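/- Let $\mathbf Z=(Z_t)_{t\ge0}$ be a real-valued process on a probability space, with natural filtration $\mathcal F_t=\sigma(Z_s,\,s\le t)$. Call $\mathbf Z$ \emph{good} if it is càdlàg with finite variation (almost surely, its paths have bounded variation on each bounded interval) and $$Z_t=Z_0+\int_0^tF_{u-}\,dA_u+\int_0^tG_{u-}\,dM_u\qquad\text{for all }t\ge0,\ \text{a.s.}$$ (Lebesgue–Stieltjes integrals over $(0,t]$), where $F,G,A,M$ are real-valued $(\mathcal F_t)$-adapted càdlàg finite variation processes such that (i) $M$ is an $(\mathcal F_t)$-martingale whose angle bracket (the right-continuous predictable increasing process $\langle M\rangle$, null at $0$, such that $M^2-\langle M\rangle$ is a local martingale) is $\langle M\rangle_t=\int_0^t\Lambda_u\,du$ for some non-negative $(\mathcal F_t)$-adapted process $\Lambda$; (ii) $A_t=A_t^+-A_t^-$, where $A^+,A^-$ are $(\mathcal F_t)$-adapted and increasing in $t$; set $\mathrm{Va}_t(A)=A_t^++A_t^-$; (iii) for each $t>0$, $\Delta A_t\,\Delta M_t=0$ almost surely, where $\Delta X_t=X_t-X_{t-}$ and $\Delta X_0=0$; (iv) there is a deterministic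 constant $K$ such that almost surely $\max\{|Z_t|,\int_0^tG_u^2\Lambda_u\,du\}\le K$ for all $t\ge0$. \textbf{Theorem.} Let $\mathbf Z$ be good, let $\varrho\in\mathbb R$, and let $(\Gamma_t)_{t\ge0}$ be events with $\Gamma_t\in\mathcal F_t$ and $\bigcap_{s\ge t}\Gamma_s=\bigcap_{s\in[t,\infty)\cap\mathbb Q}\Gamma_s$ for all $t\ge0$, and such that, up to a null set, $$\Gamma:=\bigcup_{n=1}^\infty\bigcap_{t\ge n}\Gamma_t\subseteq\Big\{\lim_{t\to\infty}Z_t=\varrho\Big\}.$$ Suppose that there are $(\mathcal F_t)$-adapted processes $\alpha,\widetilde\alpha,\beta$ such that, almost surely, $t\mapsto\alpha_t>0$ and $t\mapsto\beta_t\ge0$ are non-increasing, $$\alpha_t=\int_t^\infty\widetilde\alpha_u\,du,\qquad \max\Big\{|\Delta Z_t|,\ \int_{(t,\infty)}|F_{u-}|\,d\mathrm{Va}_u(A)\Big\}\le\beta_t\quad\text{for all }t\ge0,\qquad \lim_{t\to\infty}\frac{\beta_t}{\sqrt{\alpha_t}}=0.$$ Suppose finally that there is a deterministic constant $\kappa\in[1,\infty)$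 such that, almost surely, for every $t\ge0$, $$\frac1\kappa\,\widetilde\alpha_t\le G_t^2\Lambda_t\le\kappa\,\widetilde\alpha_t\quad\text{on the event }\Gamma_t.$$ Then $\mathbb P(\Gamma)=0$. -/

import Mathlib

open MeasureTheory ProbabilityTheory Filter Set Topology
open scoped NNReal ENNReal

namespace FinVar

/-- Lebesgue measure on `[0, ∞)`. -/
noncomputable def lebesgue : Measure ℝ≥0 := (volume : Measure ℝ).comap (fun t : ℝ≥0 => (t : ℝ))

/-- A path `x : [0, ∞) → ℝ` is càdlàg: right-continuous with finite left limits.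
(At `t = 0` the left limit condition is void.) -/
def IsCadlag (x : ℝ≥0 → ℝ) : Prop :=
  ∀ t, ContinuousWithinAt x (Ici t) t ∧ ∃ l, Tendsto x (𝓝[<] t) (𝓝 l)

/-- The jump `x_t - x_{t-}` of a path; it is `0` at `t = 0`, since `Function.leftLim x 0 = x 0`. -/
noncomputable def jump (x : ℝ≥0 → ℝ) (t : ℝ≥0) : ℝ := x t - Function.leftLim x t

open scoped Classical in
/-- The Lebesgue-Stieltjes measure of an increasing path `a : [0, ∞) → ℝ`: it has mass
`a (t+) - a (s+)` on `(s, t]` and no mass at `0`. It is set to `0` if `a` is not increasing. -/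
noncomputable def stieltjesMeasure (a : ℝ≥0 → ℝ) : Measure ℝ≥0 :=
  if h : Monotone a then h.stieltjesFunction.measure else 0

/-- The total variation of the path `a` on `[0, t]`. -/
noncomputable def totalVar (a : ℝ≥0 → ℝ) (t : ℝ≥0) : ℝ := variationOnFromTo a univ 0 t

/-- The positive part `(V + a) / 2` (an increasing path) in the Jordan decomposition of `a`. -/
noncomputable def posVar (a : ℝ≥0 → ℝ) (t : ℝ≥0) : ℝ := (totalVar a t + a t) / 2

/-- The negative part `(V - a) / 2` (an increasing path) in the Jordan decomposition of `a`. -/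
noncomputable def negVar (a : ℝ≥0 → ℝ) (t : ℝ≥0) : ℝ := (totalVar a t - a t) / 2

lemma posVar_sub_negVar (a : ℝ≥0 → ℝ) (t : ℝ≥0) : posVar a t - negVar a t = a t := by
  unfold posVar negVar; ring

lemma monotone_posVar {a : ℝ≥0 → ℝ} (ha : LocallyBoundedVariationOn a univ) :
    Monotone (posVar a) := by
  intro s t hst
  have := variationOnFromTo.add_self_monotoneOn ha (mem_univ 0) (mem_univ s) (mem_univ t) hst
  simp only [Pi.add_apply] at this
  unfold posVar totalVar
  linarith

lemma monotone_negVar {a : ℝ≥0 → ℝ} (ha : LocallyBoundedVariationOn a univ) :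
    Monotone (negVar a) := by
  intro s t hst
  have := variationOnFromTo.sub_self_monotoneOn ha (mem_univ 0) (mem_univ s) (mem_univ t) hst
  simp only [Pi.sub_apply] at this
  unfold negVar totalVar
  linarith

/-- The pathwise Lebesgue-Stieltjes integral `∫_{(0, t]} f da` against a right-continuous path `a`
of locally bounded variation, through the Jordan decomposition of `a`. -/
noncomputable def stieltjesIntegral (f a : ℝ≥0 → ℝ) (t : ℝ≥0) : ℝ :=
  (∫ u in Ioc 0 t, f u ∂(stieltjesMeasure (posVar a))) -
    ∫ u in Ioc 0 t, f u ∂(stieltjesMeasure (negVar a))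

variable {Ω : Type*} {mΩ : MeasurableSpace Ω}

/-- The event `⋃_{n ≥ 1} ⋂_{t ≥ n} Γ_t`. -/
def eventuallyAlways (Γ : ℝ≥0 → Set Ω) : Set Ω :=
  ⋃ n ∈ {n : ℕ | 1 ≤ n}, ⋂ t ∈ Ici (n : ℝ≥0), Γ t

/-- Adapted càdlàg processes with finite variation, that is, whose paths have almost surely bounded
variation on each bounded time interval. -/
structure IsCadlagFV (P : Measure Ω) (𝓕 : Filtration ℝ≥0 mΩ) (X : ℝ≥0 → Ω → ℝ) : Prop where
  adapted : StronglyAdapted 𝓕 X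
  cadlag : ∀ᵐ ω ∂P, IsCadlag (fun t => X t ω)
  finiteVariation : ∀ᵐ ω ∂P, LocallyBoundedVariationOn (fun t => X t ω) univ

/-- Càdlàg local martingales. -/
structure IsLocalMartingale (P : Measure Ω) (𝓕 : Filtration ℝ≥0 mΩ) (X : ℝ≥0 → Ω → ℝ) :
    Prop where
  adapted : StronglyAdapted 𝓕 X
  cadlag : ∀ᵐ ω ∂P, IsCadlag (fun t => X t ω)
  locally_martingale : Locally (fun Y : ℝ≥0 → Ω → ℝ => Martingale Y 𝓕 P) 𝓕 X P

/-- `C` is (a version of) the angle bracket `⟨M⟩`: the right-continuous predictable increasing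
process, null at `0`, such that `M² - C` is a local martingale. -/
structure IsAngleBracket (P : Measure Ω) (𝓕 : Filtration ℝ≥0 mΩ) (M C : ℝ≥0 → Ω → ℝ) :
    Prop where
  predictable : IsStronglyPredictable 𝓕 C
  rightCts : ∀ᵐ ω ∂P, ∀ t, ContinuousWithinAt (fun s => C s ω) (Ici t) t
  increasing : ∀ᵐ ω ∂P, Monotone (fun t => C t ω)
  zero : ∀ᵐ ω ∂P, C 0 ω = 0
  localMartingale : IsLocalMartingale P 𝓕 (fun t ω => M t ω ^ 2 - C t ω)

/-- The processes `F, G, A, M`, with `⟨M⟩ = ∫ Λ du` and `A = A⁺ - A⁻` (here `Ap` and `Am`), form a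
decomposition `Z_t = Z_0 + ∫_0^t F_{u-} dA_u + ∫_0^t G_{u-} dM_u` which makes the process `Z` good
with respect to the filtration `𝓕`. -/
structure IsGood (P : Measure Ω) (𝓕 : Filtration ℝ≥0 mΩ)
    (Z F G A M Λ Ap Am : ℝ≥0 → Ω → ℝ) : Prop where
  Z_cadlagFV : IsCadlagFV P 𝓕 Z
  F_cadlagFV : IsCadlagFV P 𝓕 F
  G_cadlagFV : IsCadlagFV P 𝓕 G
  A_cadlagFV : IsCadlagFV P 𝓕 A
  M_cadlagFV : IsCadlagFV P 𝓕 M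
  decomposition : ∀ᵐ ω ∂P, ∀ t, Z t ω = Z 0 ω +
    stieltjesIntegral (Function.leftLim fun u => F u ω) (fun u => A u ω) t +
    stieltjesIntegral (Function.leftLim fun u => G u ω) (fun u => M u ω) t
  martingale : Martingale M 𝓕 P
  Λ_adapted : StronglyAdapted 𝓕 Λ
  Λ_nonneg : ∀ᵐ ω ∂P, ∀ t, 0 ≤ Λ t ω
  Λ_integrable : ∀ᵐ ω ∂P, ∀ t, IntegrableOn (fun u => Λ u ω) (Ioc 0 t) lebesgue
  angleBracket : ∃ C : ℝ≥0 → Ω → ℝ, IsAngleBracket P 𝓕 M C ∧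
    ∀ᵐ ω ∂P, ∀ t, C t ω = ∫ u in Ioc 0 t, Λ u ω ∂lebesgue
  Ap_adapted : StronglyAdapted 𝓕 Ap
  Am_adapted : StronglyAdapted 𝓕 Am
  Ap_increasing : ∀ᵐ ω ∂P, Monotone (fun t => Ap t ω)
  Am_increasing : ∀ᵐ ω ∂P, Monotone (fun t => Am t ω)
  A_eq : ∀ᵐ ω ∂P, ∀ t, A t ω = Ap t ω - Am t ω
  no_common_jump : ∀ t, 0 < t →
    ∀ᵐ ω ∂P, jump (fun u => A u ω) t * jump (fun u => M u ω) t = 0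
  bounded : ∃ K : ℝ, ∀ᵐ ω ∂P, ∀ t,
    |Z t ω| ≤ K ∧ ∫ u in Ioc 0 t, G u ω ^ 2 * Λ u ω ∂lebesgue ≤ K

end FinVar

/-! Write `N = ∫ G_{u-} dM_u` (`mart`) and `V = ∫ G_u² Λ_u du` (`quad`), and suppose that `B = ⋂_{t
≥ n} Γ_t` has positive probability. By Lévy's upward theorem there are an integer time `T` and an
event `D` of `𝓕 T`, of positive probability, on which `B` is almost certain given `𝓕 T` and `β_T` is
tiny compared with `√α_T`. Rescale by `θ = 1 / √α_T`. On `D ∩ B` the quantity `θ² (V_H - V_T)` lies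
between `1 / (2κ)` and `κ` once `H` is large: the rescaled martingale still has fluctuations of
order one to make. But the drift of `Z` after `T` is at most `β_T`, negligible after rescaling, and
`Z_H` is close to `ϱ`; so `θ (N_H - N_T)` must end close to `m = θ (ϱ - Z_T)`, a number already
known at time `T`. A martingale with small jumps and a bracket of order one is too close to Gaussian
to be steered to a prescribed point.

The contradiction is made quantitative by the compensated cosine `cos (x - m) * exp (v / 2)`, with
`x` the rescaled martingale and `v` its bracket. It starts at `cos m ≤ 1`. If `x` ends near `m`, it
ends above `1 + 1 / (8κ)`, because the exponential has grown. Its expectation, however, can increase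
only by an amount proportional to the size `δ` of the jumps (`discrete_cosine_bound`, carried to
continuous time by `mart_cosine_bound`). Since the gain would occur with probability close to one on
`D`, this is absurd (`measure_eq_zero_of_tendsto`).

The stochastic calculus needed is that increments of `N` have conditional mean zero and conditional
variance given by `V` (`mart_isometry`). It comes from left-endpoint Riemann sums: an orthogonality
computation for each sum, a passage to the limit for bounded integrands, truncation for unbounded
ones, and localization (`exists_reduces`) to reach square integrability. -/

namespace FinVar

/-! ### Measurability up to null sets and vanishing conditional means. -/

/-- An almost everywhere limit of functions that are a.e. equal to `m`-measurable functions
is a.e. equal to an `m`-measurable function. -/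
lemma aestronglyMeasurable_of_ae_limit {Ω : Type*} {m mΩ : MeasurableSpace Ω} {P : Measure Ω}
    {f : ℕ → Ω → ℝ} {g : Ω → ℝ} (hf : ∀ n, AEStronglyMeasurable[m] (f n) P)
    (h : ∀ᵐ ω ∂P, Tendsto (fun n => f n ω) atTop (𝓝 (g ω))) : AEStronglyMeasurable[m] g P := by
  refine ⟨fun ω => limUnder atTop (fun n => (hf n).mk (f n) ω),
    @StronglyMeasurable.limUnder ℕ Ω ℝ m _ _ atTop _ _ _ _
      fun n => (hf n).stronglyMeasurable_mk, ?_⟩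
  have h' : ∀ᵐ ω ∂P, ∀ n, f n ω = (hf n).mk (f n) ω := ae_all_iff.2 fun n => (hf n).ae_eq_mk
  filter_upwards [h, h'] with ω h1 h2
  simp only [h2] at h1
  exact h1.limUnder_eq.symm

/-- `Y` is integrable and has conditional mean zero given `m`. -/
def MeanZeroGiven {Ω : Type*} {mΩ : MeasurableSpace Ω} (P : Measure Ω) (m : MeasurableSpace Ω)
    (Y : Ω → ℝ) : Prop :=
  Integrable Y P ∧ P[Y|m] =ᵐ[P] 0

namespace MeanZeroGiven

variable {Ω : Type*} {m mΩ : MeasurableSpace Ω} {P : Measure Ω} {Y Y' ξ : Ω → ℝ}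

lemma mul (h : MeanZeroGiven P m Y) (hξ : AEStronglyMeasurable[m] ξ P)
    (hi : Integrable (fun ω => ξ ω * Y ω) P) : MeanZeroGiven P m (fun ω => ξ ω * Y ω) := by
  refine ⟨hi, ?_⟩
  filter_upwards [condExp_mul_of_aestronglyMeasurable_left hξ hi h.1, h.2] with ω h1 h2
  change (P[ξ * Y|m]) ω = 0
  rw [h1, Pi.mul_apply, h2]; simp

lemma integral_eq_zero [IsFiniteMeasure P] (hm : m ≤ mΩ) (h : MeanZeroGiven P m Y) :
    ∫ ω, Y ω ∂P = 0 := by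
  rw [← integral_condExp hm, integral_congr_ae h.2]; simp

lemma congr (h : MeanZeroGiven P m Y) (hY : Y =ᵐ[P] Y') : MeanZeroGiven P m Y' :=
  ⟨h.1.congr hY, (condExp_congr_ae hY.symm).trans h.2⟩

lemma add (h : MeanZeroGiven P m Y) (h' : MeanZeroGiven P m Y') :
    MeanZeroGiven P m (fun ω => Y ω + Y' ω) := by
  refine ⟨h.1.add h'.1, ?_⟩
  filter_upwards [condExp_add h.1 h'.1 m, h.2, h'.2] with ω h1 h2 h3
  change (P[Y + Y'|m]) ω = 0
  rw [h1, Pi.add_apply, h2, h3]; simp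

lemma of_setIntegral [IsFiniteMeasure P] (hm : m ≤ mΩ) (hY : Integrable Y P)
    (h : ∀ A, MeasurableSet[m] A → ∫ ω in A, Y ω ∂P = 0) : MeanZeroGiven P m Y := by
  refine ⟨hY, (ae_eq_condExp_of_forall_setIntegral_eq hm hY ?_ ?_ ?_).symm⟩
  · intro s _ _; exact integrableOn_zero
  · intro s hs _; simp [h s hs]
  · exact aestronglyMeasurable_zero

/-- Conditional expectation contracts the `L¹` norm, so the conditional mean of the limit is no
larger in `L¹` than the distance to the approximations. -/
lemma of_tendsto [IsFiniteMeasure P] {Z : ℕ → Ω → ℝ}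
    (hZ : ∀ n, MeanZeroGiven P m (Z n)) (hY : Integrable Y P)
    (h : Tendsto (fun n => eLpNorm (Z n - Y) 1 P) atTop (𝓝 0)) : MeanZeroGiven P m Y := by
  refine ⟨hY, ?_⟩
  have h1 : ∀ n, eLpNorm (P[Y|m]) 1 P ≤ eLpNorm (Z n - Y) 1 P := by
    intro n
    have : P[Y|m] =ᵐ[P] - P[Z n - Y|m] := by
      filter_upwards [condExp_sub (hZ n).1 hY m, (hZ n).2] with ω h1 h2
      simp [h1, h2]
    rw [eLpNorm_congr_ae this, eLpNorm_neg]
    exact eLpNorm_condExp_le_eLpNorm _ le_rfl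
  have h2 : eLpNorm (P[Y|m]) 1 P = 0 :=
    le_antisymm (ge_of_tendsto' h h1) bot_le
  exact (eLpNorm_eq_zero_iff integrable_condExp.aestronglyMeasurable one_ne_zero).1 h2

end MeanZeroGiven

/-! ### Uniform partitions of a time interval. -/

/-- The `i`-th point of the partition of `[s, t]` into `n + 1` intervals of equal length. -/
noncomputable def grid (s t : ℝ≥0) (n i : ℕ) : ℝ≥0 :=
  s + (t - s) * ((min i (n + 1) : ℕ) / ((n : ℝ≥0) + 1))

section grid

variable {s t : ℝ≥0} {n : ℕ}

lemma grid_zero : grid s t n 0 = s := by simp [grid]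

lemma grid_last (hst : s ≤ t) : grid s t n (n + 1) = t := by
  have : ((n : ℝ≥0) + 1) ≠ 0 := by positivity
  simp [grid, add_tsub_cancel_of_le hst]

lemma grid_mono : Monotone (grid s t n) := by
  intro i j hij
  unfold grid
  gcongr

lemma le_grid (i : ℕ) : s ≤ grid s t n i := by unfold grid; exact le_self_add

lemma grid_le (hst : s ≤ t) (i : ℕ) : grid s t n i ≤ t := by
  have : grid s t n i ≤ s + (t - s) * 1 := by
    unfold grid
    gcongr
    apply div_le_one_of_le₀ _ (by positivity)
    exact_mod_cast min_le_right _ _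
  rwa [mul_one, add_tsub_cancel_of_le hst] at this

lemma grid_succ_le (i : ℕ) : grid s t n (i + 1) ≤ grid s t n i + (t - s) / ((n : ℝ≥0) + 1) := by
  unfold grid
  rw [add_assoc]
  gcongr
  have : ((min (i + 1) (n + 1) : ℕ) : ℝ≥0) ≤ (min i (n + 1) : ℕ) + 1 := by
    exact_mod_cast (by omega)
  calc (t - s) * (((min (i + 1) (n + 1) : ℕ) : ℝ≥0) / ((n : ℝ≥0) + 1))
      ≤ (t - s) * (((min i (n + 1) : ℕ) + 1) / ((n : ℝ≥0) + 1)) := by gcongr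
    _ = _ := by rw [add_div, mul_add, mul_one_div]

lemma tendsto_mesh : Tendsto (fun n : ℕ => (t - s) / ((n : ℝ≥0) + 1)) atTop (𝓝 0) := by
  have h := (tendsto_one_div_add_atTop_nhds_zero_nat (𝕜 := ℝ≥0)).const_mul (t - s)
  simpa only [mul_one_div, mul_zero] using h

/-- Each point `u ∈ (s, t]` lies in exactly one interval of the partition. -/
lemma exists_grid {u : ℝ≥0} (hst : s ≤ t) (hu : u ∈ Ioc s t) :
    ∃ i ≤ n, u ∈ Ioc (grid s t n i) (grid s t n (i + 1)) := by
  classical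
  have hex : ∃ i, u ≤ grid s t n i := ⟨n + 1, by rw [grid_last hst]; exact hu.2⟩
  have h1 := Nat.find_spec hex
  have h0 : Nat.find hex ≠ 0 := by
    intro h0; rw [h0, grid_zero] at h1; exact absurd hu.1 (not_lt.2 h1)
  obtain ⟨i, hi⟩ := Nat.exists_eq_succ_of_ne_zero h0
  have h2 : Nat.find hex ≤ n + 1 := Nat.find_min' hex (by rw [grid_last hst]; exact hu.2)
  refine ⟨i, by omega, ?_, by rw [hi] at h1; exact h1⟩
  exact not_le.1 (Nat.find_min hex (by omega))

end grid


/-! ### Optional stopping in continuous time, by discretization of the random time. -/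

section optionalStopping

variable {Ω : Type*} {mΩ : MeasurableSpace Ω} {P : Measure Ω}

/-- The filtration of the times of the partition `grid s t n`. -/
noncomputable def gridFiltration (𝓕 : Filtration ℝ≥0 mΩ) (s t : ℝ≥0) (n : ℕ) : Filtration ℕ mΩ where
  seq := fun i => 𝓕 (grid s t n i)
  mono' _ _ hij := 𝓕.mono (grid_mono hij)
  le' _ := 𝓕.le _

/-- The first point of the partition at which `R` holds. -/
noncomputable def gridHit (R : ℝ≥0 → Set Ω) (s t : ℝ≥0) (n : ℕ) : Ω → ℕ :=
  hittingBtwn (fun i => (R (grid s t n i)).indicator (1 : Ω → ℝ)) {1} 0 (n + 1)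

lemma isStoppingTime_gridHit {𝓕 : Filtration ℝ≥0 mΩ} {R : ℝ≥0 → Set Ω}
    (hR : ∀ s, MeasurableSet[𝓕 s] (R s)) (s t : ℝ≥0) (n : ℕ) :
    IsStoppingTime (gridFiltration 𝓕 s t n) (fun ω => (gridHit R s t n ω : WithTop ℕ)) := by
  refine Adapted.isStoppingTime_hittingBtwn (fun i => ?_) (measurableSet_singleton 1)
  have h : StronglyMeasurable[𝓕 (grid s t n i)] ((R (grid s t n i)).indicator (1 : Ω → ℝ)) :=
    stronglyMeasurable_one.indicator (hR _)
  exact h.measurable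

lemma gridHit_le (R : ℝ≥0 → Set Ω) (s t : ℝ≥0) (n : ℕ) (ω : Ω) : gridHit R s t n ω ≤ n + 1 :=
  hittingBtwn_le ω

/-- The hitting index rounds `r` up to the partition, with cap `t`. The approximation of `min t r`
is therefore from above, the side on which right-continuity can be used. -/
lemma gridHit_spec {R : ℝ≥0 → Set Ω} {s t : ℝ≥0} (n : ℕ) {ω : Ω} {r : ℝ≥0} (hst : s ≤ t)
    (hr : ∀ u, ω ∈ R u ↔ r ≤ u) :
    (r ≤ s → grid s t n (gridHit R s t n ω) = s) ∧
    (s < r → grid s t n (gridHit R s t n ω) ∈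
      Icc (min t r) (min t r + (t - s) / ((n : ℝ≥0) + 1))) := by
  have hmem : ∀ i, (R (grid s t n i)).indicator (1 : Ω → ℝ) ω ∈ ({1} : Set ℝ) ↔
      r ≤ grid s t n i := by
    intro i
    rw [← hr]
    by_cases h : ω ∈ R (grid s t n i) <;> simp [h]
  constructor
  · intro hrs
    have : gridHit R s t n ω ≤ 0 := by
      refine hittingBtwn_le_of_mem le_rfl (Nat.zero_le _) ?_
      rw [hmem, grid_zero]; exact hrs
    rw [Nat.le_zero.1 this, grid_zero]
  · intro hrs
    have hlt : ∀ j, j < gridHit R s t n ω → grid s t n j < r := by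
      intro j hj
      by_contra hcon
      have : gridHit R s t n ω ≤ j := hittingBtwn_le_of_mem (Nat.zero_le _)
        (hj.le.trans (gridHit_le ..)) ((hmem j).2 (not_lt.1 hcon))
      omega
    constructor
    · rcases (gridHit_le R s t n ω).lt_or_eq with h | h
      · have := hittingBtwn_mem_set_of_hittingBtwn_lt h
        exact (min_le_right _ _).trans ((hmem _).1 this)
      · rw [h, grid_last hst]; exact min_le_left _ _
    · rcases Nat.eq_zero_or_pos (gridHit R s t n ω) with h | h
      · rw [h, grid_zero]
        exact (le_min hst hrs.le).trans le_self_add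
      · obtain ⟨j, hj⟩ := Nat.exists_eq_succ_of_ne_zero h.ne'
        have h1 := hlt j (by omega)
        rw [hj]
        refine (grid_succ_le j).trans ?_
        gcongr
        exact le_min (grid_le hst j) h1.le

/-- Optional stopping in continuous time: the increments of a right-continuous martingale stopped
at a random time `ρ` such that `{ρ ≤ s}` is, up to a null set, an event of `𝓕 s`. -/
lemma meanZeroGiven_stopped_increment [IsProbabilityMeasure P] {𝓕 : Filtration ℝ≥0 mΩ}
    {X : ℝ≥0 → Ω → ℝ} (hX : Martingale X 𝓕 P)
    (hrc : ∀ᵐ ω ∂P, ∀ t, ContinuousWithinAt (fun s => X s ω) (Ici t) t)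
    {R : ℝ≥0 → Set Ω} (hR : ∀ s, MeasurableSet[𝓕 s] (R s)) {ρ : Ω → ℝ≥0}
    (hρ : ∀ᵐ ω ∂P, ∀ s, ω ∈ R s ↔ ρ ω ≤ s) {s t : ℝ≥0} (hst : s ≤ t) :
    MeanZeroGiven P (𝓕 s) (fun ω => X (min t (ρ ω)) ω - X (min s (ρ ω)) ω) ∧
      AEStronglyMeasurable[𝓕 t] (fun ω => X (min t (ρ ω)) ω - X (min s (ρ ω)) ω) P := by
  set W : ℕ → Ω → ℝ := fun n ω => X (grid s t n (gridHit R s t n ω)) ω with hW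
  set Y : Ω → ℝ := fun ω => X (min t (ρ ω)) ω - X (min s (ρ ω)) ω with hY
  have hmart : ∀ n, Martingale (fun i => X (grid s t n i)) (gridFiltration 𝓕 s t n) P := by
    intro n
    exact ⟨fun i => hX.stronglyAdapted _, fun i j hij => hX.condExp_ae_eq (grid_mono hij)⟩
  have hτ := fun n => isStoppingTime_gridHit hR s t n
  have hsv : ∀ n, stoppedValue (fun i => X (grid s t n i))
      (fun ω => (gridHit R s t n ω : WithTop ℕ)) = W n := fun n => rfl
  have hτle : ∀ n, ∀ ω, (gridHit R s t n ω : WithTop ℕ) ≤ ((n + 1 : ℕ) : WithTop ℕ) := by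
    intro n ω; exact_mod_cast gridHit_le R s t n ω
  have hle : ∀ n, (hτ n).measurableSpace ≤ mΩ := fun n => (hτ n).measurableSpace_le
  -- Discrete optional stopping exhibits each `W n` as a conditional expectation of the single
  -- variable `X t`; this gives uniform integrability and turns the almost sure limit into an `L¹`
  -- limit.
  have hWc : ∀ n, W n =ᵐ[P] P[X t|(hτ n).measurableSpace] := by
    intro n
    have := (hmart n).stoppedValue_ae_eq_condExp_of_le_const (hτ n) (hτle n)
    rw [hsv] at this
    simpa only [Nat.cast_id, grid_last hst] using this
  have hWs : ∀ n, P[W n|𝓕 s] =ᵐ[P] X s := by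
    intro n
    have h0 : 𝓕 s ≤ (hτ n).measurableSpace := by
      have := (hτ n).le_measurableSpace_of_const_le (i := 0) (fun ω => by exact bot_le)
      have h00 : gridFiltration 𝓕 s t n 0 = 𝓕 s := by
        change 𝓕 (grid s t n 0) = 𝓕 s
        rw [grid_zero]
      rwa [h00] at this
    exact (condExp_congr_ae (hWc n)).trans ((condExp_condExp_of_le h0 (hle n)).trans
      (hX.condExp_ae_eq hst))
  have hUI : UniformIntegrable W 1 P :=
    ((hX.integrable t).uniformIntegrable_condExp hle).ae_eq fun n => (hWc n).symm
  have hUI' : UniformIntegrable (fun n => W n - X s) 1 P := by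
    refine ⟨fun n => (hUI.1 n).sub (hX.integrable s).1, hUI.2.1.sub ?_ le_rfl ?_ ?_, ?_⟩
    · exact unifIntegrable_const le_rfl ENNReal.one_ne_top (memLp_one_iff_integrable.2 (hX.integrable s))
    · exact hUI.1
    · exact fun _ => (hX.integrable s).1
    · obtain ⟨C, hC⟩ := hUI.2.2
      refine ⟨C + (eLpNorm (X s) 1 P).toNNReal, fun n => ?_⟩
      refine (eLpNorm_sub_le (hUI.1 n) (hX.integrable s).1 le_rfl).trans ?_
      push_cast
      rw [ENNReal.coe_toNNReal (memLp_one_iff_integrable.2 (hX.integrable s)).2.ne]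
      exact add_le_add (hC n) le_rfl
  have hlim : ∀ᵐ ω ∂P, Tendsto (fun n => (W n - X s) ω) atTop (𝓝 (Y ω)) := by
    filter_upwards [hrc, hρ] with ω h1 h2
    rcases le_or_gt (ρ ω) s with h | h
    · have h3 : ∀ n, (W n - X s) ω = 0 := by
        intro n
        simp only [hW, Pi.sub_apply]
        rw [(gridHit_spec n hst h2).1 h, sub_self]
      have h4 : Y ω = 0 := by
        simp only [hY]; rw [min_eq_right h, min_eq_right (h.trans hst), sub_self]
      simp only [h3, h4]; exact tendsto_const_nhds
    · have h3 : Tendsto (fun n => grid s t n (gridHit R s t n ω)) atTop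
          (𝓝[≥] (min t (ρ ω))) := by
        refine tendsto_nhdsWithin_iff.2 ⟨?_, Eventually.of_forall fun n =>
          ((gridHit_spec n hst h2).2 h).1⟩
        refine tendsto_of_tendsto_of_tendsto_of_le_of_le tendsto_const_nhds ?_
          (fun n => ((gridHit_spec n hst h2).2 h).1) (fun n => ((gridHit_spec n hst h2).2 h).2)
        simpa using (tendsto_const_nhds (x := min t (ρ ω))).add (tendsto_mesh (s := s) (t := t))
      have h4 := ((h1 (min t (ρ ω))).tendsto.comp h3).sub_const (X s ω)
      simp only [hY, min_eq_left h.le]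
      exact h4
  have hYi : Integrable Y P := hUI'.integrable_of_ae_tendsto hlim
  have hY1 := tendsto_Lp_finite_of_tendsto_ae le_rfl ENNReal.one_ne_top hUI'.1
    (memLp_one_iff_integrable.2 hYi) hUI'.2.1 hlim
  refine ⟨MeanZeroGiven.of_tendsto (fun n => ⟨memLp_one_iff_integrable.1 (hUI'.memLp n), ?_⟩) hYi hY1,
    aestronglyMeasurable_of_ae_limit (f := fun n => W n - X s) (fun n => ?_) hlim⟩
  · have hWi : Integrable (W n) P := memLp_one_iff_integrable.1 (hUI.memLp n)
    have h5 := condExp_of_stronglyMeasurable (𝓕.le s) (hX.stronglyAdapted s) (hX.integrable s)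
    filter_upwards [condExp_sub hWi (hX.integrable s) (𝓕 s), hWs n] with ω h3 h4
    rw [h3, Pi.sub_apply, h4, h5]; simp
  · refine (StronglyMeasurable.sub ?_ ((hX.stronglyAdapted s).mono (𝓕.mono hst))).aestronglyMeasurable
    -- The discretized time takes finitely many values, all in `[s, t]`; splitting over them shows
    -- `𝓕 t`-measurability.
    have h5 : ∀ ω, W n ω = ∑ i ∈ Finset.range (n + 2),
        {ω | gridHit R s t n ω = i}.indicator (X (grid s t n i)) ω := by
      intro ω
      rw [Finset.sum_eq_single (gridHit R s t n ω)]
      · simp [hW]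
      · intro j _ hj; simp [hj.symm]
      · intro h; exact absurd (Finset.mem_range.2 (by have := gridHit_le R s t n ω; omega)) h
    have h6 : W n = fun ω => ∑ i ∈ Finset.range (n + 2),
        {ω | gridHit R s t n ω = i}.indicator (X (grid s t n i)) ω := funext h5
    rw [h6]
    refine Finset.stronglyMeasurable_fun_sum _ fun i _ => ?_
    refine StronglyMeasurable.indicator ((hX.stronglyAdapted _).mono (𝓕.mono (grid_le hst i))) ?_
    have h7 := (hτ n).measurableSet_eq i
    refine 𝓕.mono (grid_le (n := n) hst i) _ ?_
    have h8 : {ω | gridHit R s t n ω = i} =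
        {ω | (gridHit R s t n ω : WithTop ℕ) = ((i : ℕ) : WithTop ℕ)} := by
      ext ω; exact WithTop.coe_inj.symm
    rw [h8]
    exact h7

end optionalStopping


/-! ### Second moments: `L²` limits and discrete stochastic integrals. -/

section squareIntegrable

variable {Ω : Type*} {mΩ : MeasurableSpace Ω} {P : Measure Ω}

/-- Cauchy–Schwarz: the quadratic `x ↦ ∫ (x g + f)²` is nonnegative, so its discriminant is not
positive. -/
lemma sq_integral_mul_le {f g : Ω → ℝ} (hf : MemLp f 2 P) (hg : MemLp g 2 P) :
    (∫ ω, f ω * g ω ∂P) ^ 2 ≤ (∫ ω, f ω ^ 2 ∂P) * ∫ ω, g ω ^ 2 ∂P := by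
  have hfg : Integrable (fun ω => f ω * g ω) P := hf.integrable_mul hg
  have h : ∀ x : ℝ, 0 ≤ (∫ ω, g ω ^ 2 ∂P) * (x * x) + (2 * ∫ ω, f ω * g ω ∂P) * x +
      ∫ ω, f ω ^ 2 ∂P := by
    intro x
    have h1 : ∫ ω, (x * g ω + f ω) ^ 2 ∂P = (∫ ω, g ω ^ 2 ∂P) * (x * x) +
        (2 * ∫ ω, f ω * g ω ∂P) * x + ∫ ω, f ω ^ 2 ∂P := by
      have : ∀ ω, (x * g ω + f ω) ^ 2 = g ω ^ 2 * (x * x) + f ω * g ω * (2 * x) + f ω ^ 2 := by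
        intro ω; ring
      simp only [this]
      rw [integral_add (by exact (hg.integrable_sq.mul_const _).add (hfg.mul_const _))
        hf.integrable_sq, integral_add (hg.integrable_sq.mul_const _) (hfg.mul_const _),
        integral_mul_const, integral_mul_const]
      ring
    rw [← h1]
    exact integral_nonneg fun ω => sq_nonneg _
  have := discrim_le_zero h
  unfold discrim at this
  nlinarith

/-- Convergence in `L²` implies convergence of the second and of the first moments. -/
lemma tendsto_integral_sq_of_tendsto [IsProbabilityMeasure P] {Y : ℕ → Ω → ℝ} {J : Ω → ℝ}
    {c : ℕ → ℝ} (hY : ∀ k, MemLp (Y k) 2 P) (hJ : MemLp J 2 P)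
    (h : ∀ k, ∫ ω, (J ω - Y k ω) ^ 2 ∂P ≤ c k) (hc : Tendsto c atTop (𝓝 0)) :
    Tendsto (fun k => ∫ ω, Y k ω ^ 2 ∂P) atTop (𝓝 (∫ ω, J ω ^ 2 ∂P)) ∧
      Tendsto (fun k => ∫ ω, Y k ω ∂P) atTop (𝓝 (∫ ω, J ω ∂P)) := by
  have hE : ∀ k, MemLp (fun ω => J ω - Y k ω) 2 P := fun k => hJ.sub (hY k)
  have h0 : Tendsto (fun k => ∫ ω, (J ω - Y k ω) ^ 2 ∂P) atTop (𝓝 0) :=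
    squeeze_zero (fun k => integral_nonneg fun ω => sq_nonneg _) h hc
  -- The errors `J - Y k` tend to zero weakly as well; `f = J` gives the second moments and `f = 1`
  -- the first.
  have h1 : ∀ f : Ω → ℝ, MemLp f 2 P →
      Tendsto (fun k => ∫ ω, f ω * (J ω - Y k ω) ∂P) atTop (𝓝 0) := by
    intro f hf
    have h2 : Tendsto (fun k => (∫ ω, f ω * (J ω - Y k ω) ∂P) ^ 2) atTop (𝓝 0) := by
      refine squeeze_zero (fun k => sq_nonneg _) (fun k => sq_integral_mul_le hf (hE k)) ?_
      simpa using h0.const_mul (∫ ω, f ω ^ 2 ∂P)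
    have h3 := h2.sqrt
    simp only [Real.sqrt_sq_eq_abs, Real.sqrt_zero] at h3
    exact (tendsto_zero_iff_abs_tendsto_zero _).2 h3
  constructor
  · have h2 : ∀ k, ∫ ω, Y k ω ^ 2 ∂P = ∫ ω, J ω ^ 2 ∂P - 2 * ∫ ω, J ω * (J ω - Y k ω) ∂P +
        ∫ ω, (J ω - Y k ω) ^ 2 ∂P := by
      intro k
      have hJE : Integrable (fun ω => J ω * (J ω - Y k ω)) P := hJ.integrable_mul (hE k)
      rw [← integral_const_mul, ← integral_sub hJ.integrable_sq (hJE.const_mul 2), ← integral_add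
        (by exact hJ.integrable_sq.sub (hJE.const_mul 2)) (hE k).integrable_sq]
      refine integral_congr_ae (Eventually.of_forall fun ω => ?_)
      simp only []
      ring
    simp only [h2]
    simpa using (((h1 J hJ).const_mul 2).const_sub (∫ ω, J ω ^ 2 ∂P)).add h0
  · have h2 : ∀ k, ∫ ω, Y k ω ∂P = ∫ ω, J ω ∂P - ∫ ω, 1 * (J ω - Y k ω) ∂P := by
      intro k
      simp only [one_mul]
      rw [integral_sub (hJ.integrable one_le_two) ((hY k).integrable one_le_two)]
      ring
    simp only [h2]
    simpa using (h1 (fun _ => 1) (memLp_const 1)).const_sub (∫ ω, J ω ∂P)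

/-- Fatou's lemma for second moments. -/
lemma memLp_two_of_tendsto {X : ℕ → Ω → ℝ} {J : Ω → ℝ} {c : ℝ}
    (hX : ∀ n, MemLp (X n) 2 P) (h : ∀ᵐ ω ∂P, Tendsto (fun n => X n ω) atTop (𝓝 (J ω)))
    (hc : Tendsto (fun n => ∫ ω, X n ω ^ 2 ∂P) atTop (𝓝 c)) :
    MemLp J 2 P ∧ ∫ ω, J ω ^ 2 ∂P ≤ c := by
  have hJm : AEStronglyMeasurable J P := aestronglyMeasurable_of_tendsto_ae _ (fun n => (hX n).1) h
  have h1 : ∫⁻ ω, ENNReal.ofReal (J ω ^ 2) ∂P ≤ ENNReal.ofReal c := by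
    calc ∫⁻ ω, ENNReal.ofReal (J ω ^ 2) ∂P
        = ∫⁻ ω, liminf (fun n => ENNReal.ofReal (X n ω ^ 2)) atTop ∂P := by
          refine lintegral_congr_ae ?_
          filter_upwards [h] with ω hω
          exact ((ENNReal.tendsto_ofReal (hω.pow 2)).liminf_eq).symm
      _ ≤ liminf (fun n => ∫⁻ ω, ENNReal.ofReal (X n ω ^ 2) ∂P) atTop :=
          lintegral_liminf_le' fun n => ((hX n).1.aemeasurable.pow_const 2).ennreal_ofReal
      _ = liminf (fun n => ENNReal.ofReal (∫ ω, X n ω ^ 2 ∂P)) atTop := by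
          congr 1
          funext n
          rw [ofReal_integral_eq_lintegral_ofReal (hX n).integrable_sq
            (Eventually.of_forall fun ω => sq_nonneg _)]
      _ = ENNReal.ofReal c := (ENNReal.tendsto_ofReal hc).liminf_eq
  have hi : Integrable (fun ω => J ω ^ 2) P := by
    refine ⟨hJm.pow 2, ?_⟩
    rw [hasFiniteIntegral_iff_ofReal (Eventually.of_forall fun ω => sq_nonneg _)]
    exact h1.trans_lt ENNReal.ofReal_lt_top
  have hc0 : 0 ≤ c := ge_of_tendsto' hc fun n => integral_nonneg fun ω => sq_nonneg _
  refine ⟨(memLp_two_iff_integrable_sq hJm).2 hi, ?_⟩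
  rw [← ofReal_integral_eq_lintegral_ofReal hi (Eventually.of_forall fun ω => sq_nonneg _)] at h1
  exact (ENNReal.ofReal_le_ofReal_iff hc0).1 h1

lemma memLp_mul_of_bounded {ξ d : Ω → ℝ} {L : ℝ} (hξ : AEStronglyMeasurable ξ P)
    (hL : ∀ ω, |ξ ω| ≤ L) (hd : MemLp d 2 P) : MemLp (fun ω => ξ ω * d ω) 2 P := by
  refine MemLp.of_le_mul (c := L) hd (hξ.mul hd.1) (Eventually.of_forall fun ω => ?_)
  rw [norm_mul]
  exact mul_le_mul_of_nonneg_right (hL ω) (norm_nonneg _)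

/-- The isometry for discrete stochastic integrals: the increments `d i` have conditional mean zero
and conditional variance `P[q i | 𝓗 i]`. -/
lemma discrete_isometry [IsProbabilityMeasure P] {𝓗 : Filtration ℕ mΩ} {d q ξ : ℕ → Ω → ℝ}
    {L : ℝ} (hd : ∀ i, MeanZeroGiven P (𝓗 i) (d i)) (hd2 : ∀ i, MemLp (d i) 2 P)
    (hdm : ∀ i, AEStronglyMeasurable[𝓗 (i + 1)] (d i) P)
    (hdq : ∀ i, MeanZeroGiven P (𝓗 i) (fun ω => d i ω ^ 2 - q i ω))
    (hξ : ∀ i, AEStronglyMeasurable[𝓗 i] (ξ i) P) (hL : ∀ i ω, |ξ i ω| ≤ L) (n : ℕ) :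
    AEStronglyMeasurable[𝓗 n] (fun ω => ∑ i ∈ Finset.range n, ξ i ω * d i ω) P ∧
    MemLp (fun ω => ∑ i ∈ Finset.range n, ξ i ω * d i ω) 2 P ∧
    ∫ ω, ∑ i ∈ Finset.range n, ξ i ω * d i ω ∂P = 0 ∧
    ∫ ω, (∑ i ∈ Finset.range n, ξ i ω * d i ω) ^ 2 ∂P =
      ∫ ω, ∑ i ∈ Finset.range n, ξ i ω ^ 2 * q i ω ∂P ∧
    Integrable (fun ω => ∑ i ∈ Finset.range n, ξ i ω ^ 2 * q i ω) P := by
  have hξ' : ∀ i, AEStronglyMeasurable (ξ i) P := fun i => (hξ i).mono (𝓗.le i)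
  have hξd : ∀ i, MemLp (fun ω => ξ i ω * d i ω) 2 P := fun i =>
    memLp_mul_of_bounded (hξ' i) (hL i) (hd2 i)
  have hξd0 : ∀ i, MeanZeroGiven P (𝓗 i) (fun ω => ξ i ω * d i ω) := fun i =>
    (hd i).mul (hξ i) ((hξd i).integrable one_le_two)
  have hqi : ∀ i, Integrable (q i) P := by
    intro i
    have := (hd2 i).integrable_sq.sub (hdq i).1
    refine this.congr (Eventually.of_forall fun ω => ?_)
    simp
  have hb : ∀ i (f : Ω → ℝ), Integrable f P → Integrable (fun ω => ξ i ω ^ 2 * f ω) P := by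
    intro i f hf
    refine Integrable.bdd_mul (c := L ^ 2) hf ((hξ' i).pow 2) (Eventually.of_forall fun ω => ?_)
    rw [norm_pow]
    exact pow_le_pow_left₀ (norm_nonneg _) (hL i ω) 2
  induction n with
  | zero => simp [aestronglyMeasurable_const]
  | succ n ih =>
    obtain ⟨i1, i2, i3, i4, i5⟩ := ih
    simp only [Finset.sum_range_succ]
    refine ⟨(i1.mono (𝓗.mono n.le_succ)).add
      (((hξ n).mono (𝓗.mono n.le_succ)).mul (hdm n)), i2.add (hξd n), ?_, ?_,
      i5.add (hb n _ (hqi n))⟩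
    · rw [integral_add (i2.integrable one_le_two) ((hξd n).integrable one_le_two), i3,
        (hξd0 n).integral_eq_zero (𝓗.le n), add_zero]
    · have hcross : Integrable (fun ω => (∑ i ∈ Finset.range n, ξ i ω * d i ω) *
          (ξ n ω * d n ω)) P := i2.integrable_mul (hξd n)
      have h0 := ((hξd0 n).mul i1 hcross).integral_eq_zero (𝓗.le n)
      have hsq : Integrable (fun ω => ξ n ω ^ 2 * (d n ω ^ 2 - q n ω)) P := hb n _ (hdq n).1
      have h1 := ((hdq n).mul ((hξ n).pow 2) hsq).integral_eq_zero (𝓗.le n)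
      -- The cross term has mean zero because the earlier sum is known at step `n`, and `d n ^ 2`
      -- can be exchanged for `q n` at the cost of a term of mean zero.
      have hr : ∀ ω, ((∑ i ∈ Finset.range n, ξ i ω * d i ω) + ξ n ω * d n ω) ^ 2 =
          ((∑ i ∈ Finset.range n, ξ i ω * d i ω) ^ 2 + 2 * ((∑ i ∈ Finset.range n, ξ i ω * d i ω) *
          (ξ n ω * d n ω))) + (ξ n ω ^ 2 * (d n ω ^ 2 - q n ω) + ξ n ω ^ 2 * q n ω) := by
        intro ω; ring
      simp only [hr]
      have e1 := i2.integrable_sq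
      rw [integral_add (by exact e1.add (hcross.const_mul 2)) (by exact hsq.add (hb n _ (hqi n))),
        integral_add e1 (hcross.const_mul 2), integral_const_mul, h0,
        integral_add hsq (hb n _ (hqi n)), i4, integral_add i5 (hb n _ (hqi n))]
      simp only [Pi.pow_apply] at h1
      rw [h1]; ring

end squareIntegrable


/-! ### Lebesgue–Stieltjes measures and paths of bounded variation. -/

section paths

/-! ### Lebesgue measure on the half-line -/

lemma measurableEmbedding_coe : MeasurableEmbedding (fun t : ℝ≥0 => (t : ℝ)) :=
  MeasurableEmbedding.subtype_coe measurableSet_Ici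

lemma lebesgue_countable {s : Set ℝ≥0} (hs : s.Countable) : lebesgue s = 0 := by
  rw [lebesgue, measurableEmbedding_coe.comap_apply]
  exact (hs.image _).measure_zero _

/-! ### Stieltjes measures -/

lemma stieltjesMeasure_Ioc {a : ℝ≥0 → ℝ} (ha : Monotone a) (x y : ℝ≥0) :
    stieltjesMeasure a (Ioc x y) =
      ENNReal.ofReal (Function.rightLim a y - Function.rightLim a x) := by
  rw [stieltjesMeasure, dif_pos ha, StieltjesFunction.measure_Ioc]
  rfl

lemma stieltjesMeasure_Ioc_lt_top (a : ℝ≥0 → ℝ) (x y : ℝ≥0) :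
    stieltjesMeasure a (Ioc x y) < ∞ := by
  by_cases ha : Monotone a
  · rw [stieltjesMeasure_Ioc ha]; exact ENNReal.ofReal_lt_top
  · simp [stieltjesMeasure, ha]

lemma real_stieltjesMeasure_Ioc {a : ℝ≥0 → ℝ} (ha : Monotone a) {x y : ℝ≥0} (hxy : x ≤ y) :
    (stieltjesMeasure a).real (Ioc x y) = Function.rightLim a y - Function.rightLim a x := by
  rw [Measure.real, stieltjesMeasure_Ioc ha,
    ENNReal.toReal_ofReal (sub_nonneg.2 (ha.rightLim hxy))]

/-- The Stieltjes measures see `p` and `q` only through their right limits. No right-continuity of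
`p` and `q` separately is needed, only that of their difference. -/
lemma rightLim_sub_rightLim {p q a : ℝ≥0 → ℝ} (hp : Monotone p) (hq : Monotone q)
    (hpq : ∀ t, p t - q t = a t) {x : ℝ≥0} (hx : ContinuousWithinAt a (Ici x) x) :
    Function.rightLim p x - Function.rightLim q x = a x := by
  have h1 := (hp.tendsto_rightLim x).sub (hq.tendsto_rightLim x)
  simp only [hpq] at h1
  exact tendsto_nhds_unique h1 (hx.mono Ioi_subset_Ici_self)

/-- The increments of a right-continuous path of locally bounded variation, through its Jordan
decomposition. -/
lemma real_posVar_sub_real_negVar {a : ℝ≥0 → ℝ} (ha : LocallyBoundedVariationOn a univ)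
    (hr : ∀ t, ContinuousWithinAt a (Ici t) t) {x y : ℝ≥0} (hxy : x ≤ y) :
    (stieltjesMeasure (posVar a)).real (Ioc x y) - (stieltjesMeasure (negVar a)).real (Ioc x y) =
      a y - a x := by
  rw [real_stieltjesMeasure_Ioc (monotone_posVar ha) hxy,
    real_stieltjesMeasure_Ioc (monotone_negVar ha) hxy,
    ← rightLim_sub_rightLim (monotone_posVar ha) (monotone_negVar ha) (posVar_sub_negVar a) (hr x),
    ← rightLim_sub_rightLim (monotone_posVar ha) (monotone_negVar ha) (posVar_sub_negVar a) (hr y)]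
  ring

/-! ### Paths of locally bounded variation -/

lemma nhdsLT_neBot {u v : ℝ≥0} (h : v < u) : (𝓝[<] u).NeBot :=
  nhdsLT_neBot_of_exists_lt ⟨v, h⟩

lemma IsCadlag.tendsto_leftLim {x : ℝ≥0 → ℝ} (hx : IsCadlag x) (u : ℝ≥0) :
    Tendsto x (𝓝[<] u) (𝓝 (Function.leftLim x u)) := by
  rcases eq_or_neBot (𝓝[<] u) with h | h
  · rw [h]; exact tendsto_bot
  · obtain ⟨l, hl⟩ := (hx u).2
    rwa [leftLim_eq_of_tendsto hl]

lemma leftLim_eq_posVar_sub_negVar {x : ℝ≥0 → ℝ} (hx : LocallyBoundedVariationOn x univ)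
    (u : ℝ≥0) : Function.leftLim x u =
      Function.leftLim (posVar x) u - Function.leftLim (negVar x) u := by
  rcases eq_or_neBot (𝓝[<] u) with h | h
  · rw [leftLim_eq_of_eq_bot _ h, leftLim_eq_of_eq_bot _ h, leftLim_eq_of_eq_bot _ h,
      posVar_sub_negVar]
  · have h1 := ((monotone_posVar hx).tendsto_leftLim u).sub
      ((monotone_negVar hx).tendsto_leftLim u)
    simp only [posVar_sub_negVar] at h1
    exact leftLim_eq_of_tendsto h1

lemma measurable_of_locallyBoundedVariationOn {x : ℝ≥0 → ℝ}
    (hx : LocallyBoundedVariationOn x univ) : Measurable x := by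
  have : x = fun t => posVar x t - negVar x t := funext fun t => (posVar_sub_negVar x t).symm
  rw [this]
  exact (monotone_posVar hx).measurable.sub (monotone_negVar hx).measurable

lemma measurable_leftLim {x : ℝ≥0 → ℝ} (hx : LocallyBoundedVariationOn x univ) :
    Measurable (Function.leftLim x) := by
  have : Function.leftLim x = fun u =>
      Function.leftLim (posVar x) u - Function.leftLim (negVar x) u :=
    funext fun u => leftLim_eq_posVar_sub_negVar hx u
  rw [this]
  exact (monotone_posVar hx).leftLim.measurable.sub (monotone_negVar hx).leftLim.measurable

/-- Only countably many discontinuities exist. This is what replaces `G_{u-}` by `G_u` in integrals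
against `Λ_u du`. -/
lemma leftLim_ae_eq {x : ℝ≥0 → ℝ} (hx : LocallyBoundedVariationOn x univ) :
    Function.leftLim x =ᵐ[lebesgue] x := by
  have hc := (monotone_posVar hx).countable_not_continuousAt.union
    (monotone_negVar hx).countable_not_continuousAt
  refine measure_mono_null (fun u hu => ?_) (lebesgue_countable hc)
  by_contra hcon
  simp only [mem_union, mem_ofPred_eq, not_or, not_not] at hcon
  have h1 : ContinuousAt x u := by
    have := hcon.1.sub hcon.2
    exact this.congr (Eventually.of_forall fun t => posVar_sub_negVar x t)
  refine hu ?_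
  rcases eq_or_neBot (𝓝[<] u) with h | h
  · exact leftLim_eq_of_eq_bot _ h
  · exact leftLim_eq_of_tendsto (h1.tendsto.mono_left nhdsWithin_le_nhds)

/-- One bound per path, valid also for left limits: it dominates Riemann sums and makes truncations
eventually inactive on `[0, t]`. -/
lemma exists_bound {x : ℝ≥0 → ℝ} (hx : LocallyBoundedVariationOn x univ) (t : ℝ≥0) :
    ∃ L, 0 ≤ L ∧ ∀ u ≤ t, |x u| ≤ L ∧ |Function.leftLim x u| ≤ L := by
  set L := |posVar x 0| + |posVar x t| + |negVar x 0| + |negVar x t| with hL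
  have hm : ∀ p : ℝ≥0 → ℝ, Monotone p → ∀ u ≤ t,
      |p u| ≤ |p 0| + |p t| ∧ |Function.leftLim p u| ≤ |p 0| + |p t| := by
    intro p hp u hu
    have h1 : p 0 ≤ Function.leftLim p u := by
      rcases eq_or_ne u 0 with rfl | h0
      · rw [leftLim_eq_of_eq_bot]
        simp [nhdsWithin_empty]
      · exact hp.le_leftLim (pos_iff_ne_zero.2 h0)
    have h2 : Function.leftLim p u ≤ p u := hp.leftLim_le le_rfl
    have h3 := hp hu
    have h4 := hp (zero_le : 0 ≤ u)
    constructor <;> rw [abs_le] <;> constructor <;>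
      linarith [neg_abs_le (p 0), le_abs_self (p t), abs_nonneg (p t), abs_nonneg (p 0)]
  refine ⟨L, by positivity, fun u hu => ?_⟩
  obtain ⟨a1, a2⟩ := hm _ (monotone_posVar hx) u hu
  obtain ⟨b1, b2⟩ := hm _ (monotone_negVar hx) u hu
  constructor
  · rw [← posVar_sub_negVar x u]
    exact (abs_sub _ _).trans (by linarith)
  · rw [leftLim_eq_posVar_sub_negVar hx]
    exact (abs_sub _ _).trans (by linarith)

end paths

/-! ### Left-endpoint Riemann sums as integrals of step functions. -/

section riemann

open scoped Classical in
/-- The largest partition point strictly below `u` (or `s` if there is none). -/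
noncomputable def leftPt (s t : ℝ≥0) (n : ℕ) (u : ℝ≥0) : ℝ≥0 :=
  grid s t n (Nat.findGreatest (fun i => grid s t n i < u) n)

variable {s t : ℝ≥0}

lemma leftPt_eq {n i : ℕ} {u : ℝ≥0} (hi : i ≤ n)
    (hu : u ∈ Ioc (grid s t n i) (grid s t n (i + 1))) : leftPt s t n u = grid s t n i := by
  classical
  unfold leftPt
  congr 1
  rw [Nat.findGreatest_eq_iff]
  refine ⟨hi, fun _ => hu.1, fun j hj _ => not_lt.2 (hu.2.trans (grid_mono hj))⟩

lemma le_leftPt (n : ℕ) (u : ℝ≥0) : s ≤ leftPt s t n u := le_grid _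

lemma leftPt_le (n : ℕ) {u : ℝ≥0} (hu : s ≤ u) : leftPt s t n u ≤ u := by
  classical
  unfold leftPt
  rcases Nat.eq_zero_or_pos (Nat.findGreatest (fun i => grid s t n i < u) n) with h | h
  · rw [h, grid_zero]; exact hu
  · exact (Nat.findGreatest_of_ne_zero rfl h.ne').le

lemma leftPt_lt {n : ℕ} {u : ℝ≥0} (hst : s ≤ t) (hu : u ∈ Ioc s t) : leftPt s t n u < u := by
  obtain ⟨i, hi, h⟩ := exists_grid (n := n) hst hu
  rw [leftPt_eq hi h]; exact h.1

lemma tendsto_leftPt {u : ℝ≥0} (hst : s ≤ t) (hu : u ∈ Ioc s t) :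
    Tendsto (fun n => leftPt s t n u) atTop (𝓝[<] u) := by
  refine tendsto_nhdsWithin_iff.2 ⟨?_, Eventually.of_forall fun n => leftPt_lt hst hu⟩
  have h1 : Tendsto (fun n : ℕ => u - (t - s) / ((n : ℝ≥0) + 1)) atTop (𝓝 u) := by
    have := (tendsto_const_nhds (x := u)).sub (tendsto_mesh (s := s) (t := t))
    simpa using this
  refine tendsto_of_tendsto_of_tendsto_of_le_of_le h1 tendsto_const_nhds ?_
    (fun n => (leftPt_lt hst hu).le)
  intro n
  obtain ⟨i, hi, h⟩ := exists_grid (n := n) hst hu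
  dsimp only
  rw [leftPt_eq hi h, tsub_le_iff_right]
  exact h.2.trans (grid_succ_le i)

/-- `leftPt` is left-continuous and locally constant. -/
lemma eventually_leftPt_eq {n : ℕ} {u : ℝ≥0} (hst : s ≤ t) (hu : u ∈ Ioc s t) :
    ∀ᶠ v in 𝓝[<] u, leftPt s t n v = leftPt s t n u := by
  obtain ⟨i, hi, h⟩ := exists_grid (n := n) hst hu
  filter_upwards [Ioo_mem_nhdsLT h.1] with v hv
  rw [leftPt_eq hi h, leftPt_eq hi ⟨hv.1, hv.2.le.trans h.2⟩]

variable {μ : Measure ℝ≥0}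

/-- `φ ∘ leftPt` is constant on each cell of the partition, so a Riemann sum is an honest integral
and dominated convergence applies to it. -/
lemma integral_leftPt (hst : s ≤ t) (hμ : μ (Ioc s t) < ∞) (φ : ℝ≥0 → ℝ) (n : ℕ) :
    IntegrableOn (fun u => φ (leftPt s t n u)) (Ioc s t) μ ∧
    ∑ i ∈ Finset.range (n + 1),
      φ (grid s t n i) * μ.real (Ioc (grid s t n i) (grid s t n (i + 1))) =
      ∫ u in Ioc s t, φ (leftPt s t n u) ∂μ := by
  have key : ∀ m ≤ n + 1, IntegrableOn (fun u => φ (leftPt s t n u)) (Ioc s (grid s t n m)) μ ∧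
      ∑ i ∈ Finset.range m,
        φ (grid s t n i) * μ.real (Ioc (grid s t n i) (grid s t n (i + 1))) =
      ∫ u in Ioc s (grid s t n m), φ (leftPt s t n u) ∂μ := by
    intro m
    induction m with
    | zero => intro _; simp [grid_zero]
    | succ m ih =>
      intro hm
      obtain ⟨h1, h2⟩ := ih (by omega)
      have hU : Ioc s (grid s t n (m + 1)) =
          Ioc s (grid s t n m) ∪ Ioc (grid s t n m) (grid s t n (m + 1)) :=
        (Ioc_union_Ioc_eq_Ioc (le_grid m) (grid_mono m.le_succ)).symm
      have hfin : μ (Ioc (grid s t n m) (grid s t n (m + 1))) < ∞ :=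
        (measure_mono (Ioc_subset_Ioc (le_grid m) (grid_le hst _))).trans_lt hμ
      have hcst : EqOn (fun u => φ (leftPt s t n u)) (fun _ => φ (grid s t n m))
          (Ioc (grid s t n m) (grid s t n (m + 1))) := fun u hu => by
        simp only [leftPt_eq (by omega : m ≤ n) hu]
      have h3 : IntegrableOn (fun u => φ (leftPt s t n u))
          (Ioc (grid s t n m) (grid s t n (m + 1))) μ :=
        (integrableOn_congr_fun hcst measurableSet_Ioc).2 (integrableOn_const hfin.ne)
      refine ⟨hU ▸ h1.union h3, ?_⟩
      rw [Finset.sum_range_succ, h2, hU, setIntegral_union (Ioc_disjoint_Ioc_of_le le_rfl)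
        measurableSet_Ioc h1 h3, setIntegral_congr_fun measurableSet_Ioc hcst, setIntegral_const,
        smul_eq_mul, mul_comm (φ _)]
  have := key (n + 1) le_rfl
  rwa [grid_last hst] at this

/-- Riemann sums at left endpoints converge to the integral of the left limit. -/
lemma tendsto_riemann_sum (hst : s ≤ t) (hμ : μ (Ioc s t) < ∞) {φ φ' : ℝ≥0 → ℝ} {L : ℝ}
    (hL : ∀ u ∈ Icc s t, |φ u| ≤ L)
    (hφ : ∀ u ∈ Ioc s t, Tendsto φ (𝓝[<] u) (𝓝 (φ' u))) :
    Tendsto (fun n => ∑ i ∈ Finset.range (n + 1),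
      φ (grid s t n i) * μ.real (Ioc (grid s t n i) (grid s t n (i + 1)))) atTop
      (𝓝 (∫ u in Ioc s t, φ' u ∂μ)) := by
  simp only [fun n => (integral_leftPt hst hμ φ n).2]
  refine tendsto_integral_of_dominated_convergence (fun _ => L)
    (fun n => (integral_leftPt hst hμ φ n).1.1) (integrableOn_const hμ.ne) (fun n => ?_) ?_
  · refine (ae_restrict_iff' measurableSet_Ioc).2 (Eventually.of_forall fun u hu => ?_)
    exact hL _ ⟨le_leftPt _ _, (leftPt_lt hst hu).le.trans hu.2⟩
  · refine (ae_restrict_iff' measurableSet_Ioc).2 (Eventually.of_forall fun u hu => ?_)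
    exact (hφ u hu).comp (tendsto_leftPt hst hu)

end riemann


/-! ### Localization to square-integrable martingales with bounded bracket. -/

section localization

variable {Ω : Type*} {mΩ : MeasurableSpace Ω} {P : Measure Ω}

/-- The random time `ρ` reduces `M` to a square-integrable martingale with bracket `C` stopped
at `ρ`, and `C` is bounded by `c` up to the time `ρ`. -/
structure Reduces (P : Measure Ω) (𝓕 : Filtration ℝ≥0 mΩ) (M C : ℝ≥0 → Ω → ℝ) (ρ : Ω → ℝ≥0)
    (c : ℝ) : Prop where
  bound : ∀ᵐ ω ∂P, ∀ t, C (min t (ρ ω)) ω ≤ c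
  meanZero : ∀ s t, s ≤ t →
    MeanZeroGiven P (𝓕 s) (fun ω => M (min t (ρ ω)) ω - M (min s (ρ ω)) ω)
  memLp : ∀ s t, s ≤ t → MemLp (fun ω => M (min t (ρ ω)) ω - M (min s (ρ ω)) ω) 2 P
  meas : ∀ s t, s ≤ t →
    AEStronglyMeasurable[𝓕 t] (fun ω => M (min t (ρ ω)) ω - M (min s (ρ ω)) ω) P
  bracket : ∀ s t, s ≤ t → MeanZeroGiven P (𝓕 s)
    (fun ω => (M (min t (ρ ω)) ω - M (min s (ρ ω)) ω) ^ 2 -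
      (C (min t (ρ ω)) ω - C (min s (ρ ω)) ω))

lemma stoppedProcess_of_le {X : ℝ≥0 → Ω → ℝ} {τ : Ω → WithTop ℝ≥0} {t : ℝ≥0} {ω : Ω}
    (h : (t : WithTop ℝ≥0) ≤ τ ω) : stoppedProcess X τ t ω = X t ω := by
  simp only [stoppedProcess, min_eq_left h]
  rfl

lemma stoppedProcess_of_ge {X : ℝ≥0 → Ω → ℝ} {τ : Ω → WithTop ℝ≥0} {t r : ℝ≥0} {ω : Ω}
    (hr : τ ω = r) (h : r ≤ t) : stoppedProcess X τ t ω = X r ω := by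
  have h' : (r : WithTop ℝ≥0) ≤ t := by exact_mod_cast h
  simp only [stoppedProcess, hr, min_eq_right h']
  rfl

lemma continuousWithinAt_stoppedProcess {X : ℝ≥0 → Ω → ℝ} {τ : Ω → WithTop ℝ≥0} {ω : Ω}
    (h : ∀ t, ContinuousWithinAt (fun s => X s ω) (Ici t) t) (t : ℝ≥0) :
    ContinuousWithinAt (fun s => stoppedProcess X τ s ω) (Ici t) t := by
  cases hτ : τ ω with
  | top =>
    have : (fun s => stoppedProcess X τ s ω) = fun s => X s ω := by
      funext s; exact stoppedProcess_of_le (by rw [hτ]; exact le_top)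
    rw [this]; exact h t
  | coe r =>
    rcases lt_or_ge t r with h1 | h1
    · refine (h t).congr_of_eventuallyEq ?_ (stoppedProcess_of_le (by rw [hτ]; exact_mod_cast h1.le))
      filter_upwards [mem_nhdsWithin_of_mem_nhds (Iio_mem_nhds h1)] with s hs
      exact stoppedProcess_of_le (by rw [hτ]; exact_mod_cast (le_of_lt hs))
    · refine (continuousWithinAt_const (b := X r ω)).congr (fun s hs => ?_) ?_
      · exact stoppedProcess_of_ge hτ (h1.trans hs)
      · exact stoppedProcess_of_ge hτ h1

/-- The first time at which `τ` has passed, or `C` has reached `c`, or the time is `c`. -/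
noncomputable def truncTime (τ : Ω → WithTop ℝ≥0) (C : ℝ≥0 → Ω → ℝ) (p : ℕ) (ω : Ω) : ℝ≥0 :=
  sInf {s : ℝ≥0 | τ ω ≤ s ∨ (p : ℝ) ≤ C s ω ∨ (p : ℝ≥0) ≤ s}

/-- Continuity of `C` closes the set, so the infimum is attained; monotonicity makes it an up-set.
The left-hand side is an event of `𝓕 s`, the form required by `meanZeroGiven_stopped_increment`. -/
lemma truncTime_le_iff {τ : Ω → WithTop ℝ≥0} {C : ℝ≥0 → Ω → ℝ} {p : ℕ} {ω : Ω}
    (hm : Monotone fun t => C t ω) (hc : Continuous fun t => C t ω) (s : ℝ≥0) :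
    (τ ω ≤ s ∨ (p : ℝ) ≤ C s ω ∨ (p : ℝ≥0) ≤ s) ↔ truncTime τ C p ω ≤ s := by
  set S := {s : ℝ≥0 | τ ω ≤ s ∨ (p : ℝ) ≤ C s ω ∨ (p : ℝ≥0) ≤ s} with hS
  have hcl : IsClosed S := by
    have h1 : IsClosed {s : ℝ≥0 | τ ω ≤ s} := by
      cases hτ : τ ω with
      | top =>
        have : {s : ℝ≥0 | (⊤ : WithTop ℝ≥0) ≤ s} = ∅ := by
          ext s
          simp only [mem_ofPred_eq, mem_empty_iff_false, iff_false, not_le]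
          exact WithTop.coe_lt_top s
        rw [this]; exact isClosed_empty
      | coe r =>
        have : {s : ℝ≥0 | (r : WithTop ℝ≥0) ≤ s} = Ici r := by
          ext s; exact WithTop.coe_le_coe
        rw [this]; exact isClosed_Ici
    exact h1.union ((isClosed_le continuous_const hc).union isClosed_Ici)
  have hmem : sInf S ∈ S := hcl.csInf_mem ⟨p, Or.inr (Or.inr le_rfl)⟩ (OrderBot.bddBelow S)
  constructor
  · intro h; exact csInf_le (OrderBot.bddBelow S) h
  · intro h
    rcases hmem with h1 | h1 | h1
    · exact Or.inl (h1.trans (by exact_mod_cast h))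
    · exact Or.inr (Or.inl (h1.trans (hm h)))
    · exact Or.inr (Or.inr (h1.trans h))

/-- Up to `ρ` the bracket is at most `p`, so the stopped `M²` is an integrable martingale value plus
a bounded term. Optional stopping at `ρ` is applied both to `M` and to the localized `M² - C`. The
localized process carries the indicator of `{0 < τ}`, and off this event `ρ = 0`, so that all
increments vanish. -/
lemma reduces_truncTime [IsProbabilityMeasure P] {𝓕 : Filtration ℝ≥0 mΩ} {M C : ℝ≥0 → Ω → ℝ}
    (hM : Martingale M 𝓕 P)
    (hMr : ∀ᵐ ω ∂P, ∀ t, ContinuousWithinAt (fun s => M s ω) (Ici t) t)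
    (hCa : StronglyAdapted 𝓕 C) (hCc : ∀ᵐ ω ∂P, Continuous fun t => C t ω)
    (hCm : ∀ᵐ ω ∂P, Monotone fun t => C t ω) (hC0 : ∀ᵐ ω ∂P, C 0 ω = 0)
    {τ : Ω → WithTop ℝ≥0} (hτ : IsStoppingTime 𝓕 τ)
    (hY : Martingale (stoppedProcess
      (fun t => {ω | ⊥ < τ ω}.indicator (fun ω => M t ω ^ 2 - C t ω)) τ) 𝓕 P) (p : ℕ) :
    Reduces P 𝓕 M C (truncTime τ C p) p := by
  set ρ := truncTime τ C p with hρdef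
  set R : ℝ≥0 → Set Ω := fun s => {ω | τ ω ≤ s ∨ (p : ℝ) ≤ C s ω ∨ (p : ℝ≥0) ≤ s} with hRdef
  set χ : Set Ω := {ω | ⊥ < τ ω} with hχ
  set Y := stoppedProcess (fun t => χ.indicator (fun ω => M t ω ^ 2 - C t ω)) τ with hYdef
  have hR : ∀ s, MeasurableSet[𝓕 s] (R s) := by
    intro s
    refine MeasurableSet.union (hτ s) (MeasurableSet.union ?_ (MeasurableSet.const _))
    exact (hCa s).measurable measurableSet_Ici
  have hρ : ∀ᵐ ω ∂P, ∀ s, ω ∈ R s ↔ ρ ω ≤ s := by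
    filter_upwards [hCc, hCm] with ω h1 h2 s
    exact truncTime_le_iff h2 h1 s
  have hYr : ∀ᵐ ω ∂P, ∀ t, ContinuousWithinAt (fun s => Y s ω) (Ici t) t := by
    filter_upwards [hMr, hCc] with ω h1 h2 t
    refine continuousWithinAt_stoppedProcess (fun t => ?_) t
    by_cases hω : ω ∈ χ
    · simp only [indicator_of_mem hω]
      exact ((h1 t).pow 2).sub h2.continuousWithinAt
    · simp only [indicator_of_notMem hω]
      exact continuousWithinAt_const
  have hχm : MeasurableSet[𝓕 0] χ := by
    have : χ = {ω | τ ω ≤ ((0 : ℝ≥0) : WithTop ℝ≥0)}ᶜ := by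
      ext ω; simp only [hχ, mem_ofPred_eq, mem_compl_iff, not_le]; rfl
    rw [this]; exact (hτ 0).compl
  -- on the complement of `χ` the stopped processes are constant
  have hρτ : ∀ᵐ ω ∂P, (ρ ω : WithTop ℝ≥0) ≤ τ ω := by
    filter_upwards [hρ] with ω h
    cases hτ : τ ω with
    | top => exact le_top
    | coe r => exact_mod_cast (h r).1 (Or.inl hτ.le)
  have hYρ : ∀ᵐ ω ∂P, ∀ t, Y (min t (ρ ω)) ω =
      χ.indicator (fun ω => M (min t (ρ ω)) ω ^ 2 - C (min t (ρ ω)) ω) ω := by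
    filter_upwards [hρτ] with ω h t
    have : ((min t (ρ ω) : ℝ≥0) : WithTop ℝ≥0) ≤ τ ω :=
      (WithTop.coe_le_coe.2 (min_le_right _ _)).trans h
    rw [hYdef, stoppedProcess_of_le this]
    by_cases hω : ω ∈ χ
    · simp only [indicator_of_mem hω]
    · simp only [indicator_of_notMem hω]
  have hχ0 : ∀ᵐ ω ∂P, ω ∉ χ → ρ ω = 0 := by
    filter_upwards [hρτ] with ω h hω
    have h1 : τ ω = ⊥ := not_bot_lt_iff.1 hω
    rw [h1] at h
    have h2 : ((ρ ω : ℝ≥0) : WithTop ℝ≥0) ≤ ((0 : ℝ≥0) : WithTop ℝ≥0) := h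
    exact le_antisymm (WithTop.coe_le_coe.1 h2) zero_le
  have hbound : ∀ᵐ ω ∂P, ∀ t, C (min t (ρ ω)) ω ≤ p := by
    filter_upwards [hCc, hC0, hρ] with ω h1 h2 h3 t
    -- If `C` exceeded `p` by time `min t ρ`, continuity would make it exceed `p` strictly earlier,
    -- before `ρ`.
    by_contra! hcon
    have hpos : min t (ρ ω) ≠ 0 := by
      intro h0; rw [h0, h2] at hcon; exact absurd hcon (not_lt.2 (Nat.cast_nonneg p))
    have hne : (𝓝[<] (min t (ρ ω))).NeBot := nhdsLT_neBot (pos_iff_ne_zero.2 hpos)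
    have h4 : ∀ᶠ v in 𝓝[<] (min t (ρ ω)), (p : ℝ) < C v ω :=
      (h1.continuousAt.mono_left nhdsWithin_le_nhds).eventually (lt_mem_nhds hcon)
    obtain ⟨v, hv1, hv2⟩ := (h4.and self_mem_nhdsWithin).exists
    have h5 := (h3 v).1 (Or.inr (Or.inl hv1.le))
    exact absurd (lt_of_lt_of_le hv2 (min_le_right _ _)) (not_lt.2 h5)
  have hOM := fun s t (hst : s ≤ t) => meanZeroGiven_stopped_increment hM hMr hR hρ hst
  have hOY := fun s t (hst : s ≤ t) => meanZeroGiven_stopped_increment hY hYr hR hρ hst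
  -- The stopped martingale is cut to `χ` since `M 0` need not be square integrable off `χ`; its
  -- increments are unaffected.
  set w : ℝ≥0 → Ω → ℝ := fun t => χ.indicator (fun ω => M (min t (ρ ω)) ω) with hw
  have hwm : ∀ t, AEStronglyMeasurable[𝓕 t] (w t) P := by
    intro t
    have h1 := (hOM 0 t zero_le).2
    have h2 : AEStronglyMeasurable[𝓕 t] (M 0) P :=
      ((hM.stronglyAdapted 0).mono (𝓕.mono zero_le)).aestronglyMeasurable
    have h3 : StronglyMeasurable[𝓕 t] (χ.indicator (1 : Ω → ℝ)) :=
      stronglyMeasurable_one.indicator (𝓕.mono (zero_le : 0 ≤ t) _ hχm)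
    refine (h3.aestronglyMeasurable.mul (h1.add h2)).congr (Eventually.of_forall fun ω => ?_)
    by_cases hω : ω ∈ χ
    · simp [hw, hω]
    · simp [hw, hω]
  have hw2 : ∀ t, MemLp (w t) 2 P := by
    intro t
    have hwm' := (hwm t).mono (𝓕.le t)
    refine (memLp_two_iff_integrable_sq hwm').2 ?_
    have h1 : Integrable (fun ω => Y (min t (ρ ω)) ω) P := by
      have := (hOY 0 t zero_le).1.1.add (hY.integrable 0)
      refine this.congr (Eventually.of_forall fun ω => ?_)
      simp
    have h2 : Integrable (fun ω => w t ω ^ 2 - Y (min t (ρ ω)) ω) P := by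
      refine Integrable.of_bound ((hwm'.pow 2).sub h1.1) (p : ℝ) ?_
      filter_upwards [hYρ, hbound, hCm, hC0] with ω h3 h4 h5 h6
      rw [h3]
      have h7 : 0 ≤ C (min t (ρ ω)) ω := h6 ▸ h5 zero_le
      by_cases hω : ω ∈ χ
      · simp only [hw, indicator_of_mem hω, sub_sub_cancel, Real.norm_eq_abs, abs_of_nonneg h7]
        exact h4 t
      · simp [hw, indicator_of_notMem hω]
    refine (h2.add h1).congr (Eventually.of_forall fun ω => ?_)
    simp
  have hinc : ∀ s t, (fun ω => w t ω - w s ω) =ᵐ[P]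
      fun ω => M (min t (ρ ω)) ω - M (min s (ρ ω)) ω := by
    intro s t
    filter_upwards [hχ0] with ω h
    by_cases hω : ω ∈ χ
    · simp [hw, indicator_of_mem hω]
    · simp [hw, indicator_of_notMem hω, h hω]
  have hmem : ∀ s t, MemLp (fun ω => M (min t (ρ ω)) ω - M (min s (ρ ω)) ω) 2 P := fun s t =>
    ((hw2 t).sub (hw2 s)).ae_eq (hinc s t)
  refine ⟨hbound, fun s t hst => (hOM s t hst).1, fun s t _ => hmem s t,
    fun s t hst => (hOM s t hst).2, fun s t hst => ?_⟩
  -- From `(w_t - w_s)² = w_t² - w_s² - 2 w_s (w_t - w_s)`: the last term has conditional mean zero,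
  -- the rest is handled by `M² - C`.
  have h1 : MeanZeroGiven P (𝓕 s)
      (fun ω => (-2 * w s ω) * (M (min t (ρ ω)) ω - M (min s (ρ ω)) ω)) := by
    refine (hOM s t hst).1.mul ((hwm s).const_mul (-2)) ?_
    have := ((hw2 s).integrable_mul (hmem s t)).const_mul (-2)
    refine this.congr (Eventually.of_forall fun ω => ?_)
    simp; ring
  refine ((hOY s t hst).1.add h1).congr ?_
  filter_upwards [hYρ, hχ0] with ω h2 h3
  rw [h2, h2]
  by_cases hω : ω ∈ χ
  · simp only [hw, indicator_of_mem hω]; ring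
  · simp [hw, indicator_of_notMem hω, h3 hω]

/-- A localizing sequence for a martingale with continuous angle bracket. -/
lemma exists_reduces [IsProbabilityMeasure P] {𝓕 : Filtration ℝ≥0 mΩ} {M C : ℝ≥0 → Ω → ℝ}
    (hM : Martingale M 𝓕 P)
    (hMr : ∀ᵐ ω ∂P, ∀ t, ContinuousWithinAt (fun s => M s ω) (Ici t) t)
    (hC : IsAngleBracket P 𝓕 M C) (hCc : ∀ᵐ ω ∂P, Continuous fun t => C t ω) :
    ∃ ρ : ℕ → Ω → ℝ≥0, (∀ᵐ ω ∂P, ∀ t, ∀ᶠ p in atTop, t ≤ ρ p ω) ∧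
      ∀ p, Reduces P 𝓕 M C (ρ p) p := by
  obtain ⟨τ, hτ, hY⟩ := hC.localMartingale.locally_martingale
  refine ⟨fun p => truncTime (τ p) C p, ?_, fun p => reduces_truncTime hM hMr
    hC.predictable.stronglyAdapted hCc hC.increasing hC.zero (hτ.isStoppingTime p) (hY p) p⟩
  filter_upwards [hτ.tendsto_top, hCc, hC.increasing] with ω h1 h2 h3 t
  have e1 : ∀ᶠ p in atTop, ((t : ℝ≥0) : WithTop ℝ≥0) < τ p ω :=
    h1.eventually (lt_mem_nhds (WithTop.coe_lt_top t))
  have e2 : ∀ᶠ p : ℕ in atTop, C t ω < p := by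
    filter_upwards [eventually_gt_atTop ⌈C t ω⌉₊] with p hp
    exact (Nat.le_ceil _).trans_lt (by exact_mod_cast hp)
  have e3 : ∀ᶠ p : ℕ in atTop, t < p := by
    filter_upwards [eventually_gt_atTop ⌈t⌉₊] with p hp
    exact (Nat.le_ceil _).trans_lt (by exact_mod_cast hp)
  filter_upwards [e1, e2, e3] with p h4 h5 h6
  by_contra! hcon
  rcases (truncTime_le_iff h3 h2 t).2 hcon.le with h | h | h
  · exact absurd h4 (not_lt.2 h)
  · exact absurd h5 (not_lt.2 h)
  · exact absurd h6 (not_lt.2 h)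

end localization


/-! ### Riemann sums and integrals against a stopped path. -/

section riemannSums

/-- The Riemann sum, at left endpoints, of `φ` against the path `a` stopped at time `r`. -/
noncomputable def rsum (φ a : ℝ≥0 → ℝ) (s t r : ℝ≥0) (n : ℕ) : ℝ :=
  ∑ i ∈ Finset.range (n + 1), φ (grid s t n i) *
    (a (min (grid s t n (i + 1)) r) - a (min (grid s t n i) r))

/-- The integral of `f` over `(s, t] ∩ [0, r]` against the path `a`. -/
noncomputable def stoppedIntegral (f a : ℝ≥0 → ℝ) (s t r : ℝ≥0) : ℝ :=
  (∫ u in Ioc s t, f u ∂((stieltjesMeasure (posVar a)).restrict (Iic r))) -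
    ∫ u in Ioc s t, f u ∂((stieltjesMeasure (negVar a)).restrict (Iic r))

lemma Ioc_inter_Iic_eq (s t r : ℝ≥0) : Ioc s t ∩ Iic r = Ioc (min s r) (min t r) := by
  ext u
  simp only [mem_inter_iff, mem_Ioc, mem_Iic, min_lt_iff, le_min_iff]
  constructor
  · rintro ⟨⟨h1, h2⟩, h3⟩; exact ⟨Or.inl h1, h2, h3⟩
  · rintro ⟨h1 | h1, h2, h3⟩
    · exact ⟨⟨h1, h2⟩, h3⟩
    · exact absurd h1 (not_lt.2 h3)

lemma restrict_Iic_real_Ioc (μ : Measure ℝ≥0) (x y r : ℝ≥0) :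
    (μ.restrict (Iic r)).real (Ioc x y) = μ.real (Ioc (min x r) (min y r)) := by
  rw [Measure.real, Measure.restrict_apply measurableSet_Ioc, Ioc_inter_Iic_eq, Measure.real]

lemma setIntegral_restrict_Iic (μ : Measure ℝ≥0) (f : ℝ≥0 → ℝ) (s t r : ℝ≥0) :
    ∫ u in Ioc s t, f u ∂(μ.restrict (Iic r)) = ∫ u in Ioc (min s r) (min t r), f u ∂μ := by
  rw [Measure.restrict_restrict measurableSet_Ioc, Ioc_inter_Iic_eq]

lemma restrict_Iic_Ioc_lt_top {μ : Measure ℝ≥0} {s t : ℝ≥0} (h : μ (Ioc s t) < ∞) (r : ℝ≥0) :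
    (μ.restrict (Iic r)) (Ioc s t) < ∞ :=
  (Measure.restrict_apply_le _ _).trans_lt h

variable {s t : ℝ≥0}

lemma rsum_eq_sub {a φ : ℝ≥0 → ℝ} (ha : LocallyBoundedVariationOn a univ)
    (hr : ∀ t, ContinuousWithinAt a (Ici t) t) (r : ℝ≥0) (n : ℕ) :
    rsum φ a s t r n =
      (∑ i ∈ Finset.range (n + 1), φ (grid s t n i) *
        ((stieltjesMeasure (posVar a)).restrict (Iic r)).real
          (Ioc (grid s t n i) (grid s t n (i + 1)))) -
      ∑ i ∈ Finset.range (n + 1), φ (grid s t n i) *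
        ((stieltjesMeasure (negVar a)).restrict (Iic r)).real
          (Ioc (grid s t n i) (grid s t n (i + 1))) := by
  rw [rsum, ← Finset.sum_sub_distrib]
  refine Finset.sum_congr rfl fun i _ => ?_
  rw [restrict_Iic_real_Ioc, restrict_Iic_real_Ioc, ← mul_sub,
    real_posVar_sub_real_negVar ha hr (min_le_min_right r (grid_mono i.le_succ))]

lemma rsum_eq_stoppedIntegral {a : ℝ≥0 → ℝ} (ha : LocallyBoundedVariationOn a univ)
    (hr : ∀ t, ContinuousWithinAt a (Ici t) t) (hst : s ≤ t) (φ : ℝ≥0 → ℝ) (r : ℝ≥0) (n : ℕ) :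
    rsum φ a s t r n = stoppedIntegral (fun u => φ (leftPt s t n u)) a s t r := by
  rw [rsum_eq_sub ha hr, stoppedIntegral,
    (integral_leftPt hst (restrict_Iic_Ioc_lt_top (stieltjesMeasure_Ioc_lt_top _ _ _) r) φ n).2,
    (integral_leftPt hst (restrict_Iic_Ioc_lt_top (stieltjesMeasure_Ioc_lt_top _ _ _) r) φ n).2]

lemma tendsto_rsum {a : ℝ≥0 → ℝ} (ha : LocallyBoundedVariationOn a univ)
    (hr : ∀ t, ContinuousWithinAt a (Ici t) t) (hst : s ≤ t) {φ φ' : ℝ≥0 → ℝ} {L : ℝ}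
    (hL : ∀ u ∈ Icc s t, |φ u| ≤ L) (hφ : ∀ u ∈ Ioc s t, Tendsto φ (𝓝[<] u) (𝓝 (φ' u)))
    (r : ℝ≥0) :
    Tendsto (rsum φ a s t r) atTop (𝓝 (stoppedIntegral φ' a s t r)) := by
  have h : rsum φ a s t r = fun n => _ := funext fun n => rsum_eq_sub ha hr r n
  rw [h]
  exact (tendsto_riemann_sum hst (restrict_Iic_Ioc_lt_top (stieltjesMeasure_Ioc_lt_top _ _ _) r)
    hL hφ).sub (tendsto_riemann_sum hst
      (restrict_Iic_Ioc_lt_top (stieltjesMeasure_Ioc_lt_top _ _ _) r) hL hφ)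

/-- The `k`-th step integrand is left-continuous, so finer Riemann sums recover its integral, which
is the `k`-th sum itself. A coarse sum thereby becomes a limit of fine ones and can be compared with
the integral. -/
lemma tendsto_rsum_leftPt {a : ℝ≥0 → ℝ} (ha : LocallyBoundedVariationOn a univ)
    (hr : ∀ t, ContinuousWithinAt a (Ici t) t) (hst : s ≤ t) {φ : ℝ≥0 → ℝ} {L : ℝ}
    (hL : ∀ u ∈ Icc s t, |φ u| ≤ L) (r : ℝ≥0) (k : ℕ) :
    Tendsto (rsum (fun u => φ (leftPt s t k u)) a s t r) atTop (𝓝 (rsum φ a s t r k)) := by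
  rw [rsum_eq_stoppedIntegral ha hr hst]
  refine tendsto_rsum ha hr hst (L := L)
    (fun u hu => hL _ ⟨le_leftPt _ _, (leftPt_le k hu.1).trans hu.2⟩) (fun u hu => ?_) r
  refine tendsto_const_nhds.congr' ?_
  filter_upwards [eventually_leftPt_eq (n := k) hst hu] with v hv
  rw [hv]

lemma rsum_sub (φ φ' a : ℝ≥0 → ℝ) (s t r : ℝ≥0) (n : ℕ) :
    rsum (fun u => φ u - φ' u) a s t r n = rsum φ a s t r n - rsum φ' a s t r n := by
  simp only [rsum, ← Finset.sum_sub_distrib, sub_mul]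

lemma stoppedIntegral_congr {f g : ℝ≥0 → ℝ} (a : ℝ≥0 → ℝ) {r : ℝ≥0}
    (h : ∀ u ∈ Ioc s t, f u = g u) : stoppedIntegral f a s t r = stoppedIntegral g a s t r := by
  rw [stoppedIntegral, stoppedIntegral, setIntegral_congr_fun measurableSet_Ioc h,
    setIntegral_congr_fun measurableSet_Ioc h]

/-! ### Absolutely continuous increasing paths -/

/-- The measure with density `Λ` on `(0, t]`. -/
noncomputable def densityMeasure (Λ : ℝ≥0 → ℝ) (t : ℝ≥0) : Measure ℝ≥0 :=
  (lebesgue.restrict (Ioc 0 t)).withDensity fun u => ENNReal.ofReal (Λ u)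

variable {Λ : ℝ≥0 → ℝ}

lemma densityMeasure_apply (hi : ∀ t, IntegrableOn Λ (Ioc 0 t) lebesgue)
    (h0 : ∀ t, 0 ≤ Λ t) {S : Set ℝ≥0} (hS : MeasurableSet S) (hSt : S ⊆ Ioc 0 t) :
    densityMeasure Λ t S = ENNReal.ofReal (∫ u in S, Λ u ∂lebesgue) := by
  rw [densityMeasure, withDensity_apply _ hS, Measure.restrict_restrict hS,
    inter_eq_left.2 hSt, ofReal_integral_eq_lintegral_ofReal ((hi t).mono_set hSt)
      (Eventually.of_forall h0)]

lemma densityMeasure_lt_top (hi : ∀ t, IntegrableOn Λ (Ioc 0 t) lebesgue)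
    (h0 : ∀ t, 0 ≤ Λ t) (s t : ℝ≥0) : densityMeasure Λ t (Ioc s t) < ∞ := by
  rw [densityMeasure_apply hi h0 measurableSet_Ioc (Ioc_subset_Ioc_left zero_le)]
  exact ENNReal.ofReal_lt_top

lemma setIntegral_Ioc_sub {f : ℝ≥0 → ℝ} (hi : ∀ t, IntegrableOn f (Ioc 0 t) lebesgue)
    (hst : s ≤ t) : ∫ u in Ioc s t, f u ∂lebesgue =
      ∫ u in Ioc 0 t, f u ∂lebesgue - ∫ u in Ioc 0 s, f u ∂lebesgue := by
  rw [← Ioc_union_Ioc_eq_Ioc zero_le hst, setIntegral_union (Ioc_disjoint_Ioc_of_le le_rfl)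
    measurableSet_Ioc (hi s) ((hi t).mono_set (Ioc_subset_Ioc_left zero_le))]
  ring

lemma rsum_eq_densityMeasure {c : ℝ≥0 → ℝ} (hi : ∀ t, IntegrableOn Λ (Ioc 0 t) lebesgue)
    (h0 : ∀ t, 0 ≤ Λ t) (hc : ∀ t, c t = ∫ u in Ioc 0 t, Λ u ∂lebesgue) (hst : s ≤ t)
    (φ : ℝ≥0 → ℝ) (r : ℝ≥0) (n : ℕ) :
    rsum φ c s t r n = ∑ i ∈ Finset.range (n + 1), φ (grid s t n i) *
        ((densityMeasure Λ t).restrict (Iic r)).real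
          (Ioc (grid s t n i) (grid s t n (i + 1))) := by
  refine Finset.sum_congr rfl fun i _ => ?_
  have hle : min (grid s t n i) r ≤ min (grid s t n (i + 1)) r :=
    min_le_min_right r (grid_mono i.le_succ)
  rw [restrict_Iic_real_Ioc, Measure.real, densityMeasure_apply hi h0 measurableSet_Ioc
    (Ioc_subset_Ioc zero_le ((min_le_left _ _).trans (grid_le hst _))),
    ENNReal.toReal_ofReal (integral_nonneg h0), setIntegral_Ioc_sub hi hle, hc, hc]

lemma setIntegral_densityMeasure (hi : ∀ t, IntegrableOn Λ (Ioc 0 t) lebesgue)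
    (h0 : ∀ t, 0 ≤ Λ t) (f : ℝ≥0 → ℝ) {S : Set ℝ≥0} (hS : MeasurableSet S) (hSt : S ⊆ Ioc 0 t) :
    ∫ u in S, f u ∂(densityMeasure Λ t) = ∫ u in S, f u * Λ u ∂lebesgue := by
  rw [densityMeasure, restrict_withDensity hS, Measure.restrict_restrict hS,
    inter_eq_left.2 hSt]
  have hm : AEMeasurable (fun u => ENNReal.ofReal (Λ u)) (lebesgue.restrict S) :=
    ((hi t).mono_set hSt).aemeasurable.ennreal_ofReal
  rw [integral_withDensity_eq_integral_toReal_smul₀ hm (Eventually.of_forall fun u =>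
    ENNReal.ofReal_lt_top)]
  refine integral_congr_ae (Eventually.of_forall fun u => ?_)
  simp only [ENNReal.toReal_ofReal (h0 u), smul_eq_mul, mul_comm]

end riemannSums


/-! ### The Itô isometry for bounded integrands. -/

section isometry

variable {Ω : Type*} {mΩ : MeasurableSpace Ω} {P : Measure Ω} {𝓕 : Filtration ℝ≥0 mΩ}
  {G M C Λ : ℝ≥0 → Ω → ℝ} {ρ : Ω → ℝ≥0} {c : ℝ} {s t : ℝ≥0} {A : Set Ω}

/-- The pathwise properties of an integrand `G`, an integrator `M` and an absolutely continuous
bracket `C` with density `Λ`. -/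
structure GoodPaths (P : Measure Ω) (𝓕 : Filtration ℝ≥0 mΩ) (G M C Λ : ℝ≥0 → Ω → ℝ) : Prop where
  adapted : StronglyAdapted 𝓕 G
  cadlag : ∀ᵐ ω ∂P, IsCadlag fun t => G t ω
  fv : ∀ᵐ ω ∂P, LocallyBoundedVariationOn (fun t => G t ω) univ
  rightCts : ∀ᵐ ω ∂P, ∀ t, ContinuousWithinAt (fun s => M s ω) (Ici t) t
  integrator_fv : ∀ᵐ ω ∂P, LocallyBoundedVariationOn (fun t => M t ω) univ
  nonneg : ∀ᵐ ω ∂P, ∀ t, 0 ≤ Λ t ω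
  integrable : ∀ᵐ ω ∂P, ∀ t, IntegrableOn (fun u => Λ u ω) (Ioc 0 t) lebesgue
  eq_integral : ∀ᵐ ω ∂P, ∀ t, C t ω = ∫ u in Ioc 0 t, Λ u ω ∂lebesgue

lemma monotone_of_density {f l : ℝ≥0 → ℝ} (h0 : ∀ t, 0 ≤ l t)
    (hi : ∀ t, IntegrableOn l (Ioc 0 t) lebesgue)
    (hf : ∀ t, f t = ∫ u in Ioc 0 t, l u ∂lebesgue) : Monotone f := by
  intro x y hxy
  have := setIntegral_Ioc_sub hi hxy
  have h1 : 0 ≤ ∫ u in Ioc x y, l u ∂lebesgue := integral_nonneg h0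
  rw [hf, hf]; linarith

lemma indicator_tendsto {X : ℕ → Ω → ℝ} {J : Ω → ℝ} {ω : Ω}
    (h : Tendsto (fun n => X n ω) atTop (𝓝 (J ω))) :
    Tendsto (fun n => A.indicator (X n) ω) atTop (𝓝 (A.indicator J ω)) := by
  by_cases hω : ω ∈ A
  · simpa [hω] using h
  · simp [hω]

/-- The isometry for Riemann sums. -/
lemma rsum_isometry [IsProbabilityMeasure P] (hred : Reduces P 𝓕 M C ρ c)
    (hA : MeasurableSet[𝓕 s] A) {φ : ℝ≥0 → Ω → ℝ} {L : ℝ}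
    (hφ : ∀ u, s ≤ u → AEStronglyMeasurable[𝓕 u] (φ u) P) (hL : ∀ u ω, |φ u ω| ≤ L) (n : ℕ) :
    MemLp (A.indicator fun ω => rsum (fun u => φ u ω) (fun u => M u ω) s t (ρ ω) n) 2 P ∧
    ∫ ω, A.indicator (fun ω => rsum (fun u => φ u ω) (fun u => M u ω) s t (ρ ω) n) ω ∂P = 0 ∧
    ∫ ω, A.indicator (fun ω => rsum (fun u => φ u ω) (fun u => M u ω) s t (ρ ω) n) ω ^ 2 ∂P =
      ∫ ω, A.indicator
        (fun ω => rsum (fun u => φ u ω ^ 2) (fun u => C u ω) s t (ρ ω) n) ω ∂P ∧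
    Integrable (A.indicator
      fun ω => rsum (fun u => φ u ω ^ 2) (fun u => C u ω) s t (ρ ω) n) P := by
  have hL0 : ∀ ω, 0 ≤ L := fun ω => (abs_nonneg _).trans (hL 0 ω)
  -- The indicator of `A` is absorbed into the integrand, which stays predictable because `A` is
  -- known at the first partition point.
  have h := discrete_isometry (P := P) (𝓗 := gridFiltration 𝓕 s t n) (L := L)
    (d := fun i ω => M (min (grid s t n (i + 1)) (ρ ω)) ω - M (min (grid s t n i) (ρ ω)) ω)
    (q := fun i ω => C (min (grid s t n (i + 1)) (ρ ω)) ω - C (min (grid s t n i) (ρ ω)) ω)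
    (ξ := fun i ω => A.indicator (1 : Ω → ℝ) ω * φ (grid s t n i) ω)
    (fun i => hred.meanZero _ _ (grid_mono i.le_succ))
    (fun i => hred.memLp _ _ (grid_mono i.le_succ))
    (fun i => hred.meas _ _ (grid_mono i.le_succ))
    (fun i => hred.bracket _ _ (grid_mono i.le_succ))
    (fun i => by
      have h1 : StronglyMeasurable[𝓕 (grid s t n i)] (A.indicator (1 : Ω → ℝ)) :=
        stronglyMeasurable_one.indicator (𝓕.mono (le_grid i) _ hA)
      exact h1.aestronglyMeasurable.mul (hφ _ (le_grid i)))
    (fun i ω => by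
      by_cases hω : ω ∈ A
      · simpa [hω] using hL _ ω
      · simpa [hω] using hL0 ω) (n + 1)
  have e1 : ∀ ω, ∑ i ∈ Finset.range (n + 1), (A.indicator (1 : Ω → ℝ) ω * φ (grid s t n i) ω) *
      (M (min (grid s t n (i + 1)) (ρ ω)) ω - M (min (grid s t n i) (ρ ω)) ω) =
      A.indicator (fun ω => rsum (fun u => φ u ω) (fun u => M u ω) s t (ρ ω) n) ω := by
    intro ω
    by_cases hω : ω ∈ A <;> simp [hω, rsum]
  have e2 : ∀ ω, ∑ i ∈ Finset.range (n + 1),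
      (A.indicator (1 : Ω → ℝ) ω * φ (grid s t n i) ω) ^ 2 *
      (C (min (grid s t n (i + 1)) (ρ ω)) ω - C (min (grid s t n i) (ρ ω)) ω) =
      A.indicator (fun ω => rsum (fun u => φ u ω ^ 2) (fun u => C u ω) s t (ρ ω) n) ω := by
    intro ω
    by_cases hω : ω ∈ A <;> simp [hω, rsum]
  simp only [e1, e2] at h
  exact ⟨h.2.1, h.2.2.1, h.2.2.2.1, h.2.2.2.2⟩

/-- The increments of `C` are nonnegative and telescope. The bound does not depend on the partition,
so it serves for domination. -/
lemma abs_rsum_sq_le (hred : Reduces P 𝓕 M C ρ c) (hG : GoodPaths P 𝓕 G M C Λ) (hst : s ≤ t)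
    {φ : ℝ≥0 → Ω → ℝ} {L : ℝ} (hL : ∀ u ω, |φ u ω| ≤ L) :
    ∀ᵐ ω ∂P, ∀ n, |rsum (fun u => φ u ω ^ 2) (fun u => C u ω) s t (ρ ω) n| ≤ L ^ 2 * c := by
  filter_upwards [hred.bound, hG.nonneg, hG.integrable, hG.eq_integral] with ω h1 h2 h3 h4 n
  have hm := monotone_of_density h2 h3 h4
  have hC0 : C 0 ω = 0 := by rw [h4]; simp
  have hd : ∀ i, 0 ≤ C (min (grid s t n (i + 1)) (ρ ω)) ω - C (min (grid s t n i) (ρ ω)) ω :=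
    fun i => sub_nonneg.2 (hm (min_le_min_right _ (grid_mono i.le_succ)))
  have h0 : 0 ≤ rsum (fun u => φ u ω ^ 2) (fun u => C u ω) s t (ρ ω) n :=
    Finset.sum_nonneg fun i _ => mul_nonneg (sq_nonneg _) (hd i)
  rw [abs_of_nonneg h0]
  calc rsum (fun u => φ u ω ^ 2) (fun u => C u ω) s t (ρ ω) n
      ≤ ∑ i ∈ Finset.range (n + 1), L ^ 2 *
        (C (min (grid s t n (i + 1)) (ρ ω)) ω - C (min (grid s t n i) (ρ ω)) ω) :=
        Finset.sum_le_sum fun i _ => mul_le_mul_of_nonneg_right (sq_le_sq' (abs_le.1 (hL _ _)).1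
          (abs_le.1 (hL _ _)).2) (hd i)
    _ = L ^ 2 * (C (min t (ρ ω)) ω - C (min s (ρ ω)) ω) := by
        rw [← Finset.mul_sum,
          Finset.sum_range_sub (fun i => C (min (grid s t n i) (ρ ω)) ω), grid_zero, grid_last hst]
    _ ≤ L ^ 2 * c := by
        have h5 : C 0 ω ≤ C (min s (ρ ω)) ω := hm zero_le
        exact mul_le_mul_of_nonneg_left (by linarith [h1 t]) (sq_nonneg _)

/-- Fatou yields only an inequality for the limit `J`. Applied to the difference between an integral
and its Riemann sums, this inequality gives `L²` convergence, hence equality. -/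
lemma rsum_fatou [IsProbabilityMeasure P] (hred : Reduces P 𝓕 M C ρ c)
    (hG : GoodPaths P 𝓕 G M C Λ) (hA : MeasurableSet[𝓕 s] A) (hst : s ≤ t)
    {φ : ℝ≥0 → Ω → ℝ} {L : ℝ}
    (hφ : ∀ u, s ≤ u → AEStronglyMeasurable[𝓕 u] (φ u) P) (hL : ∀ u ω, |φ u ω| ≤ L)
    {J q : Ω → ℝ}
    (hJ : ∀ᵐ ω ∂P, Tendsto (fun n => rsum (fun u => φ u ω) (fun u => M u ω) s t (ρ ω) n) atTop
      (𝓝 (J ω)))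
    (hq : ∀ᵐ ω ∂P, Tendsto (fun n => rsum (fun u => φ u ω ^ 2) (fun u => C u ω) s t (ρ ω) n)
      atTop (𝓝 (q ω))) :
    MemLp (A.indicator J) 2 P ∧ ∫ ω, A.indicator J ω ^ 2 ∂P ≤ ∫ ω, A.indicator q ω ∂P ∧
    Tendsto (fun n => ∫ ω, A.indicator
      (fun ω => rsum (fun u => φ u ω ^ 2) (fun u => C u ω) s t (ρ ω) n) ω ∂P) atTop
      (𝓝 (∫ ω, A.indicator q ω ∂P)) ∧
    AEStronglyMeasurable (A.indicator q) P ∧ ∀ᵐ ω ∂P, |A.indicator q ω| ≤ L ^ 2 * c := by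
  have hS := rsum_isometry (t := t) hred hA hφ hL
  have hb : ∀ᵐ ω ∂P, ∀ n, |A.indicator
      (fun ω => rsum (fun u => φ u ω ^ 2) (fun u => C u ω) s t (ρ ω) n) ω| ≤ L ^ 2 * c := by
    filter_upwards [abs_rsum_sq_le hred hG hst hL] with ω h n
    by_cases hω : ω ∈ A
    · simpa [hω] using h n
    · simpa [hω] using (abs_nonneg _).trans (h n)
  have hlim : ∀ᵐ ω ∂P, Tendsto (fun n => A.indicator
      (fun ω => rsum (fun u => φ u ω ^ 2) (fun u => C u ω) s t (ρ ω) n) ω) atTop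
      (𝓝 (A.indicator q ω)) := by
    filter_upwards [hq] with ω h
    exact indicator_tendsto h
  have ht := tendsto_integral_of_dominated_convergence (fun _ => L ^ 2 * c)
    (fun n => (hS n).2.2.2.1) (integrable_const _)
    (fun n => hb.mono fun ω h => h n) hlim
  have hF := memLp_two_of_tendsto (c := ∫ ω, A.indicator q ω ∂P) (fun n => (hS n).1)
    (hJ.mono fun ω h => indicator_tendsto h) (by simpa only [fun n => (hS n).2.2.1] using ht)
  refine ⟨hF.1, hF.2, ht, aestronglyMeasurable_of_tendsto_ae _ (fun n => (hS n).2.2.2.1) hlim, ?_⟩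
  filter_upwards [hb, hlim] with ω h1 h2
  exact le_of_tendsto' h2.abs h1

/-- The density measure of the bracket, stopped at `ρ`. -/
noncomputable def stoppedBracket (Λ : ℝ≥0 → Ω → ℝ) (ρ : Ω → ℝ≥0) (t : ℝ≥0) (ω : Ω) :
    Measure ℝ≥0 :=
  (densityMeasure (fun u => Λ u ω) t).restrict (Iic (ρ ω))

lemma GoodPaths.stoppedBracket_lt_top (hG : GoodPaths P 𝓕 G M C Λ) (ρ : Ω → ℝ≥0) (s t : ℝ≥0) :
    ∀ᵐ ω ∂P, stoppedBracket Λ ρ t ω (Ioc s t) < ∞ := by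
  filter_upwards [hG.nonneg, hG.integrable] with ω h1 h2
  exact restrict_Iic_Ioc_lt_top (densityMeasure_lt_top h2 h1 s t) _

lemma GoodPaths.tendsto_rsum_bracket (hG : GoodPaths P 𝓕 G M C Λ) (ρ : Ω → ℝ≥0) (hst : s ≤ t) :
    ∀ᵐ ω ∂P, ∀ (φ φ' : ℝ≥0 → ℝ) (L : ℝ), (∀ u ∈ Icc s t, |φ u| ≤ L) →
      (∀ u ∈ Ioc s t, Tendsto φ (𝓝[<] u) (𝓝 (φ' u))) →
      Tendsto (fun n => rsum φ (fun u => C u ω) s t (ρ ω) n) atTop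
        (𝓝 (∫ u in Ioc s t, φ' u ∂(stoppedBracket Λ ρ t ω))) := by
  filter_upwards [hG.nonneg, hG.integrable, hG.eq_integral,
    hG.stoppedBracket_lt_top ρ s t] with ω h1 h2 h3 h4 φ φ' L hL hφ
  simp only [rsum_eq_densityMeasure h2 h1 h3 hst]
  exact tendsto_riemann_sum hst h4 hL hφ

lemma GoodPaths.tendsto_rsum_integrator (hG : GoodPaths P 𝓕 G M C Λ) (ρ : Ω → ℝ≥0)
    (hst : s ≤ t) :
    ∀ᵐ ω ∂P, ∀ (φ φ' : ℝ≥0 → ℝ) (L : ℝ), (∀ u ∈ Icc s t, |φ u| ≤ L) →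
      (∀ u ∈ Ioc s t, Tendsto φ (𝓝[<] u) (𝓝 (φ' u))) →
      Tendsto (fun n => rsum φ (fun u => M u ω) s t (ρ ω) n) atTop
        (𝓝 (stoppedIntegral φ' (fun u => M u ω) s t (ρ ω))) := by
  filter_upwards [hG.rightCts, hG.integrator_fv] with ω h1 h2 φ φ' L hL hφ
  exact tendsto_rsum h2 h1 hst hL hφ _

/-- The isometry for stochastic integrals with bounded integrand `ψ (G_{u-})`. -/
lemma isometry_of_bounded [IsProbabilityMeasure P] (hred : Reduces P 𝓕 M C ρ c)
    (hG : GoodPaths P 𝓕 G M C Λ) (hA : MeasurableSet[𝓕 s] A) (hst : s ≤ t)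
    {ψ : ℝ → ℝ} (hψ : Continuous ψ) {L : ℝ} (hL : ∀ x, |ψ x| ≤ L) :
    MemLp (A.indicator fun ω => stoppedIntegral
      (fun u => ψ (Function.leftLim (fun r => G r ω) u)) (fun u => M u ω) s t (ρ ω)) 2 P ∧
    ∫ ω, A.indicator (fun ω => stoppedIntegral
      (fun u => ψ (Function.leftLim (fun r => G r ω) u)) (fun u => M u ω) s t (ρ ω)) ω ∂P = 0 ∧
    ∫ ω, A.indicator (fun ω => stoppedIntegral
      (fun u => ψ (Function.leftLim (fun r => G r ω) u)) (fun u => M u ω) s t (ρ ω)) ω ^ 2 ∂P =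
    ∫ ω, A.indicator (fun ω => ∫ u in Ioc s t,
      ψ (Function.leftLim (fun r => G r ω) u) ^ 2 ∂(stoppedBracket Λ ρ t ω)) ω ∂P ∧
    AEStronglyMeasurable (A.indicator (fun ω => ∫ u in Ioc s t,
      ψ (Function.leftLim (fun r => G r ω) u) ^ 2 ∂(stoppedBracket Λ ρ t ω))) P := by
  set J : Ω → ℝ := fun ω => stoppedIntegral
      (fun u => ψ (Function.leftLim (fun r => G r ω) u)) (fun u => M u ω) s t (ρ ω) with hJdef
  set q : Ω → ℝ := fun ω => ∫ u in Ioc s t,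
      ψ (Function.leftLim (fun r => G r ω) u) ^ 2 ∂(stoppedBracket Λ ρ t ω) with hqdef
  have hleft : ∀ᵐ ω ∂P, ∀ u, Tendsto (fun v => ψ (G v ω)) (𝓝[<] u)
      (𝓝 (ψ (Function.leftLim (fun r => G r ω) u))) := by
    filter_upwards [hG.cadlag] with ω h u
    exact (hψ.tendsto _).comp (h.tendsto_leftLim u)
  have hφ : ∀ u, s ≤ u → AEStronglyMeasurable[𝓕 u] (fun ω => ψ (G u ω)) P := fun u _ =>
    (hψ.comp_stronglyMeasurable (hG.adapted u)).aestronglyMeasurable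
  have hJ : ∀ᵐ ω ∂P, Tendsto (fun n => rsum (fun u => ψ (G u ω)) (fun u => M u ω) s t (ρ ω) n)
      atTop (𝓝 (J ω)) := by
    filter_upwards [hG.tendsto_rsum_integrator ρ hst, hleft] with ω h1 h2
    exact h1 _ _ L (fun u _ => hL _) fun u _ => h2 u
  have hq : ∀ᵐ ω ∂P, Tendsto (fun n => rsum (fun u => ψ (G u ω) ^ 2) (fun u => C u ω) s t (ρ ω) n)
      atTop (𝓝 (q ω)) := by
    filter_upwards [hG.tendsto_rsum_bracket ρ hst, hleft] with ω h1 h2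
    refine h1 _ _ (L ^ 2) (fun u _ => ?_) fun u _ => (h2 u).pow 2
    rw [abs_pow]; exact pow_le_pow_left₀ (abs_nonneg _) (hL _) 2
  have hF := rsum_fatou hred hG hA hst hφ (fun u ω => hL _) hJ hq
  have hS := rsum_isometry (t := t) hred hA hφ (fun u ω => hL _)
  -- differences between the integral and its Riemann sums
  set φ : ℕ → ℝ≥0 → Ω → ℝ := fun k u ω => ψ (G u ω) - ψ (G (leftPt s t k u) ω) with hφdef
  set qk : ℕ → Ω → ℝ := fun k ω => ∫ u in Ioc s t,
    (ψ (Function.leftLim (fun r => G r ω) u) - ψ (G (leftPt s t k u) ω)) ^ 2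
      ∂(stoppedBracket Λ ρ t ω) with hqkdef
  have hφL : ∀ k u ω, |φ k u ω| ≤ 2 * L := fun k u ω => (abs_sub _ _).trans (by
    linarith [hL (G u ω), hL (G (leftPt s t k u) ω)])
  -- With `k` fixed and the partition refined, the sums of `φ k` tend to `J` minus its `k`-th
  -- Riemann sum, and their brackets to `qk k`.
  have hFk : ∀ k, _ := fun k => rsum_fatou hred hG hA hst (φ := φ k) (L := 2 * L)
    (J := fun ω => J ω - rsum (fun u => ψ (G u ω)) (fun u => M u ω) s t (ρ ω) k) (q := qk k)
    (fun u hu => (hφ u hu).sub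
      ((hφ (leftPt s t k u) (le_leftPt _ _)).mono (𝓕.mono (leftPt_le k hu)))) (hφL k)
    (by
      filter_upwards [hJ, hG.rightCts, hG.integrator_fv] with ω h1 h2 h3
      have h4 := tendsto_rsum_leftPt h3 h2 hst (φ := fun u => ψ (G u ω)) (L := L)
        (fun u _ => hL _) (ρ ω) k
      simp only [hφdef, rsum_sub]
      exact h1.sub h4)
    (by
      filter_upwards [hG.tendsto_rsum_bracket ρ hst, hleft] with ω h1 h2
      refine h1 _ _ ((2 * L) ^ 2) (fun u _ => ?_) fun u hu => ?_
      · rw [abs_pow]; exact pow_le_pow_left₀ (abs_nonneg _) (hφL k u ω) 2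
      · refine (Tendsto.sub (h2 u) ?_).pow 2
        refine tendsto_const_nhds.congr' ?_
        filter_upwards [eventually_leftPt_eq (n := k) hst hu] with v hv
        rw [hv])
  -- Dominated convergence twice: in `u`, because `leftPt` increases to `u` strictly from the left,
  -- then in `ω`.
  have hc : Tendsto (fun k => ∫ ω, A.indicator (qk k) ω ∂P) atTop (𝓝 0) := by
    have : Tendsto (fun k => ∫ ω, A.indicator (qk k) ω ∂P) atTop (𝓝 (∫ _, (0 : ℝ) ∂P)) := by
      refine tendsto_integral_of_dominated_convergence (fun _ => (2 * L) ^ 2 * c)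
        (fun k => (hFk k).2.2.2.1) (integrable_const _) (fun k => (hFk k).2.2.2.2) ?_
      filter_upwards [hleft, hG.fv, hG.stoppedBracket_lt_top ρ s t] with ω h1 h2 h3
      have h4 : Tendsto (fun k => qk k ω) atTop
          (𝓝 (∫ _ in Ioc s t, (0 : ℝ) ∂(stoppedBracket Λ ρ t ω))) := by
        refine tendsto_integral_of_dominated_convergence (fun _ => (2 * L) ^ 2) (fun k => ?_)
          (integrableOn_const h3.ne) (fun k => Eventually.of_forall fun u => ?_) ?_
        · have h5 := (integral_leftPt hst h3 (fun u => ψ (G u ω)) k).1.1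
          have h6 : Measurable fun u => ψ (Function.leftLim (fun r => G r ω) u) :=
            hψ.measurable.comp (measurable_leftLim h2)
          exact (h6.aestronglyMeasurable.sub h5).pow 2
        · rw [norm_pow]
          refine pow_le_pow_left₀ (norm_nonneg _) ?_ 2
          exact (abs_sub _ _).trans (by
            linarith [hL (Function.leftLim (fun r => G r ω) u), hL (G (leftPt s t k u) ω)])
        · refine (ae_restrict_iff' measurableSet_Ioc).2 (Eventually.of_forall fun u hu => ?_)
          have h5 := ((h1 u).comp (tendsto_leftPt hst hu)).const_sub
            (ψ (Function.leftLim (fun r => G r ω) u))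
          simpa using h5.pow 2
      rw [integral_zero] at h4
      have h5 := indicator_tendsto (A := A) (X := qk) (J := fun _ => (0 : ℝ)) h4
      simpa using h5
    simpa using this
  have hT := tendsto_integral_sq_of_tendsto (fun k => (hS k).1) hF.1 (fun k => ?_) hc
  · refine ⟨hF.1, ?_, ?_, hF.2.2.2.1⟩
    · have := hT.2
      simp only [fun k => (hS k).2.1] at this
      exact (tendsto_nhds_unique tendsto_const_nhds this).symm
    · have := hT.1
      simp only [fun k => (hS k).2.2.1] at this
      exact tendsto_nhds_unique this hF.2.2.1
  · have h1 : ∀ ω, A.indicator J ω - A.indicator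
        (fun ω => rsum (fun u => ψ (G u ω)) (fun u => M u ω) s t (ρ ω) k) ω =
        A.indicator (fun ω => J ω - rsum (fun u => ψ (G u ω)) (fun u => M u ω) s t (ρ ω) k) ω := by
      intro ω
      by_cases hω : ω ∈ A <;> simp [hω]
    simp only [h1]
    exact (hFk k).2.1

end isometry


/-! ### The isometry for unbounded integrands, by truncation. -/

section unbounded

variable {Ω : Type*} {mΩ : MeasurableSpace Ω} {P : Measure Ω} {𝓕 : Filtration ℝ≥0 mΩ}
  {G M C Λ : ℝ≥0 → Ω → ℝ} {ρ : Ω → ℝ≥0} {c : ℝ} {s t : ℝ≥0} {A : Set Ω}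

/-- Truncation of a real number at level `k`. -/
def clip (k : ℕ) (x : ℝ) : ℝ := max (-k) (min x k)

lemma continuous_clip (k : ℕ) : Continuous (clip k) := by unfold clip; fun_prop

lemma abs_clip_le (k : ℕ) (x : ℝ) : |clip k x| ≤ k := by
  have hk : (0 : ℝ) ≤ k := Nat.cast_nonneg k
  exact abs_le.2 ⟨le_max_left _ _, max_le (by linarith) (min_le_right _ _)⟩

lemma clip_eq_self {k : ℕ} {x : ℝ} (h : |x| ≤ k) : clip k x = x := by
  rw [clip, min_eq_left (abs_le.1 h).2, max_eq_right (abs_le.1 h).1]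

lemma clip_mem (k : ℕ) (x : ℝ) : (0 ≤ x → 0 ≤ clip k x ∧ clip k x ≤ x) ∧
    (x ≤ 0 → x ≤ clip k x ∧ clip k x ≤ 0) := by
  have hk : (0 : ℝ) ≤ k := Nat.cast_nonneg k
  unfold clip
  refine ⟨fun hx => ⟨le_max_of_le_right (le_min hx hk),
    max_le (by linarith) (min_le_left _ _)⟩, fun hx => ⟨?_,
    max_le (by linarith) ((min_le_left _ _).trans hx)⟩⟩
  rw [min_eq_left (hx.trans hk)]
  exact le_max_right _ _

lemma sq_clip_le (k : ℕ) (x : ℝ) : clip k x ^ 2 ≤ x ^ 2 := by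
  have h := clip_mem k x
  rcases le_total 0 x with hx | hx
  · obtain ⟨h1, h2⟩ := h.1 hx; nlinarith
  · obtain ⟨h1, h2⟩ := h.2 hx; nlinarith

/-- Both truncations lie between `0` and `x`. The brackets of differences of truncated integrals are
thus dominated by the bracket of the integral itself. -/
lemma sq_clip_sub_clip_le (k l : ℕ) (x : ℝ) : (clip l x - clip k x) ^ 2 ≤ x ^ 2 := by
  have h := clip_mem k x
  have h' := clip_mem l x
  rw [sq_le_sq]
  rcases le_total 0 x with hx | hx
  · obtain ⟨h1, h2⟩ := h.1 hx
    obtain ⟨h3, h4⟩ := h'.1 hx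
    rw [abs_of_nonneg hx]
    exact abs_le.2 ⟨by linarith, by linarith⟩
  · obtain ⟨h1, h2⟩ := h.2 hx
    obtain ⟨h3, h4⟩ := h'.2 hx
    rw [abs_of_nonpos hx]
    exact abs_le.2 ⟨by linarith, by linarith⟩

lemma GoodPaths.eventually_clip_eq (hG : GoodPaths P 𝓕 G M C Λ) (t : ℝ≥0) :
    ∀ᵐ ω ∂P, ∀ᶠ k in atTop, ∀ u ≤ t, clip k (Function.leftLim (fun r => G r ω) u) =
      Function.leftLim (fun r => G r ω) u := by
  filter_upwards [hG.fv] with ω h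
  obtain ⟨L, hL0, hL⟩ := exists_bound h t
  filter_upwards [eventually_ge_atTop ⌈L⌉₊] with k hk u hu
  exact clip_eq_self ((hL u hu).2.trans ((Nat.le_ceil L).trans (by exact_mod_cast hk)))

lemma GoodPaths.integrableOn_comp (hG : GoodPaths P 𝓕 G M C Λ) (ρ : Ω → ℝ≥0) (s t : ℝ≥0) :
    ∀ᵐ ω ∂P, ∀ ψ : ℝ → ℝ, Continuous ψ → IntegrableOn
      (fun u => ψ (Function.leftLim (fun r => G r ω) u)) (Ioc s t) (stoppedBracket Λ ρ t ω) := by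
  filter_upwards [hG.fv, hG.stoppedBracket_lt_top ρ s t] with ω h1 h2 ψ hψ
  obtain ⟨L, hL0, hL⟩ := exists_bound h1 t
  obtain ⟨B, hB⟩ := (isCompact_Icc (a := -L) (b := L)).exists_bound_of_continuousOn hψ.continuousOn
  refine Measure.integrableOn_of_bounded (M := B) h2.ne
    (hψ.measurable.comp (measurable_leftLim h1)).aestronglyMeasurable ?_
  refine (ae_restrict_iff' measurableSet_Ioc).2 (Eventually.of_forall fun u hu => hB _ ?_)
  exact abs_le.1 (hL u hu.2).2

lemma GoodPaths.stoppedIntegral_sub (hG : GoodPaths P 𝓕 G M C Λ) (ρ : Ω → ℝ≥0) (hst : s ≤ t)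
    {ψ ψ' : ℝ → ℝ} (hψ : Continuous ψ) (hψ' : Continuous ψ') {L L' : ℝ} (hL : ∀ x, |ψ x| ≤ L)
    (hL' : ∀ x, |ψ' x| ≤ L') :
    ∀ᵐ ω ∂P, stoppedIntegral (fun u => ψ (Function.leftLim (fun r => G r ω) u) -
        ψ' (Function.leftLim (fun r => G r ω) u)) (fun u => M u ω) s t (ρ ω) =
      stoppedIntegral (fun u => ψ (Function.leftLim (fun r => G r ω) u)) (fun u => M u ω) s t (ρ ω)
      - stoppedIntegral (fun u => ψ' (Function.leftLim (fun r => G r ω) u))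
        (fun u => M u ω) s t (ρ ω) := by
  filter_upwards [hG.tendsto_rsum_integrator ρ hst, hG.cadlag] with ω h1 h2
  have e1 : ∀ u, Tendsto (fun v => ψ (G v ω)) (𝓝[<] u) _ := fun u =>
    (hψ.tendsto _).comp (h2.tendsto_leftLim u)
  have e2 : ∀ u, Tendsto (fun v => ψ' (G v ω)) (𝓝[<] u) _ := fun u =>
    (hψ'.tendsto _).comp (h2.tendsto_leftLim u)
  have h3 := h1 _ _ L (fun u _ => hL _) fun u _ => e1 u
  have h4 := h1 _ _ L' (fun u _ => hL' _) fun u _ => e2 u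
  have h5 := h1 _ _ (L + L') (fun u _ => (abs_sub _ _).trans (add_le_add (hL _) (hL' _)))
    fun u _ => (e1 u).sub (e2 u)
  simp only [rsum_sub] at h5
  exact tendsto_nhds_unique h5 (h3.sub h4)

lemma indicator_eventually_tendsto {X : ℕ → Ω → ℝ} {J : Ω → ℝ} {ω : Ω}
    (h : ∀ᶠ n in atTop, X n ω = J ω) :
    Tendsto (fun n => A.indicator (X n) ω) atTop (𝓝 (A.indicator J ω)) :=
  indicator_tendsto (tendsto_const_nhds.congr' (h.mono fun _ hn => hn.symm))

/-- The isometry for the stochastic integral of `G_{u-}` up to a reducing time. -/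
lemma isometry_stopped [IsProbabilityMeasure P] (hred : Reduces P 𝓕 M C ρ c)
    (hG : GoodPaths P 𝓕 G M C Λ) (hA : MeasurableSet[𝓕 s] A) (hst : s ≤ t) {K : ℝ}
    (hK : ∀ᵐ ω ∂P, ∫ u in Ioc s t,
      Function.leftLim (fun r => G r ω) u ^ 2 ∂(stoppedBracket Λ ρ t ω) ≤ K) :
    MemLp (A.indicator fun ω => stoppedIntegral
      (Function.leftLim (fun r => G r ω)) (fun u => M u ω) s t (ρ ω)) 2 P ∧
    ∫ ω, A.indicator (fun ω => stoppedIntegral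
      (Function.leftLim (fun r => G r ω)) (fun u => M u ω) s t (ρ ω)) ω ∂P = 0 ∧
    ∫ ω, A.indicator (fun ω => stoppedIntegral
      (Function.leftLim (fun r => G r ω)) (fun u => M u ω) s t (ρ ω)) ω ^ 2 ∂P =
    ∫ ω, A.indicator (fun ω => ∫ u in Ioc s t,
      Function.leftLim (fun r => G r ω) u ^ 2 ∂(stoppedBracket Λ ρ t ω)) ω ∂P ∧
    AEStronglyMeasurable (A.indicator (fun ω => ∫ u in Ioc s t,
      Function.leftLim (fun r => G r ω) u ^ 2 ∂(stoppedBracket Λ ρ t ω))) P := by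
  set J : Ω → ℝ := fun ω => stoppedIntegral
      (Function.leftLim (fun r => G r ω)) (fun u => M u ω) s t (ρ ω) with hJdef
  set q : Ω → ℝ := fun ω => ∫ u in Ioc s t,
      Function.leftLim (fun r => G r ω) u ^ 2 ∂(stoppedBracket Λ ρ t ω) with hqdef
  set Jk : ℕ → Ω → ℝ := fun k ω => stoppedIntegral
      (fun u => clip k (Function.leftLim (fun r => G r ω) u)) (fun u => M u ω) s t (ρ ω) with hJkdef
  set qk : ℕ → Ω → ℝ := fun k ω => ∫ u in Ioc s t,
      clip k (Function.leftLim (fun r => G r ω) u) ^ 2 ∂(stoppedBracket Λ ρ t ω) with hqkdef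
  set qlk : ℕ → ℕ → Ω → ℝ := fun k l ω => ∫ u in Ioc s t,
      (clip l (Function.leftLim (fun r => G r ω) u) -
        clip k (Function.leftLim (fun r => G r ω) u)) ^ 2 ∂(stoppedBracket Λ ρ t ω) with hqlkdef
  set qi : ℕ → Ω → ℝ := fun k ω => ∫ u in Ioc s t,
      (Function.leftLim (fun r => G r ω) u -
        clip k (Function.leftLim (fun r => G r ω) u)) ^ 2 ∂(stoppedBracket Λ ρ t ω) with hqidef
  have hev := hG.eventually_clip_eq t
  -- all the brackets are dominated by `K`
  have hdom : ∀ᵐ ω ∂P, ∀ ψ : ℝ → ℝ, Continuous ψ → (∀ x, ψ x ^ 2 ≤ x ^ 2) →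
      |A.indicator (fun ω => ∫ u in Ioc s t, ψ (Function.leftLim (fun r => G r ω) u) ^ 2
        ∂(stoppedBracket Λ ρ t ω)) ω| ≤ K := by
    filter_upwards [hK, hG.integrableOn_comp ρ s t] with ω h1 h2 ψ hψ hle
    have h3 : 0 ≤ ∫ u in Ioc s t, ψ (Function.leftLim (fun r => G r ω) u) ^ 2
        ∂(stoppedBracket Λ ρ t ω) := integral_nonneg fun u => sq_nonneg _
    have h4 : ∫ u in Ioc s t, ψ (Function.leftLim (fun r => G r ω) u) ^ 2
        ∂(stoppedBracket Λ ρ t ω) ≤ K := by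
      refine le_trans (integral_mono (h2 (fun x => ψ x ^ 2) (hψ.pow 2))
        (h2 (fun x => x ^ 2) (continuous_pow 2)) fun u => hle _) h1
    by_cases hω : ω ∈ A
    · simpa [hω, abs_of_nonneg h3] using h4
    · simpa [hω] using h3.trans h4
  have hB := fun k => isometry_of_bounded hred hG hA hst (continuous_clip k) (abs_clip_le k)
  have hBlk := fun k l => isometry_of_bounded hred hG hA hst (ψ := fun x => clip l x - clip k x)
    ((continuous_clip l).sub (continuous_clip k)) (L := l + k)
    (fun x => (abs_sub _ _).trans (add_le_add (abs_clip_le l x) (abs_clip_le k x)))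
  have hq0 : ∀ᵐ ω ∂P, Tendsto (fun k => A.indicator (qk k) ω) atTop (𝓝 (A.indicator q ω)) := by
    filter_upwards [hev] with ω h
    refine indicator_eventually_tendsto (h.mono fun k hk => ?_)
    exact setIntegral_congr_fun measurableSet_Ioc fun u hu => by simp only [hk u hu.2]
  have hq1 : Tendsto (fun k => ∫ ω, A.indicator (qk k) ω ∂P) atTop
      (𝓝 (∫ ω, A.indicator q ω ∂P)) :=
    tendsto_integral_of_dominated_convergence (fun _ => K) (fun k => (hB k).2.2.2)
      (integrable_const _) (fun k => hdom.mono fun ω h => h _ (continuous_clip k) (sq_clip_le k)) hq0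
  have hlk : ∀ k, ∀ᵐ ω ∂P, Tendsto (fun l => A.indicator (qlk k l) ω) atTop
      (𝓝 (A.indicator (qi k) ω)) := by
    intro k
    filter_upwards [hev] with ω h
    refine indicator_eventually_tendsto (h.mono fun l hl => ?_)
    exact setIntegral_congr_fun measurableSet_Ioc fun u hu => by simp only [hl u hu.2]
  have hdomlk : ∀ k l, ∀ᵐ ω ∂P, |A.indicator (qlk k l) ω| ≤ K := fun k l =>
    hdom.mono fun ω h => h _ ((continuous_clip l).sub (continuous_clip k))
      (sq_clip_sub_clip_le k l)
  have hq2 : ∀ k, Tendsto (fun l => ∫ ω, A.indicator (qlk k l) ω ∂P) atTop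
      (𝓝 (∫ ω, A.indicator (qi k) ω ∂P)) := fun k =>
    tendsto_integral_of_dominated_convergence (fun _ => K) (fun l => (hBlk k l).2.2.2)
      (integrable_const _) (fun l => hdomlk k l) (hlk k)
  have hqi : Tendsto (fun k => ∫ ω, A.indicator (qi k) ω ∂P) atTop (𝓝 0) := by
    have : Tendsto (fun k => ∫ ω, A.indicator (qi k) ω ∂P) atTop (𝓝 (∫ _, (0 : ℝ) ∂P)) := by
      refine tendsto_integral_of_dominated_convergence (fun _ => K)
        (fun k => aestronglyMeasurable_of_tendsto_ae _ (fun l => (hBlk k l).2.2.2) (hlk k))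
        (integrable_const _) (fun k => ?_) ?_
      · filter_upwards [hlk k, ae_all_iff.2 (hdomlk k)] with ω h1 h2
        exact le_of_tendsto' h1.abs h2
      · filter_upwards [hev] with ω h
        have h1 : ∀ᶠ k in atTop, qi k ω = 0 := h.mono fun k hk => by
          rw [hqidef]
          have : ∀ u ∈ Ioc s t, (Function.leftLim (fun r => G r ω) u -
              clip k (Function.leftLim (fun r => G r ω) u)) ^ 2 = 0 := fun u hu => by
            rw [hk u hu.2]; ring
          simp only [setIntegral_congr_fun measurableSet_Ioc this, integral_zero]
        simpa using indicator_eventually_tendsto (A := A) (X := qi) (J := fun _ => 0) h1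
    simpa using this
  -- Fatou in `l` with `k` fixed: on each path the truncation at level `l` is eventually inactive,
  -- so `Jk l - Jk k` becomes `J - Jk k`.
  have hFk : ∀ k, MemLp (fun ω => A.indicator J ω - A.indicator (Jk k) ω) 2 P ∧
      ∫ ω, (A.indicator J ω - A.indicator (Jk k) ω) ^ 2 ∂P ≤ ∫ ω, A.indicator (qi k) ω ∂P := by
    intro k
    refine memLp_two_of_tendsto (fun l => (hBlk k l).1) ?_
      (by simpa only [fun l => (hBlk k l).2.2.1] using hq2 k)
    have hsub := ae_all_iff.2 fun l => hG.stoppedIntegral_sub ρ hst (continuous_clip l)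
      (continuous_clip k) (abs_clip_le l) (abs_clip_le k)
    filter_upwards [hev, hsub] with ω h1 h2
    have h3 : ∀ᶠ l in atTop, Jk l ω = J ω := h1.mono fun l hl =>
      stoppedIntegral_congr _ fun u hu => hl u hu.2
    by_cases hω : ω ∈ A
    · simp only [indicator_of_mem hω, h2]
      exact tendsto_const_nhds.congr' (h3.mono fun l hl => by rw [← hl])
    · simp only [indicator_of_notMem hω, sub_self]
      exact tendsto_const_nhds
  have hJ2 : MemLp (A.indicator J) 2 P :=
    ((hFk 0).1.add (hB 0).1).ae_eq (Eventually.of_forall fun ω => by simp [hJkdef])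
  have hT := tendsto_integral_sq_of_tendsto (fun k => (hB k).1) hJ2 (fun k => (hFk k).2) hqi
  refine ⟨hJ2, ?_, ?_, aestronglyMeasurable_of_tendsto_ae _ (fun k => (hB k).2.2.2) hq0⟩
  · have := hT.2
    simp only [fun k => (hB k).2.1] at this
    exact (tendsto_nhds_unique tendsto_const_nhds this).symm
  · have := hT.1
    simp only [fun k => (hB k).2.2.1] at this
    exact tendsto_nhds_unique this hq1

end unbounded


/-! ### The martingale part of `Z` and its bracket. -/

section drivingMartingale

variable {Ω : Type*} {mΩ : MeasurableSpace Ω} {P : Measure Ω} {𝓕 : Filtration ℝ≥0 mΩ}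
  {G M C Λ : ℝ≥0 → Ω → ℝ} {s t : ℝ≥0}

/-- The process `∫_{(0, t]} G_{u-} dM_u`. -/
noncomputable def mart (G M : ℝ≥0 → Ω → ℝ) (t : ℝ≥0) (ω : Ω) : ℝ :=
  stieltjesIntegral (Function.leftLim fun u => G u ω) (fun u => M u ω) t

/-- The process `∫_0^t G_u² Λ_u du`. -/
noncomputable def quad (G Λ : ℝ≥0 → Ω → ℝ) (t : ℝ≥0) (ω : Ω) : ℝ :=
  ∫ u in Ioc 0 t, G u ω ^ 2 * Λ u ω ∂lebesgue

lemma integrableOn_leftLim_stieltjes {x : ℝ≥0 → ℝ} (hx : LocallyBoundedVariationOn x univ)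
    (a : ℝ≥0 → ℝ) (s t : ℝ≥0) :
    IntegrableOn (Function.leftLim x) (Ioc s t) (stieltjesMeasure a) := by
  obtain ⟨L, hL0, hL⟩ := exists_bound hx t
  refine Measure.integrableOn_of_bounded (M := L) (stieltjesMeasure_Ioc_lt_top a s t).ne
    (measurable_leftLim hx).aestronglyMeasurable ?_
  exact (ae_restrict_iff' measurableSet_Ioc).2 (Eventually.of_forall fun u hu => (hL u hu.2).2)

lemma setIntegral_Ioc_sub_of_integrableOn {μ : Measure ℝ≥0} {f : ℝ≥0 → ℝ}
    (hi : ∀ t, IntegrableOn f (Ioc 0 t) μ) (hst : s ≤ t) :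
    ∫ u in Ioc s t, f u ∂μ = ∫ u in Ioc 0 t, f u ∂μ - ∫ u in Ioc 0 s, f u ∂μ := by
  rw [← Ioc_union_Ioc_eq_Ioc zero_le hst, setIntegral_union (Ioc_disjoint_Ioc_of_le le_rfl)
    measurableSet_Ioc (hi s) ((hi t).mono_set (Ioc_subset_Ioc_left zero_le))]
  ring

lemma stoppedIntegral_eq_sub {x : ℝ≥0 → ℝ} (hx : LocallyBoundedVariationOn x univ)
    (a : ℝ≥0 → ℝ) (hst : s ≤ t) (r : ℝ≥0) :
    stoppedIntegral (Function.leftLim x) a s t r =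
      stieltjesIntegral (Function.leftLim x) a (min t r) -
        stieltjesIntegral (Function.leftLim x) a (min s r) := by
  have h : min s r ≤ min t r := min_le_min_right r hst
  rw [stoppedIntegral, stieltjesIntegral, stieltjesIntegral, setIntegral_restrict_Iic,
    setIntegral_restrict_Iic,
    setIntegral_Ioc_sub_of_integrableOn (fun t => integrableOn_leftLim_stieltjes hx _ 0 t) h,
    setIntegral_Ioc_sub_of_integrableOn (fun t => integrableOn_leftLim_stieltjes hx _ 0 t) h]
  ring

lemma GoodPaths.integrableOn_quad (hG : GoodPaths P 𝓕 G M C Λ) :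
    ∀ᵐ ω ∂P, ∀ t, IntegrableOn (fun u => G u ω ^ 2 * Λ u ω) (Ioc 0 t) lebesgue := by
  filter_upwards [hG.fv, hG.integrable] with ω h1 h2 t
  obtain ⟨L, hL0, hL⟩ := exists_bound h1 t
  refine Integrable.bdd_mul (c := L ^ 2) (h2 t)
    ((measurable_of_locallyBoundedVariationOn h1).pow_const 2).aestronglyMeasurable ?_
  refine (ae_restrict_iff' measurableSet_Ioc).2 (Eventually.of_forall fun u hu => ?_)
  rw [norm_pow]
  exact pow_le_pow_left₀ (norm_nonneg _) (hL u hu.2).1 2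

lemma GoodPaths.quad_sub (hG : GoodPaths P 𝓕 G M C Λ) :
    ∀ᵐ ω ∂P, ∀ s t, s ≤ t → quad G Λ t ω - quad G Λ s ω =
      ∫ u in Ioc s t, G u ω ^ 2 * Λ u ω ∂lebesgue := by
  filter_upwards [hG.integrableOn_quad] with ω h s t hst
  rw [setIntegral_Ioc_sub h hst]; rfl

lemma GoodPaths.quad_mono (hG : GoodPaths P 𝓕 G M C Λ) :
    ∀ᵐ ω ∂P, Monotone fun t => quad G Λ t ω := by
  filter_upwards [hG.quad_sub, hG.nonneg] with ω h1 h2 s t hst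
  have h3 : 0 ≤ ∫ u in Ioc s t, G u ω ^ 2 * Λ u ω ∂lebesgue :=
    integral_nonneg fun u => mul_nonneg (sq_nonneg _) (h2 u)
  have := h1 s t hst
  dsimp only
  linarith

lemma GoodPaths.integral_stoppedBracket (hG : GoodPaths P 𝓕 G M C Λ) (ρ : Ω → ℝ≥0)
    (hst : s ≤ t) :
    ∀ᵐ ω ∂P, ∫ u in Ioc s t, Function.leftLim (fun r => G r ω) u ^ 2
      ∂(stoppedBracket Λ ρ t ω) = quad G Λ (min t (ρ ω)) ω - quad G Λ (min s (ρ ω)) ω := by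
  filter_upwards [hG.fv, hG.integrable, hG.nonneg, hG.quad_sub] with ω h1 h2 h3 h4
  rw [stoppedBracket, setIntegral_restrict_Iic, setIntegral_densityMeasure h2 h3 _
    measurableSet_Ioc (Ioc_subset_Ioc zero_le (min_le_left _ _)),
    h4 _ _ (min_le_min_right _ hst)]
  refine integral_congr_ae (ae_restrict_of_ae ?_)
  filter_upwards [leftLim_ae_eq h1] with u hu
  rw [hu]

/-- An almost sure limit of `𝓕 t`-measurable Riemann sums. The filtration is not assumed complete,
so measurability holds only up to a null set. -/
lemma GoodPaths.aestronglyMeasurable_mart (hG : GoodPaths P 𝓕 G M C Λ)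
    (hM : StronglyAdapted 𝓕 M) (hst : s ≤ t) :
    AEStronglyMeasurable[𝓕 t] (fun ω => mart G M t ω - mart G M s ω) P := by
  refine aestronglyMeasurable_of_ae_limit
    (f := fun n ω => rsum (fun u => G u ω) (fun u => M u ω) s t t n) (fun n => ?_) ?_
  · refine StronglyMeasurable.aestronglyMeasurable (Finset.stronglyMeasurable_fun_sum _
      fun i _ => StronglyMeasurable.mul ?_ (StronglyMeasurable.sub ?_ ?_))
    · exact (hG.adapted _).mono (𝓕.mono (grid_le hst i))
    · exact (hM _).mono (𝓕.mono (min_le_right _ _))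
    · exact (hM _).mono (𝓕.mono (min_le_right _ _))
  · filter_upwards [hG.tendsto_rsum_integrator (fun _ => t) hst, hG.fv, hG.cadlag] with ω h1 h2 h3
    obtain ⟨L, hL0, hL⟩ := exists_bound h2 t
    have h4 := h1 _ _ L (fun u hu => (hL u hu.2).1) fun u _ => h3.tendsto_leftLim u
    rw [stoppedIntegral_eq_sub h2 _ hst, min_self, min_eq_left hst] at h4
    exact h4

lemma GoodPaths.aestronglyMeasurable_quad (hG : GoodPaths P 𝓕 G M C Λ)
    (hC : StronglyAdapted 𝓕 C) (hst : s ≤ t) :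
    AEStronglyMeasurable[𝓕 t] (fun ω => quad G Λ t ω - quad G Λ s ω) P := by
  refine aestronglyMeasurable_of_ae_limit
    (f := fun n ω => rsum (fun u => G u ω ^ 2) (fun u => C u ω) s t t n) (fun n => ?_) ?_
  · refine StronglyMeasurable.aestronglyMeasurable (Finset.stronglyMeasurable_fun_sum _
      fun i _ => StronglyMeasurable.mul ?_ (StronglyMeasurable.sub ?_ ?_))
    · exact ((hG.adapted _).mono (𝓕.mono (grid_le hst i))).pow 2
    · exact (hC _).mono (𝓕.mono (min_le_right _ _))
    · exact (hC _).mono (𝓕.mono (min_le_right _ _))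
  · filter_upwards [hG.tendsto_rsum_bracket (fun _ => t) hst, hG.fv, hG.cadlag,
      hG.integral_stoppedBracket (fun _ => t) hst] with ω h1 h2 h3 h5
    obtain ⟨L, hL0, hL⟩ := exists_bound h2 t
    have h4 := h1 _ _ (L ^ 2) (fun u hu => by
      rw [abs_pow]; exact pow_le_pow_left₀ (abs_nonneg _) (hL u hu.2).1 2)
      fun u _ => (h3.tendsto_leftLim u).pow 2
    rw [h5, min_self, min_eq_left hst] at h4
    exact h4

/-- On an event of `𝓕 T` on which the increments of `∫ G_{u-} dM_u` after the time `T` are bounded,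
these increments have conditional mean zero and conditional variance given by `∫ G_u² Λ_u du`. -/
lemma mart_isometry [IsProbabilityMeasure P] (hG : GoodPaths P 𝓕 G M C Λ)
    (hM : StronglyAdapted 𝓕 M) (hC : StronglyAdapted 𝓕 C)
    {ρ : ℕ → Ω → ℝ≥0} (hρ : ∀ᵐ ω ∂P, ∀ t, ∀ᶠ p in atTop, t ≤ ρ p ω)
    (hred : ∀ p : ℕ, Reduces P 𝓕 M C (ρ p) p) {K : ℝ} (hK : ∀ᵐ ω ∂P, ∀ t, quad G Λ t ω ≤ K)
    {T : ℝ≥0} {D : Set Ω} (hD : MeasurableSet[𝓕 T] D) {b : ℝ}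
    (hb : ∀ᵐ ω ∂P, ω ∈ D → ∀ u v, T ≤ u → u ≤ v → |mart G M v ω - mart G M u ω| ≤ b)
    (hTs : T ≤ s) (hst : s ≤ t) :
    MeanZeroGiven P (𝓕 s) (D.indicator fun ω => mart G M t ω - mart G M s ω) ∧
    MeanZeroGiven P (𝓕 s) (D.indicator fun ω => (mart G M t ω - mart G M s ω) ^ 2 -
      (quad G Λ t ω - quad G Λ s ω)) := by
  have hDs : MeasurableSet[𝓕 s] D := 𝓕.mono hTs _ hD
  have hDm : MeasurableSet D := 𝓕.le T _ hD
  have hNm := (hG.aestronglyMeasurable_mart hM hst).mono (𝓕.le t)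
  have hQm := (hG.aestronglyMeasurable_quad hC hst).mono (𝓕.le t)
  have hK' : ∀ᵐ ω ∂P, ∀ u v, u ≤ v →
      0 ≤ quad G Λ v ω - quad G Λ u ω ∧ quad G Λ v ω - quad G Λ u ω ≤ K := by
    filter_upwards [hK, hG.quad_mono] with ω h1 h2 u v huv
    have h3 : quad G Λ u ω ≤ quad G Λ v ω := h2 huv
    have h4 : quad G Λ 0 ω ≤ quad G Λ u ω := h2 zero_le
    have h5 : quad G Λ 0 ω = 0 := by simp [quad]
    exact ⟨by linarith, by linarith [h1 v]⟩
  have hbs : ∀ᵐ ω ∂P, ∀ r, ω ∈ D → |mart G M (min t r) ω - mart G M (min s r) ω| ≤ b := by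
    filter_upwards [hb] with ω h r hω
    rcases le_total r s with hr | hr
    · rw [min_eq_right hr, min_eq_right (hr.trans hst), sub_self]
      simpa using h hω T T le_rfl le_rfl
    · rw [min_eq_left hr]
      exact h hω s _ hTs (le_min hst hr)
  -- the stopped isometry, in terms of increments
  have hiso : ∀ A, MeasurableSet[𝓕 s] A → ∀ p,
      (AEStronglyMeasurable ((A ∩ D).indicator fun ω =>
        mart G M (min t (ρ p ω)) ω - mart G M (min s (ρ p ω)) ω) P) ∧
      ∫ ω, (A ∩ D).indicator (fun ω =>
        mart G M (min t (ρ p ω)) ω - mart G M (min s (ρ p ω)) ω) ω ∂P = 0 ∧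
      ∫ ω, (A ∩ D).indicator (fun ω =>
        mart G M (min t (ρ p ω)) ω - mart G M (min s (ρ p ω)) ω) ω ^ 2 ∂P =
      ∫ ω, (A ∩ D).indicator (fun ω =>
        quad G Λ (min t (ρ p ω)) ω - quad G Λ (min s (ρ p ω)) ω) ω ∂P ∧
      AEStronglyMeasurable ((A ∩ D).indicator fun ω =>
        quad G Λ (min t (ρ p ω)) ω - quad G Λ (min s (ρ p ω)) ω) P := by
    intro A hA p
    have hbr := hG.integral_stoppedBracket (ρ p) hst
    have h := isometry_stopped (hred p) hG (hA.inter hDs) hst (K := K) (by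
      filter_upwards [hbr, hK'] with ω h1 h2
      rw [h1]; exact (h2 _ _ (min_le_min_right _ hst)).2)
    have e1 : (A ∩ D).indicator (fun ω => stoppedIntegral
        (Function.leftLim (fun r => G r ω)) (fun u => M u ω) s t (ρ p ω)) =ᵐ[P]
        (A ∩ D).indicator fun ω =>
          mart G M (min t (ρ p ω)) ω - mart G M (min s (ρ p ω)) ω := by
      filter_upwards [hG.fv] with ω h1
      by_cases hω : ω ∈ A ∩ D
      · simp only [indicator_of_mem hω]; exact stoppedIntegral_eq_sub h1 _ hst _
      · simp only [indicator_of_notMem hω]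
    have e2 : (A ∩ D).indicator (fun ω => ∫ u in Ioc s t,
        Function.leftLim (fun r => G r ω) u ^ 2 ∂(stoppedBracket Λ (ρ p) t ω)) =ᵐ[P]
        (A ∩ D).indicator fun ω =>
          quad G Λ (min t (ρ p ω)) ω - quad G Λ (min s (ρ p ω)) ω := by
      filter_upwards [hbr] with ω h1
      by_cases hω : ω ∈ A ∩ D
      · simp only [indicator_of_mem hω]; exact h1
      · simp only [indicator_of_notMem hω]
    refine ⟨(h.1.ae_eq e1).1, ?_, ?_, h.2.2.2.congr e2⟩
    · rw [← h.2.1]; exact integral_congr_ae e1.symm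
    · rw [← integral_congr_ae e2, ← h.2.2.1]
      exact integral_congr_ae (e1.symm.mono fun ω hω => by simp only [hω])
  have hconv : ∀ (A : Set Ω), ∀ᵐ ω ∂P, ∀ X : ℝ≥0 → Ω → ℝ, Tendsto (fun p => (A ∩ D).indicator
      (fun ω => X (min t (ρ p ω)) ω - X (min s (ρ p ω)) ω) ω) atTop
      (𝓝 ((A ∩ D).indicator (fun ω => X t ω - X s ω) ω)) := by
    intro A
    filter_upwards [hρ] with ω h X
    refine indicator_eventually_tendsto ((h t).mono fun p hp => ?_)
    rw [min_eq_left hp, min_eq_left (hst.trans hp)]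
  -- The restriction to `D` makes the stopped increments bounded uniformly in `p`; the localization
  -- can then be removed by dominated convergence.
  have hbA : ∀ (A : Set Ω), ∀ᵐ ω ∂P, ∀ p, |(A ∩ D).indicator (fun ω =>
      mart G M (min t (ρ p ω)) ω - mart G M (min s (ρ p ω)) ω) ω| ≤ |b| := by
    intro A
    filter_upwards [hbs] with ω h p
    by_cases hω : ω ∈ A ∩ D
    · rw [indicator_of_mem hω]; exact (h _ hω.2).trans (le_abs_self b)
    · rw [indicator_of_notMem hω, abs_zero]; exact abs_nonneg b
  have hfirst : ∀ A, MeasurableSet[𝓕 s] A →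
      ∫ ω, (A ∩ D).indicator (fun ω => mart G M t ω - mart G M s ω) ω ∂P = 0 := by
    intro A hA
    have := tendsto_integral_of_dominated_convergence (fun _ => |b|)
      (fun p => (hiso A hA p).1) (integrable_const _)
      (fun p => (hbA A).mono fun ω h => h p) ((hconv A).mono fun ω h => h (mart G M))
    simp only [fun p => (hiso A hA p).2.1] at this
    exact (tendsto_nhds_unique tendsto_const_nhds this).symm
  have hqbA : ∀ (A : Set Ω), ∀ᵐ ω ∂P, ∀ u v, u ≤ v → |(A ∩ D).indicator (fun ω =>
      quad G Λ v ω - quad G Λ u ω) ω| ≤ K := by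
    intro A
    filter_upwards [hK'] with ω h u v huv
    by_cases hω : ω ∈ A ∩ D
    · rw [indicator_of_mem hω, abs_of_nonneg (h u v huv).1]; exact (h u v huv).2
    · rw [indicator_of_notMem hω, abs_zero]; exact (h u v huv).1.trans (h u v huv).2
  have hNi : ∀ A, MeasurableSet A → Integrable ((A ∩ D).indicator (fun ω =>
      mart G M t ω - mart G M s ω)) P ∧ Integrable (fun ω => (A ∩ D).indicator (fun ω =>
      mart G M t ω - mart G M s ω) ω ^ 2) P := by
    intro A hA
    have hm := hNm.indicator (hA.inter hDm)
    have hbd : ∀ᵐ ω ∂P, |(A ∩ D).indicator (fun ω => mart G M t ω - mart G M s ω) ω| ≤ |b| := by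
      filter_upwards [hbA A, hconv A] with ω h1 h2
      exact le_of_tendsto' (h2 (mart G M)).abs h1
    refine ⟨Integrable.of_bound hm |b| hbd, Integrable.of_bound (hm.pow 2) (|b| ^ 2) ?_⟩
    filter_upwards [hbd] with ω h
    rw [norm_pow]; exact pow_le_pow_left₀ (norm_nonneg _) h 2
  have hQi : ∀ A, MeasurableSet A → Integrable ((A ∩ D).indicator (fun ω =>
      quad G Λ t ω - quad G Λ s ω)) P := fun A hA =>
    Integrable.of_bound (hQm.indicator (hA.inter hDm)) K ((hqbA A).mono fun ω h => h s t hst)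
  have hsecond : ∀ A, MeasurableSet[𝓕 s] A →
      ∫ ω, (A ∩ D).indicator (fun ω => mart G M t ω - mart G M s ω) ω ^ 2 ∂P =
      ∫ ω, (A ∩ D).indicator (fun ω => quad G Λ t ω - quad G Λ s ω) ω ∂P := by
    intro A hA
    have h1 := tendsto_integral_of_dominated_convergence (fun _ => |b| ^ 2)
      (fun p => (hiso A hA p).1.pow 2) (integrable_const _)
      (fun p => (hbA A).mono fun ω h => by
        rw [Pi.pow_apply, norm_pow]; exact pow_le_pow_left₀ (norm_nonneg _) (h p) 2)
      ((hconv A).mono fun ω h => (h (mart G M)).pow 2)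
    have h2 := tendsto_integral_of_dominated_convergence (fun _ => K)
      (fun p => (hiso A hA p).2.2.2) (integrable_const _)
      (fun p => (hqbA A).mono fun ω h => by
        have h4 := h _ _ (min_le_min_right (ρ p ω) hst)
        by_cases hω : ω ∈ A ∩ D
        · simpa only [indicator_of_mem hω, Real.norm_eq_abs] using h4
        · simpa only [indicator_of_notMem hω, Real.norm_eq_abs] using h4)
      ((hconv A).mono fun ω h => h (quad G Λ))
    have h3 : ∀ p, ∫ ω, ((A ∩ D).indicator (fun ω =>
        mart G M (min t (ρ p ω)) ω - mart G M (min s (ρ p ω)) ω) ^ 2) ω ∂P = _ :=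
      fun p => (hiso A hA p).2.2.1
    simp only [h3] at h1
    exact tendsto_nhds_unique h1 h2
  constructor
  · refine MeanZeroGiven.of_setIntegral (𝓕.le s) ?_ fun A hA => ?_
    · simpa using (hNi univ MeasurableSet.univ).1
    · rw [← integral_indicator (𝓕.le s _ hA), indicator_indicator]
      exact hfirst A hA
  · have hrw : ∀ A : Set Ω, (A ∩ D).indicator (fun ω => (mart G M t ω - mart G M s ω) ^ 2 -
        (quad G Λ t ω - quad G Λ s ω)) = fun ω =>
        (A ∩ D).indicator (fun ω => mart G M t ω - mart G M s ω) ω ^ 2 -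
        (A ∩ D).indicator (fun ω => quad G Λ t ω - quad G Λ s ω) ω := by
      intro A
      funext ω
      by_cases hω : ω ∈ A ∩ D
      · simp only [indicator_of_mem hω]
      · simp only [indicator_of_notMem hω]; ring
    refine MeanZeroGiven.of_setIntegral (𝓕.le s) ?_ fun A hA => ?_
    · have := ((hNi univ MeasurableSet.univ).2).sub (hQi univ MeasurableSet.univ)
      have h4 := hrw univ
      simp only [univ_inter] at h4 this
      rw [h4]
      exact this
    · rw [← integral_indicator (𝓕.le s _ hA), indicator_indicator, hrw A,
        integral_sub (hNi A (𝓕.le s _ hA)).2 (hQi A (𝓕.le s _ hA)), hsecond A hA, sub_self]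

end drivingMartingale


/-! ### The compensated cosine along one discrete path. -/

section pathwiseCosine

/-- The remainder of the second order expansion of `cos (y + d) * exp (q / 2)`. -/
noncomputable def cosRem (y d q : ℝ) : ℝ :=
  Real.cos (y + d) * Real.exp (q / 2) - Real.cos y + Real.sin y * d +
    Real.cos y * (d ^ 2 - q) / 2

/-- The remainder is of third order if `q` counts as a square, whence one factor `δ` remains beside
`d² + 2q`. Since `d²` and `q` have the same conditional mean, the sum over steps is controlled by
`3δ` times the total bracket. -/
lemma abs_cosRem_le_of_small {y d q δ : ℝ} (hδ : δ ≤ 1) (hd : |d| ≤ δ) (hq0 : 0 ≤ q)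
    (hq : q ≤ δ) : |cosRem y d q| ≤ δ * (d ^ 2 + 2 * q) := by
  have hd1 : |d| ≤ 1 := hd.trans hδ
  have h1 := Real.cos_bound hd1
  have h2 : |Real.sin d - (d - d ^ 3 / 6)| ≤ |d| ^ 4 * (5 / 96) := by
    refine (Real.sin_bound hd1).trans ?_
    have h4 : |d| ^ 5 ≤ |d| ^ 4 := pow_le_pow_of_le_one (abs_nonneg d) hd1 (by norm_num)
    have h5 : 0 ≤ |d| ^ 4 := by positivity
    linarith
  have h3 := Real.abs_exp_sub_one_sub_id_le (x := q / 2) (by rw [abs_of_nonneg (by linarith)]; linarith)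
  have hd0 := abs_nonneg d
  have hd4 : |d| ^ 4 ≤ |d| * d ^ 2 := by
    rw [← sq_abs]
    have : |d| ^ 4 = (|d| * |d| ^ 2) * |d| := by ring
    rw [this]
    exact mul_le_of_le_one_right (by positivity) hd1
  have hd3 : |d| * d ^ 2 ≤ δ * d ^ 2 := mul_le_mul_of_nonneg_right hd (sq_nonneg d)
  have e1 : |Real.cos (y + d) - Real.cos y + Real.sin y * d + Real.cos y * d ^ 2 / 2| ≤
      δ * d ^ 2 := by
    have : Real.cos (y + d) - Real.cos y + Real.sin y * d + Real.cos y * d ^ 2 / 2 =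
        Real.cos y * (Real.cos d - (1 - d ^ 2 / 2)) -
        Real.sin y * ((Real.sin d - (d - d ^ 3 / 6)) - d ^ 3 / 6) := by
      rw [Real.cos_add]; ring
    rw [this]
    have h4 : |Real.cos y * (Real.cos d - (1 - d ^ 2 / 2))| ≤ |d| ^ 4 * (5 / 96) := by
      rw [abs_mul]
      exact (mul_le_of_le_one_left (abs_nonneg _) (Real.abs_cos_le_one y)).trans h1
    have h5 : |Real.sin y * ((Real.sin d - (d - d ^ 3 / 6)) - d ^ 3 / 6)| ≤
        |d| ^ 4 * (5 / 96) + |d| * d ^ 2 / 6 := by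
      rw [abs_mul]
      refine (mul_le_of_le_one_left (abs_nonneg _) (Real.abs_sin_le_one y)).trans ?_
      refine (abs_sub _ _).trans (add_le_add h2 (le_of_eq ?_))
      rw [abs_div, abs_pow, ← sq_abs d, abs_of_pos (by norm_num : (0 : ℝ) < 6)]
      ring
    refine (abs_sub _ _).trans ?_
    have : 0 ≤ |d| * d ^ 2 := by positivity
    linarith
  have e2 : |Real.cos (y + d) * (Real.exp (q / 2) - 1 - q / 2)| ≤ δ * q / 4 := by
    rw [abs_mul]
    refine (mul_le_of_le_one_left (abs_nonneg _) (Real.abs_cos_le_one _)).trans (h3.trans ?_)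
    nlinarith
  have e3 : |q / 2 * (Real.cos (y + d) - Real.cos y)| ≤ δ * q / 2 := by
    rw [abs_mul, abs_of_nonneg (by linarith : 0 ≤ q / 2)]
    have h6 : |Real.cos (y + d) - Real.cos y| ≤ |d| := by
      have := Real.abs_cos_sub_cos_le (y + d) y
      simpa using this
    have := mul_le_mul_of_nonneg_left (h6.trans hd) (by linarith : 0 ≤ q / 2)
    linarith
  -- Taylor error of the cosine, Taylor error of the exponential, and the mixed term.
  have hR : cosRem y d q =
      (Real.cos (y + d) - Real.cos y + Real.sin y * d + Real.cos y * d ^ 2 / 2) +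
      (Real.cos (y + d) * (Real.exp (q / 2) - 1 - q / 2) +
        q / 2 * (Real.cos (y + d) - Real.cos y)) := by
    unfold cosRem; ring
  rw [hR]
  refine (abs_add_le _ _).trans ((add_le_add e1 ((abs_add_le _ _).trans (add_le_add e2 e3))).trans ?_)
  have : 0 ≤ δ * q := mul_nonneg (hq0.trans hq) hq0
  linarith

/-- A crude bound, for the single step that may exceed `δ` before stopping takes effect. -/
lemma abs_cosRem_le {y d q b : ℝ} (hd : |d| ≤ b) (hq0 : 0 ≤ q) (hq : q ≤ b) :
    |cosRem y d q| ≤ Real.exp (b / 2) + 1 + b + (b ^ 2 + b) := by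
  have e1 : |Real.cos (y + d) * Real.exp (q / 2)| ≤ Real.exp (b / 2) := by
    rw [abs_mul, abs_of_pos (Real.exp_pos _)]
    refine (mul_le_of_le_one_left (Real.exp_pos _).le (Real.abs_cos_le_one _)).trans ?_
    exact Real.exp_le_exp.2 (by linarith)
  have e2 : |Real.sin y * d| ≤ b := by
    rw [abs_mul]
    exact (mul_le_of_le_one_left (abs_nonneg _) (Real.abs_sin_le_one _)).trans hd
  have e3 : |Real.cos y * (d ^ 2 - q) / 2| ≤ b ^ 2 + b := by
    rw [abs_div, abs_mul, abs_two]
    have h1 : |d ^ 2 - q| ≤ b ^ 2 + b := by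
      refine (abs_sub _ _).trans (add_le_add ?_ (by rwa [abs_of_nonneg hq0]))
      rw [abs_pow]; exact pow_le_pow_left₀ (abs_nonneg _) hd 2
    have h2 := mul_le_of_le_one_left (abs_nonneg (d ^ 2 - q)) (Real.abs_cos_le_one y)
    have h3 := mul_nonneg (abs_nonneg (Real.cos y)) (abs_nonneg (d ^ 2 - q))
    linarith
  unfold cosRem
  refine (abs_add_le _ _).trans (add_le_add ?_ e3)
  refine (abs_add_le _ _).trans (add_le_add ?_ e2)
  exact (abs_sub _ _).trans (add_le_add e1 (Real.abs_cos_le_one _))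

/-- Partial sums of a sequence. -/
def psum (d : ℕ → ℝ) (i : ℕ) : ℝ := ∑ j ∈ Finset.range i, d j

lemma psum_succ (d : ℕ → ℝ) (i : ℕ) : psum d (i + 1) = psum d i + d i :=
  Finset.sum_range_succ _ _

lemma psum_zero (d : ℕ → ℝ) : psum d 0 = 0 := by simp [psum]

/-- The compensated cosine `cos (x - m) * exp (v / 2)` of `x = ∑ d`, `v = ∑ q`. -/
noncomputable def expCos (m : ℝ) (d q : ℕ → ℝ) (i : ℕ) : ℝ :=
  Real.cos (psum d i - m) * Real.exp (psum q i / 2)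

/-- The first two terms in the bracket have conditional mean zero; all growth in expectation sits in
`cosRem`. -/
lemma expCos_succ_sub (m : ℝ) (d q : ℕ → ℝ) (i : ℕ) :
    expCos m d q (i + 1) - expCos m d q i = Real.exp (psum q i / 2) *
      (-Real.sin (psum d i - m) * d i - Real.cos (psum d i - m) / 2 * (d i ^ 2 - q i) +
        cosRem (psum d i - m) (d i) (q i)) := by
  have h1 : psum d i + d i - m = psum d i - m + d i := by ring
  have h2 : (psum q i + q i) / 2 = psum q i / 2 + q i / 2 := by ring
  rw [expCos, expCos, psum_succ, psum_succ, h1, h2, Real.exp_add, cosRem]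
  ring

/-- Before the step `i` all the increments are at most `δ`, and the bracket is at most `c`. -/
def Stay (δ c : ℝ) (d q : ℕ → ℝ) (i : ℕ) : Prop :=
  (∀ j < i, |d j| ≤ δ ∧ q j ≤ δ) ∧ psum q i ≤ c

lemma Stay.of_succ {δ c : ℝ} {d q : ℕ → ℝ} (hq : ∀ i, 0 ≤ q i) {i : ℕ}
    (h : Stay δ c d q (i + 1)) : Stay δ c d q i := by
  refine ⟨fun j hj => h.1 j (by omega), ?_⟩
  have := h.2
  rw [psum_succ] at this
  linarith [hq i]

-- `Stay` holds on an initial segment of indices, so the restricted sum telescopes to a stopped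
-- value. The last step taken may overshoot the level `c`, by at most `b`.
open scoped Classical in
lemma exists_stopped_index {δ c b : ℝ} {d q : ℕ → ℝ} (hq : ∀ i, 0 ≤ q i) (hc : 0 ≤ c) (hb : 0 ≤ b) (n : ℕ)
    (hqb : ∀ i < n, q i ≤ b) :
    ∃ τ, (∀ f : ℕ → ℝ, ∑ i ∈ Finset.range n,
        (if Stay δ c d q i then f (i + 1) - f i else 0) = f τ - f 0) ∧
      psum q τ ≤ c + b ∧ (Stay δ c d q n → τ = n) := by
  induction n with
  | zero => exact ⟨0, fun f => by simp, by rw [psum_zero]; linarith, fun _ => rfl⟩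
  | succ n ih =>
    obtain ⟨τ, h1, h2, h3⟩ := ih fun i hi => hqb i (by omega)
    by_cases hs : Stay δ c d q n
    · refine ⟨n + 1, fun f => ?_, ?_, fun _ => rfl⟩
      · rw [Finset.sum_range_succ, h1, h3 hs, if_pos hs]; ring
      · rw [psum_succ]
        linarith [hs.2, hqb n (by omega)]
    · refine ⟨τ, fun f => ?_, h2, fun h => absurd (h.of_succ hq) hs⟩
      rw [Finset.sum_range_succ, h1, if_neg hs, add_zero]

-- `Stay` forbids any earlier large step, so at most one index counts.
open scoped Classical in
lemma count_large_le {δ c : ℝ} {d q : ℕ → ℝ} (hq : ∀ i, 0 ≤ q i) (n : ℕ) :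
    ∑ i ∈ Finset.range n,
      (if Stay δ c d q i ∧ ¬(|d i| ≤ δ ∧ q i ≤ δ) then (1 : ℝ) else 0) ≤
      if ∃ j < n, ¬(|d j| ≤ δ ∧ q j ≤ δ) then 1 else 0 := by
  have key : ∑ i ∈ Finset.range n,
      (if Stay δ c d q i ∧ ¬(|d i| ≤ δ ∧ q i ≤ δ) then (1 : ℝ) else 0) ≤ 1 ∧
      (Stay δ c d q n → ∑ i ∈ Finset.range n,
      (if Stay δ c d q i ∧ ¬(|d i| ≤ δ ∧ q i ≤ δ) then (1 : ℝ) else 0) = 0) := by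
    induction n with
    | zero => simp
    | succ n ih =>
      rw [Finset.sum_range_succ]
      by_cases hs : Stay δ c d q n
      · rw [ih.2 hs, zero_add]
        refine ⟨by split_ifs <;> norm_num, fun h => ?_⟩
        rw [if_neg]
        rintro ⟨_, h2⟩
        exact h2 (h.1 n (by omega))
      · rw [if_neg (fun h => hs h.1), add_zero]
        exact ⟨ih.1, fun h => absurd (h.of_succ hq) hs⟩
  split_ifs with h
  · exact key.1
  · push Not at h
    refine (Finset.sum_eq_zero fun i hi => ?_).le
    rw [if_neg]
    rintro ⟨_, h2⟩
    exact h2 (h i (Finset.mem_range.1 hi))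

lemma abs_expCos_le (m : ℝ) (d q : ℕ → ℝ) (i : ℕ) :
    |expCos m d q i| ≤ Real.exp (psum q i / 2) := by
  rw [expCos, abs_mul, abs_of_pos (Real.exp_pos _)]
  exact mul_le_of_le_one_left (Real.exp_pos _).le (Real.abs_cos_le_one _)

open scoped Classical in
lemma neg_le_stopped_expCos {δ c b m : ℝ} {d q : ℕ → ℝ} (hq : ∀ i, 0 ≤ q i) (hc : 0 ≤ c)
    (hb : 0 ≤ b) (n : ℕ) (hqb : ∀ i < n, q i ≤ b) :
    -(Real.exp ((c + b) / 2) + 1) ≤ ∑ i ∈ Finset.range n,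
      (if Stay δ c d q i then expCos m d q (i + 1) - expCos m d q i else 0) := by
  obtain ⟨τ, h1, h2, -⟩ := exists_stopped_index (δ := δ) (d := d) hq hc hb n hqb
  rw [h1 (expCos m d q)]
  have h3 := abs_expCos_le m d q τ
  have h4 : Real.exp (psum q τ / 2) ≤ Real.exp ((c + b) / 2) :=
    Real.exp_le_exp.2 (by linarith)
  have h5 := abs_expCos_le m d q 0
  rw [psum_zero, zero_div, Real.exp_zero] at h5
  linarith [neg_abs_le (expCos m d q τ), le_abs_self (expCos m d q 0)]

-- The overshoot above `c` is one step of the bracket: at most `δ` if all steps are small, at most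
-- `b` otherwise.
open scoped Classical in
lemma stopped_bracket_le {δ c b : ℝ} {d q : ℕ → ℝ} (hδ : 0 ≤ δ) (hq : ∀ i, 0 ≤ q i) (hc : 0 ≤ c)
    (hqb : ∀ i, q i ≤ b) (n : ℕ) :
    ∑ i ∈ Finset.range n, (if Stay δ c d q i then q i else 0) ≤
      c + δ + if ∃ j < n, ¬(|d j| ≤ δ ∧ q j ≤ δ) then b else 0 := by
  have hb : 0 ≤ b := (hq 0).trans (hqb 0)
  have hps : ∀ i, q i = psum q (i + 1) - psum q i := fun i => by rw [psum_succ]; ring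
  split_ifs with h
  · obtain ⟨τ, h1, h2, -⟩ := exists_stopped_index (δ := δ) (d := d) hq hc hb n fun i _ => hqb i
    have h3 := h1 (psum q)
    simp only [← hps, psum_zero, sub_zero] at h3
    rw [h3]; linarith
  · push Not at h
    obtain ⟨τ, h1, h2, -⟩ := exists_stopped_index (δ := δ) (d := d) hq hc hδ n fun i hi => (h i hi).2
    have h3 := h1 (psum q)
    simp only [← hps, psum_zero, sub_zero] at h3
    rw [h3]; linarith

end pathwiseCosine


/-! ### The expected growth of the compensated cosine in discrete time. -/

section discreteCosine

variable {Ω : Type*} {mΩ : MeasurableSpace Ω} {P : Measure Ω}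

lemma stronglyMeasurable_div_two {m : MeasurableSpace Ω} {f : Ω → ℝ}
    (hf : StronglyMeasurable[m] f) : StronglyMeasurable[m] fun ω => f ω / 2 :=
  (continuous_id.div_const (2 : ℝ)).comp_stronglyMeasurable hf

/-- The event that some increment before the step `n` exceeds `δ`. -/
def largeStep (δ : ℝ) (d q : ℕ → Ω → ℝ) (n : ℕ) : Set Ω :=
  {ω | ∃ j < n, ¬(|d j ω| ≤ δ ∧ q j ω ≤ δ)}

/-- The event that no increment exceeds `δ`, the bracket stays below `c`, and the compensated cosine
has increased by at least `c₀`. -/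
def cosineGain (δ c c₀ : ℝ) (m : Ω → ℝ) (d q : ℕ → Ω → ℝ) (n : ℕ) : Set Ω :=
  {ω | ω ∉ largeStep δ d q n ∧ psum (fun i => q i ω) n ≤ c ∧
    c₀ ≤ expCos (m ω) (fun i => d i ω) (fun i => q i ω) n -
      expCos (m ω) (fun i => d i ω) (fun i => q i ω) 0}

/-- The expectation of the compensated cosine of a discrete martingale grows little, so that the
event on which it grows by `c₀` has small probability. -/
lemma discrete_cosine_bound [IsProbabilityMeasure P] {𝓗 : Filtration ℕ mΩ} {d q : ℕ → Ω → ℝ}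
    {m : Ω → ℝ} {D : Set Ω} {b c δ c₀ : ℝ}
    (hdm : ∀ i, StronglyMeasurable[𝓗 (i + 1)] (d i))
    (hqm : ∀ i, StronglyMeasurable[𝓗 (i + 1)] (q i)) (hm : StronglyMeasurable[𝓗 0] m)
    (hD : MeasurableSet[𝓗 0] D) (hdb : ∀ i ω, |d i ω| ≤ b) (hq0 : ∀ i ω, 0 ≤ q i ω)
    (hqb : ∀ i ω, q i ω ≤ b) (hd : ∀ i, MeanZeroGiven P (𝓗 i) (D.indicator (d i)))
    (hdq : ∀ i, MeanZeroGiven P (𝓗 i) (D.indicator fun ω => d i ω ^ 2 - q i ω))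
    (hc : 0 ≤ c) (hδ0 : 0 ≤ δ) (hδ : δ ≤ 1) (n : ℕ) :
    c₀ * P.real (D ∩ cosineGain δ c c₀ m d q n) ≤
      (Real.exp ((c + 1) / 2) + 1) * P.real (D \ cosineGain δ c c₀ m d q n) +
      Real.exp (c / 2) * (3 * δ * (c + δ)) * P.real D +
      (Real.exp ((c + b) / 2) + 1 + Real.exp (c / 2) * (3 * b +
        (Real.exp (b / 2) + 1 + b + (b ^ 2 + b)))) * P.real (D ∩ largeStep δ d q n) := by
  classical
  have hDm : MeasurableSet D := 𝓗.le 0 _ hD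
  have hdm' : ∀ i j, i < j → StronglyMeasurable[𝓗 j] (d i) := fun i j hij =>
    (hdm i).mono (𝓗.mono hij)
  have hqm' : ∀ i j, i < j → StronglyMeasurable[𝓗 j] (q i) := fun i j hij =>
    (hqm i).mono (𝓗.mono hij)
  have hpd : ∀ i, StronglyMeasurable[𝓗 i] (fun ω => psum (fun j => d j ω) i) := fun i =>
    Finset.stronglyMeasurable_fun_sum _ fun j hj => hdm' j i (Finset.mem_range.1 hj)
  have hpq : ∀ i, StronglyMeasurable[𝓗 i] (fun ω => psum (fun j => q j ω) i) := fun i =>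
    Finset.stronglyMeasurable_fun_sum _ fun j hj => hqm' j i (Finset.mem_range.1 hj)
  have hm' : ∀ i, StronglyMeasurable[𝓗 i] m := fun i => hm.mono (𝓗.mono (Nat.zero_le i))
  have hsmall : ∀ j i, j < i → MeasurableSet[𝓗 i] {ω | |d j ω| ≤ δ ∧ q j ω ≤ δ} := by
    intro j i hji
    have h1 : Measurable[𝓗 i] (fun ω => |d j ω|) := (hdm' j i hji).norm.measurable
    have h2 : Measurable[𝓗 i] (q j) := (hqm' j i hji).measurable
    exact MeasurableSet.inter (h1 measurableSet_Iic) (h2 measurableSet_Iic)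
  have hlarge : ∀ i, MeasurableSet[𝓗 i] (largeStep δ d q i) := by
    intro i
    have : largeStep δ d q i = ⋃ j ∈ Finset.range i, {ω | |d j ω| ≤ δ ∧ q j ω ≤ δ}ᶜ := by
      ext ω; simp only [largeStep, mem_ofPred_eq, mem_iUnion, Finset.mem_range, mem_compl_iff,
        exists_prop]
    rw [this]
    exact Finset.measurableSet_biUnion _ fun j hj => (hsmall j i (Finset.mem_range.1 hj)).compl
  -- the predictable event on which the process has not been stopped
  set St : ℕ → Set Ω := fun i =>
    {ω | ω ∈ D ∧ Stay δ c (fun j => d j ω) (fun j => q j ω) i} with hSt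
  have hStm : ∀ i, MeasurableSet[𝓗 i] (St i) := by
    intro i
    have : St i = D ∩ ((largeStep δ d q i)ᶜ ∩ {ω | psum (fun j => q j ω) i ≤ c}) := by
      ext ω
      simp only [hSt, Stay, largeStep, mem_ofPred_eq, mem_inter_iff, mem_compl_iff]
      push Not
      rfl
    rw [this]
    exact (𝓗.mono (Nat.zero_le i) _ hD).inter ((hlarge i).compl.inter
      ((hpq i).measurable measurableSet_Iic))
  -- The exponential factor, switched off after stopping: it is known at step `i` and bounded by
  -- `exp (c / 2)`, so multiplying by it preserves conditional mean zero.
  set ζ : ℕ → Ω → ℝ := fun i =>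
    (St i).indicator fun ω => Real.exp (psum (fun j => q j ω) i / 2) with hζ
  have hζm : ∀ i, StronglyMeasurable[𝓗 i] (ζ i) := fun i =>
    (Real.continuous_exp.comp_stronglyMeasurable (stronglyMeasurable_div_two (hpq i))).indicator (hStm i)
  have hζ0 : ∀ i ω, 0 ≤ ζ i ω := fun i ω => indicator_nonneg (fun _ _ => (Real.exp_pos _).le) ω
  have hζb : ∀ i ω, ζ i ω ≤ Real.exp (c / 2) := by
    intro i ω
    by_cases hω : ω ∈ St i
    · simp only [hζ, indicator_of_mem hω]
      exact Real.exp_le_exp.2 (by linarith [hω.2.2])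
    · simp only [hζ, indicator_of_notMem hω]; exact (Real.exp_pos _).le
  have hbdd : ∀ {f : Ω → ℝ} {B : ℝ}, StronglyMeasurable f → (∀ ω, |f ω| ≤ B) → Integrable f P :=
    fun hf hB => Integrable.of_bound hf.aestronglyMeasurable _ (Eventually.of_forall hB)
  set y : ℕ → Ω → ℝ := fun i ω => psum (fun j => d j ω) i - m ω with hy
  have hym : ∀ i, StronglyMeasurable[𝓗 i] (y i) := fun i => (hpd i).sub (hm' i)
  set e : ℝ := Real.exp (c / 2) with he
  have he0 : 0 < e := Real.exp_pos _
  -- the two martingale terms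
  have h1 : ∀ i, MeanZeroGiven P (𝓗 i) (fun ω => (-(ζ i ω * Real.sin (y i ω))) *
      D.indicator (d i) ω) := by
    intro i
    have hs : StronglyMeasurable[𝓗 i] (fun ω => -(ζ i ω * Real.sin (y i ω))) :=
      ((hζm i).mul (Real.continuous_sin.comp_stronglyMeasurable (hym i))).neg
    refine (hd i).mul hs.aestronglyMeasurable ?_
    refine Integrable.bdd_mul (c := e) (hd i).1 (hs.mono (𝓗.le i)).aestronglyMeasurable
      (Eventually.of_forall fun ω => ?_)
    rw [norm_neg, norm_mul, Real.norm_eq_abs, Real.norm_eq_abs, abs_of_nonneg (hζ0 i ω)]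
    exact (mul_le_of_le_one_right (hζ0 i ω) (Real.abs_sin_le_one _)).trans (hζb i ω)
  have h2 : ∀ i, MeanZeroGiven P (𝓗 i) (fun ω => (-(ζ i ω * Real.cos (y i ω)) / 2) *
      D.indicator (fun ω => d i ω ^ 2 - q i ω) ω) := by
    intro i
    have hs : StronglyMeasurable[𝓗 i] (fun ω => -(ζ i ω * Real.cos (y i ω)) / 2) :=
      stronglyMeasurable_div_two
        ((hζm i).mul (Real.continuous_cos.comp_stronglyMeasurable (hym i))).neg
    refine (hdq i).mul hs.aestronglyMeasurable ?_
    refine Integrable.bdd_mul (c := e) (hdq i).1 (hs.mono (𝓗.le i)).aestronglyMeasurable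
      (Eventually.of_forall fun ω => ?_)
    rw [norm_div, norm_neg, norm_mul, Real.norm_eq_abs, Real.norm_eq_abs, abs_of_nonneg (hζ0 i ω)]
    have := (mul_le_of_le_one_right (hζ0 i ω) (Real.abs_cos_le_one (y i ω))).trans (hζb i ω)
    rw [Real.norm_two]
    linarith
  -- Used in the remainder through `d² + 2q = (d² - q) + 3q`, whose first part has mean zero.
  have h3 : ∀ i, MeanZeroGiven P (𝓗 i) (fun ω => (St i).indicator (1 : Ω → ℝ) ω *
      D.indicator (fun ω => d i ω ^ 2 - q i ω) ω) := by
    intro i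
    have hs : StronglyMeasurable[𝓗 i] ((St i).indicator (1 : Ω → ℝ)) :=
      stronglyMeasurable_one.indicator (hStm i)
    refine (hdq i).mul hs.aestronglyMeasurable ?_
    refine Integrable.bdd_mul (c := 1) (hdq i).1 (hs.mono (𝓗.le i)).aestronglyMeasurable
      (Eventually.of_forall fun ω => ?_)
    by_cases hω : ω ∈ St i <;> simp [hω]
  set R : ℕ → Ω → ℝ := fun i ω => ζ i ω * cosRem (y i ω) (d i ω) (q i ω) with hR
  set B : ℝ := Real.exp (b / 2) + 1 + b + (b ^ 2 + b) with hB
  have hRi : ∀ i, Integrable (R i) P := by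
    intro i
    have hy' := (hym i).mono (𝓗.le i)
    have hd' := (hdm i).mono (𝓗.le _)
    have hq' := (hqm i).mono (𝓗.le _)
    refine hbdd (B := e * B) (((hζm i).mono (𝓗.le i)).mul ?_) fun ω => ?_
    · unfold cosRem
      exact (((((Real.continuous_cos.comp_stronglyMeasurable (hy'.add hd')).mul
        (Real.continuous_exp.comp_stronglyMeasurable (stronglyMeasurable_div_two hq'))).sub
        (Real.continuous_cos.comp_stronglyMeasurable hy')).add
        ((Real.continuous_sin.comp_stronglyMeasurable hy').mul hd')).add
        (stronglyMeasurable_div_two ((Real.continuous_cos.comp_stronglyMeasurable hy').mul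
          ((hd'.pow 2).sub hq'))))
    · rw [hR, abs_mul, abs_of_nonneg (hζ0 i ω)]
      exact mul_le_mul (hζb i ω) (abs_cosRem_le (hdb i ω) (hq0 i ω) (hqb i ω)) (abs_nonneg _) he0.le
  -- the stopped compensated cosine
  set S : Ω → ℝ := fun ω => ∑ i ∈ Finset.range n, (if ω ∈ St i then
    expCos (m ω) (fun j => d j ω) (fun j => q j ω) (i + 1) -
      expCos (m ω) (fun j => d j ω) (fun j => q j ω) i else 0) with hS
  have hSeq : ∀ ω, S ω = ∑ i ∈ Finset.range n, ((-(ζ i ω * Real.sin (y i ω))) *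
      D.indicator (d i) ω + (-(ζ i ω * Real.cos (y i ω)) / 2) *
      D.indicator (fun ω => d i ω ^ 2 - q i ω) ω + R i ω) := by
    intro ω
    refine Finset.sum_congr rfl fun i _ => ?_
    by_cases hω : ω ∈ St i
    · rw [if_pos hω, expCos_succ_sub]
      simp only [hR, hζ, indicator_of_mem hω, indicator_of_mem hω.1, hy]
      ring
    · rw [if_neg hω]
      simp only [hR, hζ, indicator_of_notMem hω]
      ring
  have hterm : ∀ i, Integrable (fun ω => (-(ζ i ω * Real.sin (y i ω))) *
      D.indicator (d i) ω + (-(ζ i ω * Real.cos (y i ω)) / 2) *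
      D.indicator (fun ω => d i ω ^ 2 - q i ω) ω + R i ω) P := fun i =>
    ((h1 i).1.add (h2 i).1).add (hRi i)
  have hSi : Integrable S P := by
    rw [funext hSeq]
    exact integrable_finsetSum _ fun i _ => hterm i
  have hSint : ∫ ω, S ω ∂P = ∫ ω, ∑ i ∈ Finset.range n, R i ω ∂P := by
    simp only [hSeq]
    rw [integral_finsetSum _ fun i _ => hterm i, integral_finsetSum _ fun i _ => hRi i]
    refine Finset.sum_congr rfl fun i _ => ?_
    rw [integral_add (by exact (h1 i).1.add (h2 i).1) (hRi i), integral_add (h1 i).1 (h2 i).1,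
      (h1 i).integral_eq_zero (𝓗.le i), (h2 i).integral_eq_zero (𝓗.le i), zero_add, zero_add]
  have hLm : MeasurableSet (largeStep δ d q n) := 𝓗.le n _ (hlarge n)
  -- upper bound for the remainders
  have hRle : ∀ ω, ∑ i ∈ Finset.range n, R i ω ≤
      e * (δ * ∑ i ∈ Finset.range n, ((St i).indicator (1 : Ω → ℝ) ω *
        D.indicator (fun ω => d i ω ^ 2 - q i ω) ω) +
      D.indicator (fun _ => 3 * δ * (c + δ)) ω +
      (D ∩ largeStep δ d q n).indicator (fun _ => 3 * b + B) ω) := by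
    intro ω
    have hb : 0 ≤ b := (hq0 0 ω).trans (hqb 0 ω)
    have hB0 : 0 ≤ B := by positivity
    by_cases hωD : ω ∈ D
    swap
    · have : ∀ i, ω ∉ St i := fun i h => hωD h.1
      simp [hR, hζ, this, hωD]
    have hiff : ∀ i, ω ∈ St i ↔ Stay δ c (fun j => d j ω) (fun j => q j ω) i := fun i =>
      ⟨fun h => h.2, fun h => ⟨hωD, h⟩⟩
    have hpt : ∀ i, R i ω ≤ e * (δ * ((St i).indicator (1 : Ω → ℝ) ω *
        D.indicator (fun ω => d i ω ^ 2 - q i ω) ω) +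
        3 * δ * (if Stay δ c (fun j => d j ω) (fun j => q j ω) i then q i ω else 0) +
        B * (if Stay δ c (fun j => d j ω) (fun j => q j ω) i ∧
          ¬(|d i ω| ≤ δ ∧ q i ω ≤ δ) then 1 else 0)) := by
      intro i
      by_cases hω : ω ∈ St i
      · have hst := (hiff i).1 hω
        have hle : R i ω ≤ e * |cosRem (y i ω) (d i ω) (q i ω)| :=
          (mul_le_mul_of_nonneg_left (le_abs_self _) (hζ0 i ω)).trans
            (mul_le_mul_of_nonneg_right (hζb i ω) (abs_nonneg _))
        refine hle.trans (mul_le_mul_of_nonneg_left ?_ he0.le)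
        simp only [indicator_of_mem hω, indicator_of_mem hωD, Pi.one_apply, one_mul,
          hst, true_and, if_true]
        by_cases hs : |d i ω| ≤ δ ∧ q i ω ≤ δ
        · rw [if_neg (not_not.2 hs)]
          refine (abs_cosRem_le_of_small hδ hs.1 (hq0 i ω) hs.2).trans (le_of_eq ?_)
          ring
        · rw [if_pos hs]
          refine (abs_cosRem_le (hdb i ω) (hq0 i ω) (hqb i ω)).trans ?_
          have : 0 ≤ δ * (d i ω ^ 2) := mul_nonneg hδ0 (sq_nonneg _)
          have h5 : 0 ≤ δ * q i ω := mul_nonneg hδ0 (hq0 i ω)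
          linarith
      · have hst : ¬ Stay δ c (fun j => d j ω) (fun j => q j ω) i := fun h => hω ((hiff i).2 h)
        simp [hR, hζ, hω, hst]
    refine (Finset.sum_le_sum fun i _ => hpt i).trans ?_
    rw [← Finset.mul_sum, Finset.sum_add_distrib, Finset.sum_add_distrib, ← Finset.mul_sum,
      ← Finset.mul_sum, ← Finset.mul_sum]
    refine mul_le_mul_of_nonneg_left ?_ he0.le
    have k1 := stopped_bracket_le (d := fun j => d j ω) hδ0 (fun i => hq0 i ω) hc
      (fun i => hqb i ω) n
    have k2 := count_large_le (δ := δ) (c := c) (d := fun j => d j ω) (fun i => hq0 i ω) n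
    rw [indicator_of_mem hωD]
    have k3 := mul_le_mul_of_nonneg_left k1 (by linarith : 0 ≤ 3 * δ)
    have k4 := mul_le_mul_of_nonneg_left k2 hB0
    by_cases hl : ω ∈ largeStep δ d q n
    · have hl' : ∃ j < n, ¬(|d j ω| ≤ δ ∧ q j ω ≤ δ) := hl
      rw [indicator_of_mem (show ω ∈ D ∩ largeStep δ d q n from ⟨hωD, hl⟩)]
      simp only [if_pos hl'] at k3 k4
      have k5 : 3 * δ * b ≤ 3 * b := by nlinarith
      linarith
    · have hl' : ¬ ∃ j < n, ¬(|d j ω| ≤ δ ∧ q j ω ≤ δ) := hl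
      rw [indicator_of_notMem (fun h => hl h.2)]
      simp only [if_neg hl'] at k3 k4
      linarith
  set L := largeStep δ d q n with hL
  set E := cosineGain δ c c₀ m d q n with hE
  have hEm : MeasurableSet E := by
    have hmeas : ∀ i, StronglyMeasurable[𝓗 i]
        (fun ω => expCos (m ω) (fun j => d j ω) (fun j => q j ω) i) := fun i =>
      (Real.continuous_cos.comp_stronglyMeasurable (hym i)).mul
        (Real.continuous_exp.comp_stronglyMeasurable (stronglyMeasurable_div_two (hpq i)))
    refine hLm.compl.inter (MeasurableSet.inter ?_ ?_)
    · exact ((hpq n).mono (𝓗.le n)).measurable measurableSet_Iic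
    · exact (((hmeas n).mono (𝓗.le n)).sub ((hmeas 0).mono (𝓗.le 0))).measurable measurableSet_Ici
  have hupper : ∫ ω, S ω ∂P ≤
      e * (3 * δ * (c + δ) * P.real D + (3 * b + B) * P.real (D ∩ L)) := by
    rw [hSint]
    have i1 : Integrable (fun ω => δ * ∑ i ∈ Finset.range n, ((St i).indicator (1 : Ω → ℝ) ω *
        D.indicator (fun ω => d i ω ^ 2 - q i ω) ω)) P :=
      (integrable_finsetSum _ fun i _ => (h3 i).1).const_mul δ
    have i2 : Integrable (D.indicator (fun _ => 3 * δ * (c + δ))) P :=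
      (integrable_const _).indicator hDm
    have i3 : Integrable ((D ∩ L).indicator (fun _ => 3 * b + B)) P :=
      (integrable_const _).indicator (hDm.inter hLm)
    refine (integral_mono (integrable_finsetSum _ fun i _ => hRi i)
      (((i1.add i2).add i3).const_mul e) hRle).trans (le_of_eq ?_)
    rw [integral_const_mul, integral_add' (i1.add i2) i3, integral_add' i1 i2,
      integral_const_mul, integral_finsetSum _ fun i _ => (h3 i).1,
      Finset.sum_eq_zero fun i _ => (h3 i).integral_eq_zero (𝓗.le i), integral_indicator hDm,
      integral_indicator (hDm.inter hLm), setIntegral_const, setIntegral_const]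
    simp only [smul_eq_mul]
    ring
  -- lower bound for the stopped compensated cosine
  have hlower : c₀ * P.real (D ∩ E) - (Real.exp ((c + 1) / 2) + 1) * P.real (D \ E) -
      (Real.exp ((c + b) / 2) + 1) * P.real (D ∩ L) ≤ ∫ ω, S ω ∂P := by
    have i1 : Integrable ((D ∩ E).indicator (fun _ => c₀)) P :=
      (integrable_const _).indicator (hDm.inter hEm)
    have i2 : Integrable ((D \ E).indicator (fun _ => Real.exp ((c + 1) / 2) + 1)) P :=
      (integrable_const _).indicator (hDm.diff hEm)
    have i3 : Integrable ((D ∩ L).indicator (fun _ => Real.exp ((c + b) / 2) + 1)) P :=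
      (integrable_const _).indicator (hDm.inter hLm)
    refine le_trans (le_of_eq ?_) (integral_mono ((i1.sub i2).sub i3) hSi fun ω => ?_)
    · rw [integral_sub' (i1.sub i2) i3, integral_sub' i1 i2,
        integral_indicator (hDm.inter hEm), integral_indicator (hDm.diff hEm),
        integral_indicator (hDm.inter hLm), setIntegral_const, setIntegral_const, setIntegral_const]
      simp only [smul_eq_mul]
      ring
    · simp only [Pi.sub_apply]
      have hb : 0 ≤ b := (hq0 0 ω).trans (hqb 0 ω)
      by_cases hωD : ω ∈ D
      swap
      · have : ∀ i, ω ∉ St i := fun i h => hωD h.1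
        simp [hS, this, hωD]
      have hSω : S ω = ∑ i ∈ Finset.range n, (if Stay δ c (fun j => d j ω) (fun j => q j ω) i then
          expCos (m ω) (fun j => d j ω) (fun j => q j ω) (i + 1) -
          expCos (m ω) (fun j => d j ω) (fun j => q j ω) i else 0) := by
        refine Finset.sum_congr rfl fun i _ => ?_
        simp only [hSt, mem_ofPred_eq, hωD, true_and]
      rw [hSω]
      -- On `E` stopping never occurs, so the sum is the full gain, at least `c₀`; elsewhere only
      -- the lower bound `neg_le_stopped_expCos` is available.
      by_cases hωE : ω ∈ E
      · rw [indicator_of_mem (show ω ∈ D ∩ E from ⟨hωD, hωE⟩),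
          indicator_of_notMem (show ω ∉ D \ E from fun h => h.2 hωE),
          indicator_of_notMem (show ω ∉ D ∩ L from fun h => hωE.1 h.2)]
        have hgood : ∀ j < n, |d j ω| ≤ δ ∧ q j ω ≤ δ := by
          intro j hj
          by_contra hcon
          exact hωE.1 ⟨j, hj, hcon⟩
        obtain ⟨τ, t1, -, t3⟩ := exists_stopped_index (δ := δ) (d := fun j => d j ω)
          (fun i => hq0 i ω) hc hb n fun i _ => hqb i ω
        rw [t1 (expCos (m ω) (fun j => d j ω) (fun j => q j ω)), t3 ⟨hgood, hωE.2.1⟩]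
        linarith [hωE.2.2]
      · rw [indicator_of_notMem (show ω ∉ D ∩ E from fun h => hωE h.2),
          indicator_of_mem (show ω ∈ D \ E from ⟨hωD, hωE⟩)]
        by_cases hωL : ω ∈ L
        · rw [indicator_of_mem (show ω ∈ D ∩ L from ⟨hωD, hωL⟩)]
          have := neg_le_stopped_expCos (δ := δ) (m := m ω) (d := fun j => d j ω)
            (fun i => hq0 i ω) hc hb n fun i _ => hqb i ω
          linarith [Real.exp_pos ((c + 1) / 2)]
        · rw [indicator_of_notMem (show ω ∉ D ∩ L from fun h => hωL h.2)]
          -- Without large steps the overshoot is at most `1`, so the constant in front of `P (D \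
          -- E)` does not involve `b`. This matters because `δ` and `ε` are later fixed before `b`
          -- is known.
          have hgood : ∀ j < n, q j ω ≤ 1 := by
            intro j hj
            by_contra hcon
            exact hωL ⟨j, hj, fun h => hcon (h.2.trans hδ)⟩
          have := neg_le_stopped_expCos (δ := δ) (m := m ω) (d := fun j => d j ω)
            (fun i => hq0 i ω) hc zero_le_one n hgood
          linarith
  have := hlower.trans hupper
  linarith

end discreteCosine


/-! ### Oscillation of càdlàg and continuous paths over fine partitions. -/

section oscillation

variable {s t : ℝ≥0}

/-- The oscillation of a càdlàg path over the intervals of a fine partition hardly exceeds its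
largest jump. -/
lemma IsCadlag.eventually_abs_grid_sub_le {z : ℝ≥0 → ℝ} (hz : IsCadlag z) (hst : s ≤ t) {b δ : ℝ}
    (hb : ∀ u ∈ Icc s t, |jump z u| ≤ b) (hδ : 0 < δ) :
    ∀ᶠ n in atTop, ∀ i, |z (grid s t n (i + 1)) - z (grid s t n i)| ≤ b + δ := by
  have hU : ∀ u : ℝ≥0, ∃ U : Set ℝ≥0, IsOpen U ∧ u ∈ U ∧ (∀ v ∈ U, u ≤ v → |z v - z u| < δ / 2) ∧
      ∀ v ∈ U, v < u → |z v - Function.leftLim z u| < δ / 2 := by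
    intro u
    have h1 : ∀ᶠ v in 𝓝[≥] u, |z v - z u| < δ / 2 := by
      have := (hz u).1.eventually (Metric.ball_mem_nhds (z u) (half_pos hδ))
      filter_upwards [this] with v hv
      exact hv
    have h2 : ∀ᶠ v in 𝓝[<] u, |z v - Function.leftLim z u| < δ / 2 := by
      have := (hz.tendsto_leftLim u).eventually (Metric.ball_mem_nhds _ (half_pos hδ))
      filter_upwards [this] with v hv
      exact hv
    rw [eventually_nhdsWithin_iff] at h1 h2
    obtain ⟨U, hU, hUo, hu⟩ := eventually_nhds_iff.1 (h1.and h2)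
    exact ⟨U, hUo, hu, fun v hv huv => (hU v hv).1 huv, fun v hv huv => (hU v hv).2 huv⟩
  choose U hUo hUu hU1 hU2 using hU
  have hosc : ∀ u ∈ Icc s t, ∀ v ∈ U u, ∀ w ∈ U u, |z v - z w| ≤ b + δ := by
    intro u hu v hv w hw
    have hj : |z u - Function.leftLim z u| ≤ b := hb u hu
    have hb0 : 0 ≤ b := (abs_nonneg _).trans hj
    rw [abs_le] at hj ⊢
    rcases le_or_gt u v with h1 | h1 <;> rcases le_or_gt u w with h2 | h2
    · have a1 := abs_lt.1 (hU1 u v hv h1)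
      have a2 := abs_lt.1 (hU1 u w hw h2)
      constructor <;> linarith
    · have a1 := abs_lt.1 (hU1 u v hv h1)
      have a2 := abs_lt.1 (hU2 u w hw h2)
      constructor <;> linarith
    · have a1 := abs_lt.1 (hU2 u v hv h1)
      have a2 := abs_lt.1 (hU1 u w hw h2)
      constructor <;> linarith
    · have a1 := abs_lt.1 (hU2 u v hv h1)
      have a2 := abs_lt.1 (hU2 u w hw h2)
      constructor <;> linarith
  -- Each `U u` has oscillation at most `b + δ`; once the mesh is below a Lebesgue number of this
  -- cover, every cell fits into one of them.
  obtain ⟨ε, hε, hball⟩ := lebesgue_number_lemma_of_metric (c := fun u : Icc s t => U u)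
    (isCompact_Icc (a := s) (b := t)) (fun u => hUo u)
    fun u hu => mem_iUnion.2 ⟨⟨u, hu⟩, hUu u⟩
  have hmesh : ∀ᶠ n : ℕ in atTop, (t - s) / ((n : ℝ≥0) + 1) < ⟨ε, hε.le⟩ :=
    tendsto_mesh.eventually (gt_mem_nhds (by exact_mod_cast hε))
  filter_upwards [hmesh] with n hn i
  obtain ⟨u, hu⟩ := hball (grid s t n i) ⟨le_grid i, grid_le hst i⟩
  refine hosc u u.2 _ (hu ?_) _ (hu (Metric.mem_ball_self hε))
  have h1 : grid s t n i ≤ grid s t n (i + 1) := grid_mono (Nat.le_succ i)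
  have h2 : (grid s t n (i + 1) : ℝ) ≤ grid s t n i + ((t - s) / ((n : ℝ≥0) + 1) : ℝ≥0) := by
    exact_mod_cast grid_succ_le i
  have h3 : (((t - s) / ((n : ℝ≥0) + 1) : ℝ≥0) : ℝ) < ε := by exact_mod_cast hn
  rw [Metric.mem_ball, NNReal.dist_eq, abs_of_nonneg (sub_nonneg.2 (by exact_mod_cast h1))]
  linarith

lemma Continuous.isCadlag {z : ℝ≥0 → ℝ} (hz : Continuous z) : IsCadlag z := fun t =>
  ⟨hz.continuousWithinAt, z t, hz.continuousWithinAt⟩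

lemma Continuous.jump_eq_zero {z : ℝ≥0 → ℝ} (hz : Continuous z) (t : ℝ≥0) : jump z t = 0 := by
  rw [jump, sub_eq_zero]
  rcases eq_or_neBot (𝓝[<] t) with h | h
  · exact (leftLim_eq_of_eq_bot _ h).symm
  · exact (leftLim_eq_of_tendsto (hz.continuousWithinAt (s := Iio t))).symm

lemma eventually_abs_grid_sub_le_of_continuous {z : ℝ≥0 → ℝ} (hz : Continuous z) (hst : s ≤ t)
    {δ : ℝ} (hδ : 0 < δ) :
    ∀ᶠ n in atTop, ∀ i, |z (grid s t n (i + 1)) - z (grid s t n i)| ≤ δ := by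
  have := (Continuous.isCadlag hz).eventually_abs_grid_sub_le hst (b := 0)
    (fun u _ => by rw [Continuous.jump_eq_zero hz, abs_zero]) hδ
  simpa only [zero_add] using this

lemma continuous_setIntegral_Ioc {f : ℝ≥0 → ℝ} (hf : ∀ t, IntegrableOn f (Ioc 0 t) lebesgue) :
    Continuous fun t => ∫ u in Ioc 0 t, f u ∂lebesgue := by
  refine continuous_iff_continuousAt.2 fun t => ?_
  have h : ∀ t, ∫ u in Ioc 0 t, f u ∂lebesgue = ∫ u, (Ioc 0 t).indicator f u ∂lebesgue :=
    fun t => (integral_indicator measurableSet_Ioc).symm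
  simp only [h]
  have hi : ∀ t, Integrable ((Ioc 0 t).indicator f) lebesgue := fun t =>
    (integrable_indicator_iff measurableSet_Ioc).2 (hf t)
  refine tendsto_integral_filter_of_dominated_convergence
    (fun u => ‖(Ioc 0 (t + 1)).indicator f u‖) (Eventually.of_forall fun r => (hi r).1) ?_
    (hi (t + 1)).norm ?_
  · filter_upwards [Iio_mem_nhds (lt_add_one t)] with r hr
    refine Eventually.of_forall fun u => ?_
    exact norm_indicator_le_of_subset (Ioc_subset_Ioc_right (le_of_lt hr)) _ _
  · have h0 : ∀ᵐ u ∂lebesgue, u ≠ t := by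
      have := lebesgue_countable (countable_singleton t)
      exact compl_mem_ae_iff.2 this
    filter_upwards [h0] with u hu
    refine tendsto_const_nhds.congr' ?_
    rcases lt_or_gt_of_ne hu with h1 | h1
    · filter_upwards [Ioi_mem_nhds h1] with r hr
      have hr' : u < r := hr
      simp only [indicator, mem_Ioc, hr'.le, h1.le, and_true]
    · filter_upwards [Iio_mem_nhds h1] with r hr
      have hr' : r < u := hr
      simp only [indicator, mem_Ioc, not_le.2 hr', not_le.2 h1, and_false]

end oscillation

/-! ### The drift: integrals against a difference of increasing paths. -/

section drift

lemma stieltjesMeasure_add {a b : ℝ≥0 → ℝ} (ha : Monotone a) (hb : Monotone b) :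
    stieltjesMeasure (fun t => a t + b t) = stieltjesMeasure a + stieltjesMeasure b := by
  rw [stieltjesMeasure, stieltjesMeasure, stieltjesMeasure, dif_pos ha, dif_pos hb,
    dif_pos (ha.add hb), ← StieltjesFunction.measure_add]
  congr 1
  ext x
  have h1 := (ha.tendsto_rightLim x).add (hb.tendsto_rightLim x)
  exact tendsto_nhds_unique ((ha.add hb).tendsto_rightLim x) h1

/-- The increments of `∫ F_{u-} dA_u` are bounded by the mass that they give to the increasing
paths of which `A` is the difference. -/
lemma abs_stieltjesIntegral_sub_le {x a p m : ℝ≥0 → ℝ} (hx : LocallyBoundedVariationOn x univ)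
    (ha : LocallyBoundedVariationOn a univ) (hp : Monotone p) (hm : Monotone m)
    (hpm : ∀ t, a t = p t - m t) {s t : ℝ≥0} (hst : s ≤ t) {B : ℝ} (hB : 0 ≤ B)
    (h : ∫⁻ u in Ioi s, ENNReal.ofReal |Function.leftLim x u|
      ∂(stieltjesMeasure fun t => p t + m t) ≤ ENNReal.ofReal B) :
    |stieltjesIntegral (Function.leftLim x) a t - stieltjesIntegral (Function.leftLim x) a s| ≤
      B := by
  set f := Function.leftLim x with hf
  have hi : ∀ a : ℝ≥0 → ℝ, IntegrableOn f (Ioc s t) (stieltjesMeasure a) := fun a =>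
    integrableOn_leftLim_stieltjes hx a s t
  have hsub : ∀ a : ℝ≥0 → ℝ, ∫ u in Ioc s t, f u ∂(stieltjesMeasure a) =
      ∫ u in Ioc 0 t, f u ∂(stieltjesMeasure a) - ∫ u in Ioc 0 s, f u ∂(stieltjesMeasure a) :=
    fun a => setIntegral_Ioc_sub_of_integrableOn
      (fun t => integrableOn_leftLim_stieltjes hx a 0 t) hst
  have hadd : ∀ (g : ℝ≥0 → ℝ) {a b : ℝ≥0 → ℝ}, Monotone a → Monotone b →
      IntegrableOn g (Ioc s t) (stieltjesMeasure a) →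
      IntegrableOn g (Ioc s t) (stieltjesMeasure b) →
      ∫ u in Ioc s t, g u ∂(stieltjesMeasure fun t => a t + b t) =
        ∫ u in Ioc s t, g u ∂(stieltjesMeasure a) + ∫ u in Ioc s t, g u ∂(stieltjesMeasure b) := by
    intro g a b ha hb h1 h2
    rw [stieltjesMeasure_add ha hb, Measure.restrict_add, integral_add_measure h1 h2]
  -- Two decompositions of `a` agree after cross-addition; additivity of the Stieltjes measure then
  -- replaces the Jordan decomposition by `p - m`.
  have heq : (fun t => posVar a t + m t) = fun t => negVar a t + p t := by
    funext t
    have := posVar_sub_negVar a t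
    linarith [hpm t]
  have e1 := hadd f (monotone_posVar ha) hm (hi _) (hi _)
  have e2 := hadd f (monotone_negVar ha) hp (hi _) (hi _)
  rw [heq] at e1
  have e3 := hadd (fun u => |f u|) hp hm (hi _).norm (hi _).norm
  have e4 : stieltjesIntegral f a t - stieltjesIntegral f a s =
      ∫ u in Ioc s t, f u ∂(stieltjesMeasure p) - ∫ u in Ioc s t, f u ∂(stieltjesMeasure m) := by
    have k1 := hsub (posVar a)
    have k2 := hsub (negVar a)
    unfold stieltjesIntegral
    linarith
  have e5 : ∫ u in Ioc s t, |f u| ∂(stieltjesMeasure fun t => p t + m t) ≤ B := by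
    have hint : IntegrableOn (fun u => |f u|) (Ioc s t) (stieltjesMeasure fun t => p t + m t) :=
      (hi _).norm
    rw [integral_eq_lintegral_of_nonneg_ae (Eventually.of_forall fun u => abs_nonneg _) hint.1]
    refine ENNReal.toReal_le_of_le_ofReal hB (le_trans ?_ h)
    exact lintegral_mono_set Ioc_subset_Ioi_self
  rw [e4]
  refine (abs_sub _ _).trans (le_trans (add_le_add ?_ ?_) (e3.symm.le.trans e5))
  · exact abs_integral_le_integral_abs
  · exact abs_integral_le_integral_abs

end drift

/-! ### Consequences of goodness for the drift and the bracket. -/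

section goodProcesses

variable {Ω : Type*} {mΩ : MeasurableSpace Ω} {P : Measure Ω} {𝓕 : Filtration ℝ≥0 mΩ}
  {Z F G A M Λ Ap Am β : ℝ≥0 → Ω → ℝ}

/-- The difference is an increment of `∫ F_{u-} dA_u` after time `u`, and the remaining mass of this
drift is at most `β u`. -/
lemma IsGood.abs_mart_sub_sub_le (h : IsGood P 𝓕 Z F G A M Λ Ap Am)
    (hβ : ∀ᵐ ω ∂P, ∀ t, 0 ≤ β t ω)
    (htail : ∀ᵐ ω ∂P, ∀ t, ∫⁻ u in Ioi t, ENNReal.ofReal |Function.leftLim (fun r => F r ω) u|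
      ∂(stieltjesMeasure fun r => Ap r ω + Am r ω) ≤ ENNReal.ofReal (β t ω)) :
    ∀ᵐ ω ∂P, ∀ u v, u ≤ v →
      |(mart G M v ω - mart G M u ω) - (Z v ω - Z u ω)| ≤ β u ω := by
  filter_upwards [h.decomposition, h.F_cadlagFV.finiteVariation, h.A_cadlagFV.finiteVariation,
    h.Ap_increasing, h.Am_increasing, h.A_eq, hβ, htail] with ω h1 h2 h3 h4 h5 h6 h7 h8 u v huv
  have := abs_stieltjesIntegral_sub_le h2 h3 h4 h5 h6 huv (h7 u) (h8 u)
  rw [h1 u, h1 v, mart, mart, abs_sub_comm]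
  refine (le_of_eq ?_).trans this
  congr 1
  ring

lemma GoodPaths.continuous_quad {C : ℝ≥0 → Ω → ℝ} (h : GoodPaths P 𝓕 G M C Λ) :
    ∀ᵐ ω ∂P, Continuous fun t => quad G Λ t ω := by
  filter_upwards [h.integrableOn_quad] with ω hω
  exact continuous_setIntegral_Ioc hω

lemma IsGood.exists_bracket (h : IsGood P 𝓕 Z F G A M Λ Ap Am) :
    ∃ C : ℝ≥0 → Ω → ℝ, IsAngleBracket P 𝓕 M C ∧ GoodPaths P 𝓕 G M C Λ ∧
      ∀ᵐ ω ∂P, Continuous fun t => C t ω := by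
  obtain ⟨C, hC, hCΛ⟩ := h.angleBracket
  refine ⟨C, hC, ⟨h.G_cadlagFV.adapted, h.G_cadlagFV.cadlag, h.G_cadlagFV.finiteVariation, ?_,
    h.M_cadlagFV.finiteVariation, h.Λ_nonneg, h.Λ_integrable, hCΛ⟩, ?_⟩
  · filter_upwards [h.M_cadlagFV.cadlag] with ω hω t using (hω t).1
  · filter_upwards [hCΛ, h.Λ_integrable] with ω h1 h2
    simp only [h1]
    exact continuous_setIntegral_Ioc h2

end goodProcesses


/-! ### The cosine bound in continuous time, and conditionally likely events. -/

section

variable {Ω : Type*} {mΩ : MeasurableSpace Ω} {P : Measure Ω}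

/-- A measurable version is clamped to the interval: `discrete_cosine_bound` asks for genuine
measurability and for bounds at every `ω`. -/
lemma exists_stronglyMeasurable_mem_Icc {m : MeasurableSpace Ω} {f : Ω → ℝ} {lo hi : ℝ}
    (hf : AEStronglyMeasurable[m] f P) (hfb : ∀ᵐ ω ∂P, f ω ∈ Icc lo hi) (hlh : lo ≤ hi) :
    ∃ g : Ω → ℝ, StronglyMeasurable[m] g ∧ (∀ ω, g ω ∈ Icc lo hi) ∧ g =ᵐ[P] f := by
  refine ⟨fun ω => max lo (min hi (hf.mk f ω)), ?_, fun ω =>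
    ⟨le_max_left _ _, max_le hlh (min_le_left _ _)⟩, ?_⟩
  · exact (continuous_const.max (continuous_const.min continuous_id)).comp_stronglyMeasurable
      hf.stronglyMeasurable_mk
  · filter_upwards [hf.ae_eq_mk, hfb] with ω h1 h2
    rw [← h1, min_eq_right h2.2, max_eq_right h2.1]

lemma aestronglyMeasurable_indicator_of_sub {m : MeasurableSpace Ω} {f : Ω → ℝ} {D : Set Ω}
    (hf : AEStronglyMeasurable[m] f P) (hD : MeasurableSet[m] D) :
    AEStronglyMeasurable[m] (D.indicator f) P :=
  ⟨D.indicator (hf.mk f), hf.stronglyMeasurable_mk.indicator hD,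
    hf.ae_eq_mk.mono fun ω hω => by
      by_cases h : ω ∈ D
      · simpa only [indicator_of_mem h] using hω
      · simp only [indicator_of_notMem h]⟩

lemma tendsto_measureReal_zero [IsFiniteMeasure P] {S : ℕ → Set Ω}
    (hS : ∀ n, NullMeasurableSet (S n) P) (h : ∀ᵐ ω ∂P, ∀ᶠ n in atTop, ω ∉ S n) :
    Tendsto (fun n => P.real (S n)) atTop (𝓝 0) := by
  have h1 : ∀ n, P.real (S n) = ∫ ω, (S n).indicator (fun _ => (1 : ℝ)) ω ∂P := fun n => by
    rw [integral_indicator₀ (hS n), setIntegral_const, smul_eq_mul, mul_one]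
  have h2 : (0 : ℝ) = ∫ _, (0 : ℝ) ∂P := by simp
  simp only [h1]
  rw [h2]
  refine tendsto_integral_of_dominated_convergence (fun _ => (1 : ℝ))
    (fun n => (aestronglyMeasurable_const).indicator₀ (hS n)) (integrable_const _)
    (fun n => Eventually.of_forall fun ω => ?_) ?_
  · refine (norm_indicator_le_norm_self _ _).trans ?_
    simp
  · filter_upwards [h] with ω hω
    refine tendsto_const_nhds.congr' ?_
    filter_upwards [hω] with n hn
    rw [indicator_of_notMem hn]

variable {𝓕 : Filtration ℝ≥0 mΩ} {G M C Λ : ℝ≥0 → Ω → ℝ}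

/-- The bound on the probability that the compensated cosine of `θ * ∫ G_{u-} dM_u` grows, after a
passage to the limit along a sequence of partitions. -/
lemma mart_cosine_bound [IsProbabilityMeasure P] (hG : GoodPaths P 𝓕 G M C Λ)
    (hM : StronglyAdapted 𝓕 M) (hC : StronglyAdapted 𝓕 C)
    {ρ : ℕ → Ω → ℝ≥0} (hρ : ∀ᵐ ω ∂P, ∀ t, ∀ᶠ p in atTop, t ≤ ρ p ω)
    (hred : ∀ p : ℕ, Reduces P 𝓕 M C (ρ p) p) {K : ℝ} (hK0 : 0 ≤ K)
    (hK : ∀ᵐ ω ∂P, ∀ t, quad G Λ t ω ≤ K)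
    {T H : ℝ≥0} (hTH : T ≤ H) {D W : Set Ω} (hD : MeasurableSet[𝓕 T] D) {b : ℝ} (hb0 : 0 ≤ b)
    (hb : ∀ᵐ ω ∂P, ω ∈ D → ∀ u v, T ≤ u → u ≤ v → |mart G M v ω - mart G M u ω| ≤ b)
    {θ m : Ω → ℝ} (hθ : StronglyMeasurable[𝓕 T] θ) (hm : StronglyMeasurable[𝓕 T] m)
    {Θ : ℝ} (hθ0 : ∀ ω, 0 ≤ θ ω) (hθΘ : ∀ ω, θ ω ≤ Θ) {c δ c₀ : ℝ} (hc : 0 ≤ c) (hδ0 : 0 < δ)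
    (hδ : δ ≤ 1) (hc₀ : 0 ≤ c₀)
    (hosc : ∀ᵐ ω ∂P, ω ∈ D → ∀ᶠ n in atTop, ∀ i,
      |θ ω * (mart G M (grid T H n (i + 1)) ω - mart G M (grid T H n i) ω)| ≤ δ)
    (hW : ∀ᵐ ω ∂P, ω ∈ W → ω ∈ D ∧ θ ω ^ 2 * (quad G Λ H ω - quad G Λ T ω) ≤ c ∧
      c₀ ≤ Real.cos (θ ω * (mart G M H ω - mart G M T ω) - m ω) *
        Real.exp (θ ω ^ 2 * (quad G Λ H ω - quad G Λ T ω) / 2) - 1) :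
    c₀ * P.real W ≤ (Real.exp ((c + 1) / 2) + 1) * P.real (D \ W) +
      Real.exp (c / 2) * (3 * δ * (c + δ)) * P.real D := by
  have hDm : MeasurableSet D := 𝓕.le T _ hD
  rcases isEmpty_or_nonempty Ω with hΩ | ⟨⟨ω₀⟩⟩
  · simp [Set.eq_empty_of_isEmpty W, Set.eq_empty_of_isEmpty D]
  have hΘ : 0 ≤ Θ := (hθ0 ω₀).trans (hθΘ ω₀)
  -- One bound for both kinds of increments. Its size is harmless: it only multiplies `P (L n)`,
  -- which tends to zero.
  set B : ℝ := Θ * b + Θ ^ 2 * K with hB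
  have hB0 : 0 ≤ B := by positivity
  have hK' : ∀ᵐ ω ∂P, ∀ u v, u ≤ v →
      0 ≤ quad G Λ v ω - quad G Λ u ω ∧ quad G Λ v ω - quad G Λ u ω ≤ K := by
    filter_upwards [hK, hG.quad_mono] with ω h1 h2 u v huv
    have h3 : quad G Λ u ω ≤ quad G Λ v ω := h2 huv
    have h4 : quad G Λ 0 ω ≤ quad G Λ u ω := h2 zero_le
    have h5 : quad G Λ 0 ω = 0 := by simp [quad]
    exact ⟨by linarith, by linarith [h1 v]⟩
  have hle : ∀ n i, grid T H n i ≤ grid T H n (i + 1) := fun n i => grid_mono (Nat.le_succ i)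
  have hθi : ∀ n i, StronglyMeasurable[𝓕 (grid T H n i)] θ := fun n i =>
    hθ.mono (𝓕.mono (le_grid i))
  have hDi : ∀ n i, MeasurableSet[𝓕 (grid T H n i)] D := fun n i => 𝓕.mono (le_grid i) _ hD
  set dN : ℕ → ℕ → Ω → ℝ := fun n i =>
    D.indicator fun ω => mart G M (grid T H n (i + 1)) ω - mart G M (grid T H n i) ω with hdN
  set dV : ℕ → ℕ → Ω → ℝ := fun n i =>
    D.indicator fun ω => quad G Λ (grid T H n (i + 1)) ω - quad G Λ (grid T H n i) ω with hdV
  have hdNm : ∀ n i, AEStronglyMeasurable[𝓕 (grid T H n (i + 1))]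
      (fun ω => θ ω * dN n i ω) P := fun n i =>
    (hθi n (i + 1)).aestronglyMeasurable.mul
      (aestronglyMeasurable_indicator_of_sub (hG.aestronglyMeasurable_mart hM (hle n i))
        (hDi n (i + 1)))
  have hdVm : ∀ n i, AEStronglyMeasurable[𝓕 (grid T H n (i + 1))]
      (fun ω => θ ω ^ 2 * dV n i ω) P := fun n i =>
    ((hθi n (i + 1)).pow 2).aestronglyMeasurable.mul
      (aestronglyMeasurable_indicator_of_sub (hG.aestronglyMeasurable_quad hC (hle n i))
        (hDi n (i + 1)))
  have hdNb : ∀ n i, ∀ᵐ ω ∂P, θ ω * dN n i ω ∈ Icc (-B) B := by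
    intro n i
    filter_upwards [hb] with ω h1
    have h2 : |dN n i ω| ≤ b := by
      by_cases hω : ω ∈ D
      · simpa only [hdN, indicator_of_mem hω] using h1 hω _ _ (le_grid i) (hle n i)
      · simpa only [hdN, indicator_of_notMem hω, abs_zero] using hb0
    rw [mem_Icc, ← abs_le, abs_mul, abs_of_nonneg (hθ0 ω)]
    have h3 := mul_le_mul (hθΘ ω) h2 (abs_nonneg _) hΘ
    have h4 : 0 ≤ Θ ^ 2 * K := by positivity
    linarith
  have hdVb : ∀ n i, ∀ᵐ ω ∂P, θ ω ^ 2 * dV n i ω ∈ Icc 0 B := by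
    intro n i
    filter_upwards [hK'] with ω h1
    have h2 : 0 ≤ dV n i ω ∧ dV n i ω ≤ K := by
      by_cases hω : ω ∈ D
      · simpa only [hdV, indicator_of_mem hω] using h1 _ _ (hle n i)
      · simpa only [hdV, indicator_of_notMem hω] using ⟨le_rfl, hK0⟩
    have h3 := mul_le_mul (pow_le_pow_left₀ (hθ0 ω) (hθΘ ω) 2) h2.2 h2.1 (by positivity)
    have h4 : 0 ≤ Θ * b := by positivity
    exact ⟨mul_nonneg (sq_nonneg _) h2.1, by linarith⟩
  choose d hdm hdb hde using fun n i =>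
    exists_stronglyMeasurable_mem_Icc (hdNm n i) (hdNb n i) (by linarith : -B ≤ B)
  choose q hqm hqb hqe using fun n i =>
    exists_stronglyMeasurable_mem_Icc (hdVm n i) (hdVb n i) hB0
  have hint : ∀ {f : Ω → ℝ}, StronglyMeasurable f → ∀ B' : ℝ, (∀ ω, |f ω| ≤ B') →
      Integrable f P := fun hf B' hB' =>
    Integrable.of_bound hf.aestronglyMeasurable B' (Eventually.of_forall hB')
  have hiso := fun n i => mart_isometry hG hM hC hρ hred hK hD hb (le_grid i) (hle n i)
  have hd0 : ∀ n i, MeanZeroGiven P (𝓕 (grid T H n i)) (D.indicator (d n i)) := by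
    intro n i
    have h1 : (fun ω => θ ω * dN n i ω) =ᵐ[P] D.indicator (d n i) := by
      filter_upwards [hde n i] with ω hω
      by_cases hωD : ω ∈ D
      · rw [indicator_of_mem hωD, hω]
      · simp [hdN, hωD]
    refine MeanZeroGiven.congr ((hiso n i).1.mul (hθi n i).aestronglyMeasurable ?_) h1
    exact ((hiso n i).1.1.bdd_mul ((hθi n i).mono (𝓕.le _)).aestronglyMeasurable
      (Eventually.of_forall fun ω => by
        rw [Real.norm_eq_abs, abs_of_nonneg (hθ0 ω)]; exact hθΘ ω))
  have hdq0 : ∀ n i, MeanZeroGiven P (𝓕 (grid T H n i))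
      (D.indicator fun ω => d n i ω ^ 2 - q n i ω) := by
    intro n i
    have h1 : (fun ω => θ ω ^ 2 * D.indicator (fun ω =>
        (mart G M (grid T H n (i + 1)) ω - mart G M (grid T H n i) ω) ^ 2 -
        (quad G Λ (grid T H n (i + 1)) ω - quad G Λ (grid T H n i) ω)) ω) =ᵐ[P]
        D.indicator fun ω => d n i ω ^ 2 - q n i ω := by
      filter_upwards [hde n i, hqe n i] with ω hω hω'
      by_cases hωD : ω ∈ D
      · simp only [indicator_of_mem hωD, hω, hω', hdN, hdV]
        ring
      · simp [hωD]
    refine MeanZeroGiven.congr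
      ((hiso n i).2.mul ((hθi n i).pow 2).aestronglyMeasurable ?_) h1
    exact ((hiso n i).2.1.bdd_mul (((hθi n i).pow 2).mono (𝓕.le _)).aestronglyMeasurable
      (c := Θ ^ 2) (Eventually.of_forall fun ω => by
        rw [Pi.pow_apply, norm_pow, Real.norm_eq_abs, abs_of_nonneg (hθ0 ω)]
        exact pow_le_pow_left₀ (hθ0 ω) (hθΘ ω) 2))
  have hall : ∀ᵐ ω ∂P, ∀ n i, d n i ω = θ ω * dN n i ω ∧ q n i ω = θ ω ^ 2 * dV n i ω :=
    ae_all_iff.2 fun n => ae_all_iff.2 fun i => (hde n i).and (hqe n i)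
  set L : ℕ → Set Ω := fun n => D ∩ largeStep δ (d n) (q n) (n + 1) with hL
  have hLm : ∀ n, MeasurableSet (L n) := by
    intro n
    have h1 : largeStep δ (d n) (q n) (n + 1) =
        ⋃ j ∈ Finset.range (n + 1), {ω | |d n j ω| ≤ δ ∧ q n j ω ≤ δ}ᶜ := by
      ext ω; simp only [largeStep, mem_ofPred_eq, mem_iUnion, Finset.mem_range, mem_compl_iff,
        exists_prop]
    refine hDm.inter ?_
    rw [h1]
    refine Finset.measurableSet_biUnion _ fun j _ => (MeasurableSet.inter ?_ ?_).compl
    · exact ((hdm n j).mono (𝓕.le _)).norm.measurable measurableSet_Iic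
    · exact ((hqm n j).mono (𝓕.le _)).measurable measurableSet_Iic
  have hL0 : Tendsto (fun n => P.real (L n)) atTop (𝓝 0) := by
    refine tendsto_measureReal_zero (fun n => (hLm n).nullMeasurableSet) ?_
    filter_upwards [hall, hosc, hG.continuous_quad, hK'] with ω h1 h2 h3 h4
    by_cases hωD : ω ∈ D
    swap
    · exact Eventually.of_forall fun n hn => hωD hn.1
    -- The `+ 1` keeps the divisor positive when `Θ = 0`; after multiplication by `θ² ≤ Θ²` the
    -- bracket increments are at most `δ`.
    have h5 := eventually_abs_grid_sub_le_of_continuous h3 hTH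
      (by positivity : 0 < δ / (Θ ^ 2 + 1))
    filter_upwards [h2 hωD, h5] with n h6 h7 hn
    obtain ⟨j, -, hj⟩ := hn.2
    refine hj ⟨?_, ?_⟩
    · rw [(h1 n j).1]; simpa only [hdN, indicator_of_mem hωD] using h6 j
    · rw [(h1 n j).2]; simp only [hdV, indicator_of_mem hωD]
      have h8 := (abs_le.1 (h7 j)).2
      have h9 := mul_le_mul (pow_le_pow_left₀ (hθ0 ω) (hθΘ ω) 2) h8
        (h4 _ _ (hle n j)).1 (by positivity)
      refine h9.trans ?_
      rw [mul_div_assoc', div_le_iff₀ (by positivity)]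
      nlinarith
  set A : ℝ := Real.exp ((c + B) / 2) + 1 + Real.exp (c / 2) * (3 * B +
        (Real.exp (B / 2) + 1 + B + (B ^ 2 + B))) with hA
  set C₁ : ℝ := Real.exp ((c + 1) / 2) + 1 with hC₁
  have hC₁0 : 0 ≤ C₁ := by positivity
  have hmain : ∀ n, c₀ * P.real W ≤ C₁ * P.real (D \ W) +
      Real.exp (c / 2) * (3 * δ * (c + δ)) * P.real D + (C₁ + A + c₀) * P.real (L n) := by
    intro n
    have h1 := discrete_cosine_bound (𝓗 := gridFiltration 𝓕 T H n) (d := d n) (q := q n) (m := m)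
      (D := D) (b := B) (c := c) (δ := δ) (c₀ := c₀) (hdm n) (hqm n) (hm.mono (𝓕.mono (le_grid 0)))
      (hDi n 0) (fun i ω => abs_le.2 (hdb n i ω)) (fun i ω => (hqb n i ω).1)
      (fun i ω => (hqb n i ω).2) (hd0 n) (hdq0 n) hc hδ0.le hδ (n + 1)
    set E := cosineGain δ c c₀ m (d n) (q n) (n + 1) with hE
    -- The sums over the partition telescope, so the discrete gain event contains `W`, up to paths
    -- with a large step and null sets.
    have hWE : ∀ᵐ ω ∂P, ω ∈ W → ω ∈ (D ∩ E) ∪ L n := by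
      filter_upwards [hW, hall] with ω h2 h3 hωW
      obtain ⟨hωD, h4, h5⟩ := h2 hωW
      by_cases hωL : ω ∈ largeStep δ (d n) (q n) (n + 1)
      · exact Or.inr ⟨hωD, hωL⟩
      have h6 : psum (fun i => d n i ω) (n + 1) = θ ω * (mart G M H ω - mart G M T ω) := by
        have : ∀ i, d n i ω = θ ω * (mart G M (grid T H n (i + 1)) ω -
            mart G M (grid T H n i) ω) := fun i => by
          rw [(h3 n i).1, hdN]; simp only [indicator_of_mem hωD]
        simp only [psum, this]
        rw [← Finset.mul_sum, Finset.sum_range_sub (fun i => mart G M (grid T H n i) ω),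
          grid_last hTH, grid_zero]
      have h7 : psum (fun i => q n i ω) (n + 1) = θ ω ^ 2 * (quad G Λ H ω - quad G Λ T ω) := by
        have : ∀ i, q n i ω = θ ω ^ 2 * (quad G Λ (grid T H n (i + 1)) ω -
            quad G Λ (grid T H n i) ω) := fun i => by
          rw [(h3 n i).2, hdV]; simp only [indicator_of_mem hωD]
        simp only [psum, this]
        rw [← Finset.mul_sum, Finset.sum_range_sub (fun i => quad G Λ (grid T H n i) ω),
          grid_last hTH, grid_zero]
      refine Or.inl ⟨hωD, hωL, by rw [h7]; exact h4, ?_⟩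
      have h8 : expCos (m ω) (fun i => d n i ω) (fun i => q n i ω) 0 ≤ 1 := by
        simp only [expCos, psum, Finset.range_zero, Finset.sum_empty, zero_div, Real.exp_zero,
          mul_one]
        exact Real.cos_le_one _
      have h9 : expCos (m ω) (fun i => d n i ω) (fun i => q n i ω) (n + 1) =
          Real.cos (θ ω * (mart G M H ω - mart G M T ω) - m ω) *
          Real.exp (θ ω ^ 2 * (quad G Λ H ω - quad G Λ T ω) / 2) := by
        rw [expCos, h6, h7]
      rw [h9]
      linarith
    have h2 : P.real W ≤ P.real (D ∩ E) + P.real (L n) := by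
      refine (ENNReal.toReal_mono (measure_ne_top _ _) (measure_mono_ae hWE)).trans ?_
      exact measureReal_union_le _ _
    have h3 : P.real (D \ E) ≤ P.real (D \ W) + P.real (L n) := by
      have : (D \ E : Set Ω) ≤ᵐ[P] ((D \ W) ∪ L n : Set Ω) := by
        filter_upwards [hWE] with ω h4 hω
        by_cases hωW : ω ∈ W
        · rcases h4 hωW with h5 | h5
          · exact absurd h5.2 hω.2
          · exact Or.inr h5
        · exact Or.inl ⟨hω.1, hωW⟩
      refine (ENNReal.toReal_mono (measure_ne_top _ _) (measure_mono_ae this)).trans ?_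
      exact measureReal_union_le _ _
    have h4 := mul_le_mul_of_nonneg_left h2 hc₀
    have h5 := mul_le_mul_of_nonneg_left h3 hC₁0
    have h6 : D ∩ largeStep δ (d n) (q n) (n + 1) = L n := rfl
    rw [h6] at h1
    linarith
  have hlim := (hL0.const_mul (C₁ + A + c₀)).const_add
    (C₁ * P.real (D \ W) + Real.exp (c / 2) * (3 * δ * (c + δ)) * P.real D)
  rw [mul_zero, add_zero] at hlim
  exact ge_of_tendsto' hlim hmain

/-- On a suitable event of some `𝓗 k`, an event in the limit of the filtration has conditional
probability close to one. -/
lemma exists_conditionally_likely [IsProbabilityMeasure P] {𝓗 : Filtration ℕ mΩ} {B : Set Ω}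
    (hB : MeasurableSet[⨆ n, 𝓗 n] B) (hPB : P B ≠ 0) {U : ℕ → Set Ω}
    (hUm : ∀ k, MeasurableSet[𝓗 k] (U k)) (hU : ∀ᵐ ω ∂P, ω ∈ B → ∀ᶠ k in atTop, ω ∈ U k)
    {ε : ℝ} (hε : 0 < ε) (N : ℕ) :
    ∃ k ≥ N, ∃ S ⊆ U k, MeasurableSet[𝓗 k] S ∧ P S ≠ 0 ∧
      ∀ D ⊆ S, MeasurableSet[𝓗 k] D → P.real (D \ B) ≤ ε * P.real D := by
  have hBm : MeasurableSet B := (iSup_le fun n => 𝓗.le n : ⨆ n, 𝓗 n ≤ mΩ) _ hB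
  set f : Ω → ℝ := B.indicator fun _ => (1 : ℝ) with hf
  have hfi : Integrable f P := (integrable_const _).indicator hBm
  -- By Lévy's upward theorem almost every point of `B` eventually lies in `S k`; hence some `S k`
  -- with `k ≥ N` is not null. The bound passes to every `𝓗 k`-measurable subset of `S k`, so `S k`
  -- may be shrunk later.
  set S : ℕ → Set Ω := fun k => U k ∩ {ω | 1 - ε < (P[f|𝓗 k]) ω} with hS
  have hSm : ∀ k, MeasurableSet[𝓗 k] (S k) := fun k =>
    (hUm k).inter ((stronglyMeasurable_condExp (m := 𝓗 k)).measurable measurableSet_Ioi)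
  have hev : ∀ᵐ ω ∂P, ω ∈ B → ∀ᶠ k in atTop, ω ∈ S k := by
    filter_upwards [hU, hfi.tendsto_ae_condExp (ℱ := 𝓗)
      (stronglyMeasurable_const.indicator hB)] with ω h1 h2 hω
    have h3 : f ω = 1 := indicator_of_mem hω _
    rw [h3] at h2
    filter_upwards [h1 hω, h2.eventually (lt_mem_nhds (by linarith : 1 - ε < 1))] with k h4 h5
    exact ⟨h4, h5⟩
  have hex : ∃ k ≥ N, P (S k) ≠ 0 := by
    by_contra! hcon
    have h1 : ∀ᵐ ω ∂P, ∀ k, N ≤ k → ω ∉ S k :=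
      ae_all_iff.2 fun k => by
        by_cases hk : N ≤ k
        · filter_upwards [measure_eq_zero_iff_ae_notMem.1 (hcon k hk)] with ω hω _ using hω
        · exact Eventually.of_forall fun ω h => absurd h hk
    refine hPB (measure_mono_null (fun ω hω => ?_) (ae_iff.1 (h1.and hev)))
    rintro ⟨h2, h3⟩
    obtain ⟨k, hk, hk'⟩ := ((h3 hω).and (eventually_ge_atTop N)).exists
    exact h2 k hk' hk
  obtain ⟨k, hk, hPk⟩ := hex
  refine ⟨k, hk, S k, inter_subset_left, hSm k, hPk, fun D hDS hD => ?_⟩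
  have hDm : MeasurableSet D := 𝓗.le k _ hD
  have h1 : ∫ ω in D, (P[f|𝓗 k]) ω ∂P = P.real (D ∩ B) := by
    rw [setIntegral_condExp (𝓗.le k) hfi hD, hf, setIntegral_indicator hBm, setIntegral_const,
      smul_eq_mul, mul_one]
  have h2 : (1 - ε) * P.real D ≤ ∫ ω in D, (P[f|𝓗 k]) ω ∂P := by
    have := setIntegral_mono_on (μ := P) (s := D) (f := fun _ => 1 - ε) (integrable_const _).integrableOn
      (integrable_condExp (μ := P) (f := f) (m := 𝓗 k)).integrableOn hDm
      fun ω hω => (hDS hω).2.le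
    rw [setIntegral_const, smul_eq_mul, mul_comm] at this
    exact this
  have h3 : P.real (D ∩ B) + P.real (D \ B) = P.real D := measureReal_inter_add_sdiff hBm
  linarith

end


/-! ### Tail integrals and comparable densities. -/

section tails

variable {a a' : ℝ≥0 → ℝ}

lemma tendsto_tail_integral (h : ∀ t, IntegrableOn a' (Ioi t) lebesgue ∧
    a t = ∫ u in Ioi t, a' u ∂lebesgue) :
    Tendsto (fun k : ℕ => a k) atTop (𝓝 0) := by
  have h1 : ⋂ k : ℕ, Ioi (k : ℝ≥0) = ∅ := by
    refine Set.eq_empty_of_forall_notMem fun u hu => ?_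
    obtain ⟨k, hk⟩ := exists_nat_ge u
    exact absurd (mem_iInter.1 hu k) (not_lt.2 hk)
  have h2 := tendsto_setIntegral_of_antitone (μ := lebesgue) (f := a')
    (s := fun k : ℕ => Ioi (k : ℝ≥0)) (fun k => measurableSet_Ioi)
    (fun k l hkl => Ioi_subset_Ioi (by exact_mod_cast hkl)) ⟨0, (h _).1⟩
  rw [h1, setIntegral_empty] at h2
  exact h2.congr fun k => (h k).2.symm

lemma tail_integral_sub (h : ∀ t, IntegrableOn a' (Ioi t) lebesgue ∧
    a t = ∫ u in Ioi t, a' u ∂lebesgue)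
    {s t : ℝ≥0} (hst : s ≤ t) :
    a s - a t = ∫ u in Ioc s t, a' u ∂lebesgue := by
  rw [(h s).2, (h t).2, ← Ioc_union_Ioi_eq_Ioi hst, setIntegral_union
    (Ioc_disjoint_Ioi le_rfl) measurableSet_Ioi
    ((h s).1.mono_set Ioc_subset_Ioi_self) (h t).1]
  ring

/-- A density comparable to `a'` has increments comparable to those of `a`. -/
lemma setIntegral_mem_of_density (h : ∀ t, IntegrableOn a' (Ioi t) lebesgue ∧
    a t = ∫ u in Ioi t, a' u ∂lebesgue)
    {g : ℝ≥0 → ℝ} {s t : ℝ≥0} {κ : ℝ}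
    (hg : IntegrableOn g (Ioc s t) lebesgue) (hst : s ≤ t)
    (hga : ∀ u, s ≤ u → 1 / κ * a' u ≤ g u ∧ g u ≤ κ * a' u) :
    1 / κ * (a s - a t) ≤ ∫ u in Ioc s t, g u ∂lebesgue ∧
      ∫ u in Ioc s t, g u ∂lebesgue ≤ κ * (a s - a t) := by
  have hi : IntegrableOn a' (Ioc s t) lebesgue := (h s).1.mono_set Ioc_subset_Ioi_self
  rw [tail_integral_sub h hst, ← integral_const_mul, ← integral_const_mul]
  exact ⟨setIntegral_mono_on (hi.const_mul _) hg measurableSet_Ioc fun u hu => (hga u hu.1.le).1,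
    setIntegral_mono_on hg (hi.const_mul _) measurableSet_Ioc fun u hu => (hga u hu.1.le).2⟩

end tails

/-! ### The contradiction, for one event on which `Z` converges. -/

section main

/-- With `r = 1 / (8κ) ≤ 1 / 8` the product is at least `(1 - r / 2) (1 + 2r) ≥ 1 + r`: the growth
of the exponential outweighs the loss in the cosine. -/
lemma le_cos_mul_exp_sub_one {κ δ y v : ℝ} (hκ : 1 ≤ κ) (hδ : δ ^ 2 ≤ 1 / (8 * κ))
    (hy : |y| ≤ δ) (hv : 1 / (2 * κ) ≤ v) :
    1 / (8 * κ) ≤ Real.cos y * Real.exp (v / 2) - 1 := by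
  have h0 : 0 < κ := by linarith
  set r := 1 / (8 * κ) with hr
  have hr0 : 0 < r := by positivity
  have hr1 : r ≤ 1 / 8 := one_div_le_one_div_of_le (by norm_num) (by linarith)
  have hv' : 4 * r ≤ v := by
    refine le_trans (le_of_eq ?_) hv
    rw [hr]; field_simp; norm_num
  have h1 : 1 - r / 2 ≤ Real.cos y := by
    have h2 : y ^ 2 ≤ r := (sq_le_sq' (by linarith [(abs_le.1 hy).1]) (abs_le.1 hy).2).trans hδ
    linarith [Real.one_sub_sq_div_two_le_cos (x := y)]
  have h3 : 1 + 2 * r ≤ Real.exp (v / 2) := by linarith [Real.add_one_le_exp (v / 2)]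
  have h4 := mul_le_mul h1 h3 (by linarith) (by linarith)
  nlinarith

variable {Ω : Type*} {mΩ : MeasurableSpace Ω} {P : Measure Ω} {𝓕 : Filtration ℝ≥0 mΩ}
  {Z F G A M Λ Ap Am α α' β : ℝ≥0 → Ω → ℝ}

/-- The restriction of a filtration to integer times. -/
def natFiltration (𝓕 : Filtration ℝ≥0 mΩ) : Filtration ℕ mΩ where
  seq k := 𝓕 k
  mono' _ _ hkl := 𝓕.mono (by exact_mod_cast hkl)
  le' _ := 𝓕.le _

lemma measure_eq_zero_of_tendsto [IsProbabilityMeasure P] (h : IsGood P 𝓕 Z F G A M Λ Ap Am)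
    {B : Set Ω} {N : ℕ} (hB : MeasurableSet[⨆ k, natFiltration 𝓕 k] B) {ϱ : ℝ}
    (hlim : ∀ᵐ ω ∂P, ω ∈ B → Tendsto (fun t => Z t ω) atTop (𝓝 ϱ))
    (hα_adapted : StronglyAdapted 𝓕 α) (hβ_adapted : StronglyAdapted 𝓕 β)
    (hα_pos : ∀ᵐ ω ∂P, ∀ t, 0 < α t ω) (hβ_nonneg : ∀ᵐ ω ∂P, ∀ t, 0 ≤ β t ω)
    (hβ_anti : ∀ᵐ ω ∂P, Antitone (fun t => β t ω))
    (hα_eq : ∀ᵐ ω ∂P, ∀ t, IntegrableOn (fun u => α' u ω) (Ioi t) lebesgue ∧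
      α t ω = ∫ u in Ioi t, α' u ω ∂lebesgue)
    (hjump : ∀ᵐ ω ∂P, ∀ t, |jump (fun u => Z u ω) t| ≤ β t ω)
    (htail : ∀ᵐ ω ∂P, ∀ t, ∫⁻ u in Ioi t, ENNReal.ofReal |Function.leftLim (fun r => F r ω) u|
      ∂(stieltjesMeasure fun r => Ap r ω + Am r ω) ≤ ENNReal.ofReal (β t ω))
    (hβα : ∀ᵐ ω ∂P, Tendsto (fun t => β t ω / √(α t ω)) atTop (𝓝 0))
    {κ : ℝ} (hκ : 1 ≤ κ)
    (hquad : ∀ᵐ ω ∂P, ω ∈ B → ∀ t : ℝ≥0, N ≤ t →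
      1 / κ * α' t ω ≤ G t ω ^ 2 * Λ t ω ∧ G t ω ^ 2 * Λ t ω ≤ κ * α' t ω) :
    P B = 0 := by
  by_contra hPB
  have hκ0 : 0 < κ := by linarith
  have hnat : Tendsto (fun k : ℕ => (k : ℝ≥0)) atTop atTop := tendsto_natCast_atTop_atTop
  obtain ⟨C, hC, hG, hCc⟩ := h.exists_bracket
  obtain ⟨ρ, hρ, hred⟩ := exists_reduces h.martingale hG.rightCts hC hCc
  have hCa : StronglyAdapted 𝓕 C := hC.predictable.stronglyAdapted
  have hMa : StronglyAdapted 𝓕 M := h.M_cadlagFV.adapted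
  have hBm : MeasurableSet B :=
    (iSup_le fun n => (natFiltration 𝓕).le n : ⨆ n, natFiltration 𝓕 n ≤ mΩ) _ hB
  have hdrift := h.abs_mart_sub_sub_le hβ_nonneg htail
  obtain ⟨K, hZK, hK⟩ : ∃ K : ℝ, (∀ᵐ ω ∂P, ∀ t, |Z t ω| ≤ K) ∧ ∀ᵐ ω ∂P, ∀ t, quad G Λ t ω ≤ K := by
    obtain ⟨K, hK⟩ := h.bounded
    exact ⟨K, hK.mono fun ω hω t => (hω t).1, hK.mono fun ω hω t => (hω t).2⟩
  have hK0 : 0 ≤ K := by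
    obtain ⟨ω, hω⟩ := hZK.exists
    exact (abs_nonneg _).trans (hω 0)
  -- the constants
  set c₀ : ℝ := 1 / (8 * κ) with hc₀
  set C₁ : ℝ := Real.exp ((κ + 1) / 2) + 1 with hC₁
  set C₂ : ℝ := Real.exp (κ / 2) with hC₂
  have hc₀0 : 0 < c₀ := by positivity
  have hc₀1 : c₀ ≤ 1 / 8 := one_div_le_one_div_of_le (by norm_num) (by linarith)
  have hC₁1 : 1 ≤ C₁ := by linarith [Real.exp_pos ((κ + 1) / 2)]
  have hC₂1 : 1 ≤ C₂ := Real.one_le_exp (by linarith)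
  -- `δ` makes the remainder term at most `c₀ / 4` and `ε` makes `C₁ * ε = c₀ / 4`. Both depend on
  -- `κ` alone.
  set δ : ℝ := c₀ / (24 * κ * C₂) with hδ
  set ε : ℝ := c₀ / (4 * C₁) with hε
  have hδ0 : 0 < δ := by positivity
  have hε0 : 0 < ε := by positivity
  have hδκ : δ * (24 * κ * C₂) = c₀ := div_mul_cancel₀ _ (by positivity)
  have hεC : ε * (4 * C₁) = c₀ := div_mul_cancel₀ _ (by positivity)
  have hκC : 1 ≤ κ * C₂ := one_le_mul_of_one_le_of_one_le hκ hC₂1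
  have hδc : δ ≤ c₀ := by nlinarith
  have hε1 : ε ≤ 1 / 8 := by nlinarith
  have hδ1 : δ ≤ 1 := by linarith
  -- the initial time and event
  obtain ⟨T, hNT, S, hSU, hSm, hPS, hScond⟩ := exists_conditionally_likely (𝓗 := natFiltration 𝓕)
    hB hPB (U := fun k => {ω | β k ω ≤ δ / 4 * √(α k ω)})
    (fun k => measurableSet_le (hβ_adapted k).measurable
      ((hα_adapted k).measurable.sqrt.const_mul _))
    (by
      filter_upwards [hα_pos, hβα] with ω h1 h2 _
      filter_upwards [(h2.comp hnat).eventually (gt_mem_nhds (by positivity : 0 < δ / 4))] with k hk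
      have h3 : 0 < √(α k ω) := Real.sqrt_pos.2 (h1 k)
      exact ((div_lt_iff₀ h3).1 hk).le) (half_pos hε0) N
  -- This level bounds `θ` and the increments of the martingale on `D`, as `mart_cosine_bound`
  -- requires; its value plays no role in the final estimate.
  obtain ⟨L, hPD⟩ : ∃ L : ℕ, P (S ∩ {ω | 1 / ((L : ℝ) + 1) ≤ α T ω ∧ β T ω ≤ L}) ≠ 0 := by
    by_contra! hcon
    refine hPS (measure_mono_null_ae ?_ (measure_iUnion_null hcon))
    filter_upwards [hα_pos] with ω h1 hω
    obtain ⟨L, hL⟩ := exists_nat_ge (max (β T ω) (1 / α T ω))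
    refine mem_iUnion.2 ⟨L, hω, ?_, (le_max_left _ _).trans hL⟩
    have h2 : 1 / α T ω ≤ (L : ℝ) + 1 := ((le_max_right _ _).trans hL).trans (by linarith)
    exact (one_div_le (h1 T) (by positivity)).1 h2
  set D : Set Ω := S ∩ {ω | 1 / ((L : ℝ) + 1) ≤ α T ω ∧ β T ω ≤ L} with hD
  have hDT : MeasurableSet[𝓕 (T : ℝ≥0)] D :=
    hSm.inter (MeasurableSet.inter ((hα_adapted T).measurable measurableSet_Ici)
      ((hβ_adapted T).measurable measurableSet_Iic))
  have hDm : MeasurableSet D := 𝓕.le _ _ hDT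
  have hDB : P.real (D \ B) ≤ ε / 2 * P.real D := hScond D inter_subset_left hDT
  have hPD0 : 0 < P.real D := ENNReal.toReal_pos hPD (measure_ne_top _ _)
  set θ : Ω → ℝ := D.indicator fun ω => 1 / √(α T ω) with hθ
  have hL0 : (0 : ℝ) < (L : ℝ) + 1 := by positivity
  have hθm : StronglyMeasurable[𝓕 (T : ℝ≥0)] θ := by
    refine StronglyMeasurable.indicator (Measurable.stronglyMeasurable ?_) hDT
    exact (hα_adapted T).measurable.sqrt.const_div 1
  have hθ0 : ∀ ω, 0 ≤ θ ω := fun ω => indicator_nonneg (fun _ _ => by positivity) ω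
  have hθD : ∀ ω ∈ D, θ ω = 1 / √(α T ω) := fun ω hω => indicator_of_mem hω _
  have hαD : ∀ ω ∈ D, 0 < α T ω := fun ω hω => lt_of_lt_of_le (by positivity) hω.2.1
  have hθα : ∀ ω ∈ D, θ ω ^ 2 * α T ω = 1 := fun ω hω => by
    rw [hθD ω hω, div_pow, one_pow, Real.sq_sqrt (hαD ω hω).le,
      one_div_mul_cancel (hαD ω hω).ne']
  have hθβ : ∀ ω ∈ D, θ ω * β T ω ≤ δ / 4 := fun ω hω => by
    have h1 : β T ω ≤ δ / 4 * √(α T ω) := hSU hω.1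
    rw [hθD ω hω, one_div_mul_eq_div, div_le_iff₀ (Real.sqrt_pos.2 (hαD ω hω))]
    exact h1
  have hθΘ : ∀ ω, θ ω ≤ √((L : ℝ) + 1) := by
    intro ω
    by_cases hω : ω ∈ D
    · have h1 : 1 / √(α T ω) = √(1 / α T ω) := by rw [Real.sqrt_div zero_le_one, Real.sqrt_one]
      rw [hθD ω hω, h1]
      exact Real.sqrt_le_sqrt ((one_div_le hL0 (hαD ω hω)).1 hω.2.1)
    · rw [hθ, indicator_of_notMem hω]; positivity
  have hb : ∀ᵐ ω ∂P, ω ∈ D → ∀ u v, (T : ℝ≥0) ≤ u → u ≤ v →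
      |mart G M v ω - mart G M u ω| ≤ 2 * K + L := by
    filter_upwards [hdrift, hZK, hβ_anti] with ω h1 h2 h3 hω u v hu huv
    have h4 := abs_le.1 (h1 u v huv)
    have h5 : β u ω ≤ β T ω := h3 hu
    have h6 := abs_le.1 (h2 u)
    have h7 := abs_le.1 (h2 v)
    have h8 := hω.2.2
    rw [abs_le]
    constructor <;> linarith
  -- the bounds on the quadratic variation
  have hVB : ∀ᵐ ω ∂P, ω ∈ B → ∀ t : ℝ≥0, T ≤ t →
      1 / κ * (α T ω - α t ω) ≤ quad G Λ t ω - quad G Λ T ω ∧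
      quad G Λ t ω - quad G Λ T ω ≤ κ * (α T ω - α t ω) := by
    filter_upwards [hquad, hα_eq, hG.quad_sub, hG.integrableOn_quad] with ω h1 h2 h3 h4 hω t ht
    rw [h3 _ _ ht]
    exact setIntegral_mem_of_density h2 ((h4 t).mono_set (Ioc_subset_Ioc_left zero_le)) ht
      fun u hu => h1 hω u ((by exact_mod_cast hNT : (N : ℝ≥0) ≤ T).trans hu)
  -- the final time and event
  set H : ℕ → ℝ≥0 := fun j => ((T + j : ℕ) : ℝ≥0) with hH
  have hTH : ∀ j, (T : ℝ≥0) ≤ H j := fun j =>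
    Nat.cast_le.2 (Nat.le_add_right T j)
  have hHtop : Tendsto (fun j => T + j) atTop atTop := tendsto_atTop_mono
    (fun j => Nat.le_add_left j T) tendsto_id
  -- By time `H j` the process is near its limit on the scale `1 / θ`, while a definite share of the
  -- bracket has been used. Both hold eventually on `D ∩ B`, as `Z` converges and `α` tends to zero.
  set W : ℕ → Set Ω := fun j => (D ∩ B) ∩ {ω | θ ω * |Z (H j) ω - ϱ| ≤ δ / 4 ∧
    1 / (2 * κ) ≤ θ ω ^ 2 * (quad G Λ (H j) ω - quad G Λ T ω)} with hW
  have hWm : ∀ j, NullMeasurableSet (W j) P := by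
    intro j
    have h1 : AEMeasurable (fun ω => θ ω ^ 2 * (quad G Λ (H j) ω - quad G Λ T ω)) P :=
      ((hθm.mono (𝓕.le _)).measurable.pow_const 2).aemeasurable.mul
        ((hG.aestronglyMeasurable_quad hCa (hTH j)).mono (𝓕.le _)).aemeasurable
    have h2 : Measurable (fun ω => θ ω * |Z (H j) ω - ϱ|) :=
      (hθm.mono (𝓕.le _)).measurable.mul
        (((h.Z_cadlagFV.adapted (H j)).mono (𝓕.le _)).measurable.sub_const ϱ).norm
    refine (hDm.inter hBm).nullMeasurableSet.inter (NullMeasurableSet.inter ?_ ?_)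
    · exact (h2 measurableSet_Iic).nullMeasurableSet
    · exact h1.nullMeasurable measurableSet_Ici
  have hWlim : Tendsto (fun j => P.real ((D ∩ B) \ W j)) atTop (𝓝 0) := by
    refine tendsto_measureReal_zero (fun j => (hDm.inter hBm).nullMeasurableSet.diff (hWm j)) ?_
    filter_upwards [hlim, hVB, hα_eq] with ω h1 h2 h3
    by_cases hω : ω ∈ D ∩ B
    swap
    · exact Eventually.of_forall fun j hj => hω hj.1
    have h4 : Tendsto (fun j => θ ω * |Z (H j) ω - ϱ|) atTop (𝓝 0) := by
      have := ((((h1 hω.2).comp (hnat.comp hHtop)).sub_const ϱ).abs).const_mul (θ ω)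
      rw [sub_self, abs_zero, mul_zero] at this
      exact this
    have h5 : Tendsto (fun j => θ ω ^ 2 * α (H j) ω) atTop (𝓝 0) := by
      have := ((tendsto_tail_integral h3).comp hHtop).const_mul (θ ω ^ 2)
      rw [mul_zero] at this
      exact this
    filter_upwards [h4.eventually (gt_mem_nhds (by positivity : 0 < δ / 4)),
      h5.eventually (gt_mem_nhds (by norm_num : (0 : ℝ) < 1 / 2))] with j h6 h7 hj
    refine hj.2 ⟨hω, h6.le, ?_⟩
    have h8 := mul_le_mul_of_nonneg_left (h2 hω.2 _ (hTH j)).1 (sq_nonneg (θ ω))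
    refine le_trans ?_ h8
    have h9 : θ ω ^ 2 * (1 / κ * (α T ω - α (H j) ω)) =
        1 / κ * (θ ω ^ 2 * α T ω - θ ω ^ 2 * α (H j) ω) := by ring
    rw [h9, hθα ω hω.1]
    have h10 : 1 / (2 * κ) = 1 / κ * (1 / 2) := by field_simp
    rw [h10]
    exact mul_le_mul_of_nonneg_left (by linarith) (by positivity)
  obtain ⟨j, hj⟩ := (hWlim.eventually
    (gt_mem_nhds (by positivity : 0 < ε / 2 * P.real D))).exists
  -- Half of `ε` pays for leaving `B`, the other half for `H j` not being late enough.
  have hDW : P.real (D \ W j) ≤ ε * P.real D := by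
    have h1 : D \ W j ⊆ (D \ B) ∪ ((D ∩ B) \ W j) := by
      intro ω hω
      by_cases hωB : ω ∈ B
      · exact Or.inr ⟨⟨hω.1, hωB⟩, hω.2⟩
      · exact Or.inl ⟨hω.1, hωB⟩
    have h2 := (measureReal_mono (μ := P) h1).trans (measureReal_union_le _ _)
    linarith
  have hWD : P.real D ≤ P.real (W j) + P.real (D \ W j) := by
    refine (measureReal_mono (μ := P) ?_).trans (measureReal_union_le _ _)
    intro ω hω
    by_cases hωW : ω ∈ W j
    · exact Or.inl hωW
    · exact Or.inr ⟨hω, hωW⟩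
  -- the oscillation over the intervals of a fine partition
  have hosc : ∀ᵐ ω ∂P, ω ∈ D → ∀ᶠ n in atTop, ∀ i,
      |θ ω * (mart G M (grid T (H j) n (i + 1)) ω - mart G M (grid T (H j) n i) ω)| ≤ δ := by
    filter_upwards [hdrift, h.Z_cadlagFV.cadlag, hjump, hβ_anti] with ω h1 h2 h3 h4 hω
    have hθp : 0 < θ ω := by
      rw [hθD ω hω]; exact one_div_pos.2 (Real.sqrt_pos.2 (hαD ω hω))
    -- An increment of the martingale costs `β T` for the jumps of `Z`, `β T` for the drift and `δ /
    -- (2θ)` for the mesh; since `θ * β T ≤ δ / 4`, the rescaled total is at most `δ`.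
    filter_upwards [h2.eventually_abs_grid_sub_le (hTH j) (b := β T ω)
      (fun u hu => (h3 u).trans (h4 hu.1)) (by positivity : 0 < δ / 2 / θ ω)] with n hn i
    have h5 := abs_le.1 (h1 _ _ (grid_mono (Nat.le_succ i) :
      grid (T : ℝ≥0) (H j) n i ≤ grid (T : ℝ≥0) (H j) n (i + 1)))
    have h6 : β (grid T (H j) n i) ω ≤ β T ω := h4 (le_grid i)
    have h7 := abs_le.1 (hn i)
    have h8 : |mart G M (grid T (H j) n (i + 1)) ω - mart G M (grid T (H j) n i) ω| ≤
        2 * β T ω + δ / 2 / θ ω := by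
      rw [abs_le]; constructor <;> linarith
    rw [abs_mul, abs_of_pos hθp]
    refine (mul_le_mul_of_nonneg_left h8 hθp.le).trans ?_
    have h9 : θ ω * (δ / 2 / θ ω) = δ / 2 := by field_simp
    have := hθβ ω hω
    linarith
  -- The centre `θ (ϱ - Z_T)` is the value that the rescaled martingale would approach if the drift
  -- vanished; on `W j` the error is at most `δ / 4` from the drift plus `δ / 4` from `Z (H j) - ϱ`.
  have hfin := mart_cosine_bound hG hMa hCa hρ hred hK0 hK (hTH j) hDT
    (by positivity : 0 ≤ 2 * K + L) hb hθm (m := fun ω => θ ω * (ϱ - Z T ω))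
    (hθm.mul (stronglyMeasurable_const.sub (h.Z_cadlagFV.adapted T))) hθ0 hθΘ hκ0.le hδ0 hδ1
    hc₀0.le hosc (W := W j) (by
      filter_upwards [hVB, hdrift, hα_pos] with ω h1 h2 h3 hω
      obtain ⟨⟨hωD, hωB⟩, h4, h5⟩ := hω
      refine ⟨hωD, ?_, le_cos_mul_exp_sub_one hκ (δ := δ) ?_ ?_ h5⟩
      · have h6 := mul_le_mul_of_nonneg_left (h1 hωB _ (hTH j)).2 (sq_nonneg (θ ω))
        refine h6.trans ?_
        have h7 : θ ω ^ 2 * (κ * (α T ω - α (H j) ω)) =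
            κ * (θ ω ^ 2 * α T ω - θ ω ^ 2 * α (H j) ω) := by ring
        rw [h7, hθα ω hωD]
        have h8 : 0 ≤ θ ω ^ 2 * α (H j) ω := mul_nonneg (sq_nonneg _) (h3 _).le
        nlinarith
      · nlinarith
      · have h6 := h2 _ _ (hTH j)
        have h7 : θ ω * (mart G M (H j) ω - mart G M T ω) - θ ω * (ϱ - Z T ω) =
            θ ω * ((mart G M (H j) ω - mart G M T ω) - (Z (H j) ω - Z T ω)) +
            θ ω * (Z (H j) ω - ϱ) := by ring
        rw [h7]
        refine (abs_add_le _ _).trans ?_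
        rw [abs_mul, abs_mul, abs_of_nonneg (hθ0 ω)]
        have h8 := mul_le_mul_of_nonneg_left h6 (hθ0 ω)
        have h9 := hθβ ω hωD
        linarith)
  have e1 : C₁ * P.real (D \ W j) ≤ c₀ / 4 * P.real D := by
    have := mul_le_mul_of_nonneg_left hDW (by linarith : 0 ≤ C₁)
    refine this.trans (le_of_eq ?_)
    rw [← hεC]; ring
  have e2 : C₂ * (3 * δ * (κ + δ)) ≤ c₀ / 4 := by
    have h1 : 3 * δ * (κ + δ) ≤ 3 * δ * (2 * κ) :=
      mul_le_mul_of_nonneg_left (by linarith) (by positivity)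
    have h2 := mul_le_mul_of_nonneg_left h1 (by linarith : 0 ≤ C₂)
    refine h2.trans (le_of_eq ?_)
    rw [← hδκ]; ring
  have e3 := mul_le_mul_of_nonneg_right e2 hPD0.le
  -- The cosine bound now reads `7/8 * c₀ ≤ c₀ / 4 + c₀ / 4` after division by `P D`.
  have e4 : (7 / 8) * P.real D ≤ P.real (W j) := by nlinarith
  have e5 := mul_le_mul_of_nonneg_left e4 hc₀0.le
  have e6 : 0 < c₀ * P.real D := by positivity
  linarith

end main

end FinVar

theorem mainTheorem3 {Ω : Type*} [mΩ : MeasurableSpace Ω] (P : Measure Ω) [IsProbabilityMeasure P]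
    (Z F G A M Λ Ap Am : ℝ≥0 → Ω → ℝ) (hZ : ∀ t, StronglyMeasurable (Z t))
    (hgood : FinVar.IsGood P (Filtration.natural Z hZ) Z F G A M Λ Ap Am)
    (ϱ : ℝ) (Γ : ℝ≥0 → Set Ω)
    (hΓ_meas : ∀ t, MeasurableSet[Filtration.natural Z hZ t] (Γ t))
    (hΓ_rat : ∀ t : ℝ≥0,
      (⋂ s ∈ Ici t, Γ s) = (⋂ s ∈ Ici t ∩ range (fun q : ℚ≥0 => (q : ℝ≥0)), Γ s))
    (hΓ_lim : ∀ᵐ ω ∂P, ω ∈ FinVar.eventuallyAlways Γ →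
      Tendsto (fun t => Z t ω) atTop (𝓝 ϱ))
    (α α' β : ℝ≥0 → Ω → ℝ)
    (hα_adapted : StronglyAdapted (Filtration.natural Z hZ) α)
    (hα'_adapted : StronglyAdapted (Filtration.natural Z hZ) α')
    (hβ_adapted : StronglyAdapted (Filtration.natural Z hZ) β)
    (hα_pos : ∀ᵐ ω ∂P, ∀ t, 0 < α t ω)
    (hβ_nonneg : ∀ᵐ ω ∂P, ∀ t, 0 ≤ β t ω)
    (hα_anti : ∀ᵐ ω ∂P, Antitone (fun t => α t ω))
    (hβ_anti : ∀ᵐ ω ∂P, Antitone (fun t => β t ω))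
    (hα_eq : ∀ᵐ ω ∂P, ∀ t, IntegrableOn (fun u => α' u ω) (Ioi t) FinVar.lebesgue ∧
      α t ω = ∫ u in Ioi t, α' u ω ∂FinVar.lebesgue)
    (hjump : ∀ᵐ ω ∂P, ∀ t, |FinVar.jump (fun u => Z u ω) t| ≤ β t ω)
    (htail : ∀ᵐ ω ∂P, ∀ t,
      ∫⁻ u in Ioi t, ENNReal.ofReal |Function.leftLim (fun r => F r ω) u|
        ∂(FinVar.stieltjesMeasure fun r => Ap r ω + Am r ω) ≤ ENNReal.ofReal (β t ω))
    (hβα : ∀ᵐ ω ∂P, Tendsto (fun t => β t ω / √(α t ω)) atTop (𝓝 0))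
    (κ : ℝ) (hκ : 1 ≤ κ)
    (hquad : ∀ᵐ ω ∂P, ∀ t, ω ∈ Γ t →
      1 / κ * α' t ω ≤ G t ω ^ 2 * Λ t ω ∧ G t ω ^ 2 * Λ t ω ≤ κ * α' t ω) :
    P (FinVar.eventuallyAlways Γ) = 0 := by
  refine (measure_biUnion_null_iff (to_countable _)).2 fun n hn => ?_
  refine FinVar.measure_eq_zero_of_tendsto (N := n) (ϱ := ϱ) hgood ?_ ?_ hα_adapted hβ_adapted hα_pos
    hβ_nonneg hβ_anti hα_eq hjump htail hβα hκ ?_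
  -- Passing to rational times makes the intersection countable, hence an event of the limit of the
  -- filtration along the integers.
  · rw [hΓ_rat]
    refine MeasurableSet.biInter ((countable_range _).mono inter_subset_right) fun s _ => ?_
    obtain ⟨k, hk⟩ := exists_nat_ge s
    exact le_iSup (fun k : ℕ => FinVar.natFiltration (Filtration.natural Z hZ) k) k _
      ((Filtration.natural Z hZ).mono hk _ (hΓ_meas s))
  · filter_upwards [hΓ_lim] with ω h1 hω
    exact h1 (mem_biUnion (show n ∈ {n : ℕ | 1 ≤ n} from hn) hω)
  · filter_upwards [hquad] with ω h1 hω t ht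
    exact h1 t (mem_iInter₂.1 hω t ht)
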